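/- **Setting.** Let $\mathcal C$ be a countably infinite set of constants, identified with $\mathbb N$ by a fixed bijection, so that finite objects over $\mathcal C$ have Gödel numbers. An *instance* over a finite relational schema $\mathcal R$ is a finite set of facts; $\mathrm{adom}(I)$ is the set of constants occurring in $I$. First-order queries are evaluated with quantifiers ranging over $\mathrm{adom}(I)$, and $\mathrm{ans}(Q,I)$ is the set of assignments $\theta$ of values in $\mathrm{adom}(I)$ to the free variables of $Q$ with $I\models Q\theta$. A *DCDS* $\mathcal S$ consists of a schema $\mathcal R$; an initial instance $I_0$; finitely many equality constraints $Q\to\bigwedge_j z_j=y_j$ ($z_j,y_j$ free variables of $Q$ or constants), all satisfied by $I_0$, where $I$ satisfies the constraint if $z_j\theta=y_j\theta$ for all $j$ and all $\theta\in\mathrm{ans}(Q,I)$; finitely many services (function symbols with arities); finitely many actions; and finitely many rules $Q\mapsto\alpha$, where $\alpha$ is an action and the free variables of $Q$ are exactly the parameters of $\alpha$. An action has a list of distinct parameters and finitely many effects $q^+\wedge Q^-\rightsquigarrow E$, with $q^+$ a union of conjunctive queries, $Q^-$ a first-order query whose free variables other than parameters are free in $q^+$, and $E$ a finite set of facts whose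 terms are constants, parameters, free variables of $q^+$, and service calls applied to such terms. All constants used are in $\mathrm{adom}(I_0)$. With *deterministic services*, the concrete transition system $\Upsilon_{\mathcal S}$ has as states pairs $\langle I,M\rangle$ of an instance and a partial map $M$ from ground service calls to $\mathcal C$, starting from $\langle I_0,\emptyset\rangle$. There is a transition $\langle I,M\rangle\Rightarrow\langle I',M'\rangle$ if for some rule $Q\mapsto\alpha$ and some $\sigma\in\mathrm{ans}(Q,I)$: $M'$ extends $M$ by arbitrary values for exactly those service calls outside the domain of $M$ that occur in the set $\mathrm{DO}(I,\alpha\sigma)$ of all $E\sigma\theta$, for effects $q^+\wedge Q^-\rightsquigarrow E$ of $\alpha$ and $\theta\in\mathrm{ans}((q^+\wedge Q^-)\sigma,I)$; $I'=M'(\mathrm{DO}(I,\alpha\sigma))$; and $I'$ satisfies the equality constraints. The states are those reachable from the initial one, and the database of $\langle I,M\rangle$ is $I$. $\mathcal S$ is *run-bounded* if there is $b$ such that along every finite or infinite run of $\Upsilon_{\mathcal S}$ from the initial state fewer than $b$ distinct values occur in the databases. Formulas of $\mu\mathcal L_A$ are $\Phi::=Q\mid\neg\Phi\mid\Phi\wedge\Phi\mid\exists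 x.\mathrm{LIVE}(x)\wedge\Phi\mid\langle-\rangle\Phi\mid Z\mid\mu Z.\Phi$, where $Q$ is a first-order query, $\mathrm{LIVE}(x)$ says that $x$ is in the active domain of the database of the current state, $\mu$ is the least fixpoint, and in $\mu Z.\Phi$ every free occurrence of $Z$ in $\Phi$ is under an even number of negations. A *property* of $\mathcal S$ is a closed $\mu\mathcal L_A$ formula with constants in $\mathrm{adom}(I_0)$, and $\mathcal S$ verifies $\Phi$ if $\Phi$ holds in the initial state of $\Upsilon_{\mathcal S}$, written $\Upsilon_{\mathcal S}\models\Phi$. For a finite-state transition system $\Theta$ labelled by instances, let $\mathrm{adom}(\Theta)$ be the finite set of values in its databases, and let $\mathrm{PROP}_\Theta(\Phi)$ be the propositional $\mu$-calculus formula obtained from $\Phi$ by replacing each $\exists x.\mathrm{LIVE}(x)\wedge\Psi(x)$ recursively by $\bigvee_{t\in\mathrm{adom}(\Theta)}\mathrm{LIVE}(t)\wedge\mathrm{PROP}_\Theta(\Psi(t))$; its atomic propositions are ground statements $\mathrm{LIVE}(t)$ and queries without free variables, each true at a state iff it holds in the database of that state. **Theorem.** 1. Verification of $\mu\mathcal L_A$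 properties on run-bounded DCDSs with deterministic services is decidable: there is an algorithm (a partial recursive function) that, for every run-bounded DCDS $\mathcal S$ and every property $\Phi$ of $\mathcal S$, halts on input $(\mathcal S,\Phi)$ and answers whether $\Upsilon_{\mathcal S}\models\Phi$. 2. It reduces effectively to model checking of the propositional $\mu$-calculus over a finite transition system: there is an algorithm such that for every run-bounded DCDS $\mathcal S$ there is a finite-state transition system $\Theta_{\mathcal S}$, labelled by instances over $\mathcal R$ with values in $\mathcal C$, such that for every property $\Phi$ of $\mathcal S$ the algorithm halts on input $(\mathcal S,\Phi)$ with output $(\Theta_{\mathcal S},\mathrm{PROP}_{\Theta_{\mathcal S}}(\Phi))$, the formula $\mathrm{PROP}_{\Theta_{\mathcal S}}(\Phi)$ is closed and syntactically monotone, and $$\Upsilon_{\mathcal S}\models\Phi\iff\Theta_{\mathcal S}\models\Phi\iff\Theta_{\mathcal S}\models\mathrm{PROP}_{\Theta_{\mathcal S}}(\Phi).$$ -/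

import Mathlib

namespace DataCentric

/-! ### Relational data and first-order queries -/

/-- A relation symbol (the index of a relation of the schema) applied to a list of arguments. -/
structure RelAtom (T : Type*) where
  rel : ℕ
  args : List T

/-- A fact: a relation symbol applied to constants. -/
abbrev Fact (C : Type*) := RelAtom C

/-- Database instances are sets of facts. The instances that occur below are finite, since the
initial instance is a finite list of facts and every action derives finitely many facts. -/
abbrev Instance (C : Type*) := Set (Fact C)

/-- A schema is the list of the arities of its relations; relation `r` is the `r`-th entry. -/
abbrev Schema := List ℕ

/-- The atom uses a relation of the schema with the right number of arguments. -/
def RelAtom.Conforms {T : Type*} (R : Schema) (a : RelAtom T) : Prop :=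
  R[a.rel]? = some a.args.length

/-- The active domain: the constants that occur in the instance. -/
def adom {C : Type*} (I : Instance C) : Set C := {c | ∃ f ∈ I, c ∈ f.args}

/-- Terms of queries: individual variables (named by numbers) and constants. -/
inductive Term (C : Type*) where
  | var (x : ℕ)
  | const (c : C)

namespace Term
variable {C : Type*}

def eval (v : ℕ → C) : Term C → C
  | var x => v x
  | const c => c

def vars : Term C → Set ℕ
  | var x => {x}
  | const _ => ∅

def consts : Term C → Set C
  | var _ => ∅
  | const c => {c}

/-- Simultaneous substitution of terms for variables. -/
def subst (σ : ℕ → Term C) : Term C → Term C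
  | var x => σ x
  | const c => const c

end Term

/-- First-order queries. -/
inductive Query (C : Type*) where
  | tru
  | rel (a : RelAtom (Term C))
  | eq (t u : Term C)
  | neg (q : Query C)
  | and (q r : Query C)
  | or (q r : Query C)
  | ex (x : ℕ) (q : Query C)

namespace Query
variable {C : Type*}

/-- `I ⊨ q` under the valuation `v`; quantified variables range over the active domain of `I`. -/
def Holds (I : Instance C) : (ℕ → C) → Query C → Prop
  | _, tru => True
  | v, rel a => (⟨a.rel, a.args.map (Term.eval v)⟩ : Fact C) ∈ I
  | v, eq t u => t.eval v = u.eval v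
  | v, neg q => ¬ Holds I v q
  | v, and q r => Holds I v q ∧ Holds I v r
  | v, or q r => Holds I v q ∨ Holds I v r
  | v, ex x q => ∃ c ∈ adom I, Holds I (Function.update v x c) q

/-- Free variables. -/
def fv : Query C → Set ℕ
  | tru => ∅
  | rel a => {x | ∃ t ∈ a.args, x ∈ t.vars}
  | eq t u => t.vars ∪ u.vars
  | neg q => fv q
  | and q r => fv q ∪ fv r
  | or q r => fv q ∪ fv r
  | ex x q => fv q \ {x}

def consts : Query C → Set C
  | tru => ∅
  | rel a => {c | ∃ t ∈ a.args, c ∈ t.consts}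
  | eq t u => t.consts ∪ u.consts
  | neg q => consts q
  | and q r => consts q ∪ consts r
  | or q r => consts q ∪ consts r
  | ex _ q => consts q

/-- All relational atoms of the query conform to the schema. -/
def Conforms (R : Schema) : Query C → Prop
  | tru => True
  | rel a => a.Conforms R
  | eq _ _ => True
  | neg q => Conforms R q
  | and q r => Conforms R q ∧ Conforms R r
  | or q r => Conforms R q ∧ Conforms R r
  | ex _ q => Conforms R q

/-- Conjunctive queries: built from atoms with conjunction and existential quantification. -/
def IsCQ : Query C → Prop
  | tru => True
  | rel _ => True
  | eq _ _ => True
  | neg _ => False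
  | and q r => IsCQ q ∧ IsCQ r
  | or _ _ => False
  | ex _ q => IsCQ q

/-- Unions of conjunctive queries. -/
def IsUCQ : Query C → Prop
  | or q r => IsUCQ q ∧ IsUCQ r
  | q => IsCQ q

/-- Substitution of terms for the free variables. It is used only to replace variables by constants
(all other variables are mapped to themselves), so that no variable is captured. -/
def subst : (ℕ → Term C) → Query C → Query C
  | _, tru => tru
  | σ, rel a => rel ⟨a.rel, a.args.map (Term.subst σ)⟩
  | σ, eq t u => eq (t.subst σ) (u.subst σ)
  | σ, neg q => neg (subst σ q)
  | σ, and q r => and (subst σ q) (subst σ r)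
  | σ, or q r => or (subst σ q) (subst σ r)
  | σ, ex x q => ex x (subst (Function.update σ x (Term.var x)) q)

/-- The answers of `q` over `I`: assignments of values of the active domain of `I` to the free
variables of `q` that make `q` true (the values at all other variables are irrelevant). -/
def ans (q : Query C) (I : Instance C) : Set (ℕ → C) :=
  {θ | (∀ x ∈ q.fv, θ x ∈ adom I) ∧ q.Holds I θ}

end Query

/-! ### Data-centric dynamic systems -/

/-- An equality constraint: a query that implies a conjunction of equalities between terms. -/
structure EqConstraint (C : Type*) where
  query : Query C
  eqs : List (Term C × Term C)

def EqConstraint.Sat {C : Type*} (ec : EqConstraint C) (I : Instance C) : Prop :=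
  ∀ θ ∈ ec.query.ans I, ∀ e ∈ ec.eqs, e.1.eval θ = e.2.eval θ

/-- Terms of effects: variables, parameters, constants, and calls of a service
(named by its index) on such terms. -/
inductive EffTerm (C : Type*) where
  | base (t : Term C)
  | call (f : ℕ) (args : List (Term C))

namespace EffTerm
variable {C : Type*}

def vars : EffTerm C → Set ℕ
  | base t => t.vars
  | call _ args => {x | ∃ t ∈ args, x ∈ t.vars}

def consts : EffTerm C → Set C
  | base t => t.consts
  | call _ args => {c | ∃ t ∈ args, c ∈ t.consts}

/-- Service calls use a declared service with the right number of arguments. -/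
def Conforms (F : List ℕ) : EffTerm C → Prop
  | base _ => True
  | call f args => F[f]? = some args.length

end EffTerm

/-- Ground terms: constants and ground service calls. -/
inductive GroundTerm (C : Type*) where
  | val (c : C)
  | call (f : ℕ) (args : List C)

def EffTerm.ground {C : Type*} (θ : ℕ → C) : EffTerm C → GroundTerm C
  | .base t => .val (t.eval θ)
  | .call f args => .call f (args.map (Term.eval θ))

/-- An effect specification `qpos ∧ qneg ⇝ facts`. -/
structure Effect (C : Type*) where
  qpos : Query C
  qneg : Query C
  facts : List (RelAtom (EffTerm C))

/-- An action: its input parameters (which are variables) and its effect specifications. -/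
structure Action (C : Type*) where
  params : List ℕ
  effects : List (Effect C)

/-- A condition-action rule; the action is given by its index in the list of actions. -/
structure Rule (C : Type*) where
  cond : Query C
  action : ℕ

/-- The finite syntactic description of a data-centric dynamic system over the set of constants
`C`: schema, equality constraints, initial instance, services (given by their arities), actions
and condition-action rules. -/
structure DCDS (C : Type*) where
  schema : Schema
  constraints : List (EqConstraint C)
  init : List (Fact C)
  services : List ℕ
  actions : List (Action C)
  rules : List (Rule C)

/-- The ground facts `DO(I, ασ)`. -/
def Action.doo {C : Type*} (α : Action C) (σ : ℕ → C) (I : Instance C) :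
    Set (RelAtom (GroundTerm C)) :=
  {g | ∃ e ∈ α.effects, ∃ θ : ℕ → C,
      (∀ p ∈ α.params, θ p = σ p) ∧
      (∀ x ∈ (e.qpos.and e.qneg).fv, x ∉ α.params → θ x ∈ adom I) ∧
      (e.qpos.and e.qneg).Holds I θ ∧
      ∃ E ∈ e.facts, g = ⟨E.rel, E.args.map (EffTerm.ground θ)⟩}

/-- Service call maps: partial functions from service calls to constants. -/
abbrev CallMap (C : Type*) := ℕ × List C → Option C

/-- The value of a ground term under a service call map. -/
def GroundTerm.value {C : Type*} (M : CallMap C) : GroundTerm C → Option C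
  | .val c => some c
  | .call f args => M (f, args)

/-- The instance `M(E)` obtained by applying a service call map to a set of ground facts. -/
def CallMap.apply {C : Type*} (M : CallMap C) (E : Set (RelAtom (GroundTerm C))) : Instance C :=
  {f | ∃ g ∈ E, f.rel = g.rel ∧ List.Forall₂ (fun t c => t.value M = some c) g.args f.args}

/-- `M'` is a possible result of issuing the service calls occurring in `E`: it keeps the
results stored in `M`, and assigns arbitrary values to exactly the new calls. -/
def CallMap.Calls {C : Type*} (M : CallMap C) (E : Set (RelAtom (GroundTerm C)))
    (M' : CallMap C) : Prop :=
  (∀ t c, M t = some c → M' t = some c) ∧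
  ∀ t, (M' t).isSome ↔ (M t).isSome ∨ ∃ g ∈ E, GroundTerm.call t.1 t.2 ∈ g.args

/-- Concrete states: an instance together with the results of all service calls made so far. -/
structure CState (C : Type*) where
  inst : Instance C
  map : CallMap C

/-- Transition systems whose states are labelled by database instances over `C`. -/
structure TransitionSystem (C : Type*) where
  State : Type*
  init : State
  db : State → Instance C
  Step : State → State → Prop

namespace TransitionSystem
variable {C : Type*}

/-- Runs of length `ℓ`, which is a number of transitions or `∞`:
`τ i` is the `i`-th state, for `i ≤ ℓ`. -/
def IsRun (T : TransitionSystem C) (ℓ : ℕ∞) (τ : ℕ → T.State) : Prop :=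
  τ 0 = T.init ∧ ∀ i : ℕ, (i : ℕ∞) < ℓ → T.Step (τ i) (τ (i + 1))

/-- There is one bound for the number of values occurring along every finite or infinite run. -/
def RunBounded (T : TransitionSystem C) : Prop :=
  ∃ b : ℕ, ∀ (ℓ : ℕ∞) (τ : ℕ → T.State), T.IsRun ℓ τ →
    {c : C | ∃ i : ℕ, (i : ℕ∞) ≤ ℓ ∧ c ∈ adom (T.db (τ i))}.encard < b

end TransitionSystem

namespace DCDS
variable {C : Type*}

/-- The initial instance. -/
def initInst (S : DCDS C) : Instance C := {f | f ∈ S.init}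

/-- The instance satisfies all equality constraints. -/
def SatConstraints (S : DCDS C) (I : Instance C) : Prop := ∀ ec ∈ S.constraints, ec.Sat I

/-- The description is a data-centric dynamic system: everything conforms to the schema, all
constants are from the active domain of the initial instance, the initial instance satisfies the
equality constraints, and variables are used as they should be. -/
structure WellFormed (S : DCDS C) : Prop where
  init_conforms : ∀ f ∈ S.init, f.Conforms S.schema
  init_sat : S.SatConstraints S.initInst
  constraint_query : ∀ ec ∈ S.constraints,
    ec.query.Conforms S.schema ∧ ec.query.consts ⊆ adom S.initInst
  constraint_eqs : ∀ ec ∈ S.constraints, ∀ e ∈ ec.eqs,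
    e.1.vars ∪ e.2.vars ⊆ ec.query.fv ∧ e.1.consts ∪ e.2.consts ⊆ adom S.initInst
  params_nodup : ∀ α ∈ S.actions, α.params.Nodup
  effect_query : ∀ α ∈ S.actions, ∀ e ∈ α.effects,
    e.qpos.IsUCQ ∧ e.qpos.Conforms S.schema ∧ e.qneg.Conforms S.schema ∧
    e.qpos.consts ∪ e.qneg.consts ⊆ adom S.initInst ∧
    e.qneg.fv ⊆ e.qpos.fv ∪ {p | p ∈ α.params}
  effect_facts : ∀ α ∈ S.actions, ∀ e ∈ α.effects, ∀ E ∈ e.facts,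
    E.Conforms S.schema ∧ ∀ t ∈ E.args,
      t.Conforms S.services ∧ t.consts ⊆ adom S.initInst ∧
      t.vars ⊆ e.qpos.fv ∪ {p | p ∈ α.params}
  rule : ∀ r ∈ S.rules,
    r.cond.Conforms S.schema ∧ r.cond.consts ⊆ adom S.initInst ∧
    ∃ α, S.actions[r.action]? = some α ∧ r.cond.fv = {p | p ∈ α.params}

/-- Concrete action execution: some rule allows some action with a legal parameter
assignment `σ`, and `s'` is a possible result of this action. -/
def Exec (S : DCDS C) (s s' : CState C) : Prop :=
  ∃ r ∈ S.rules, ∃ α, S.actions[r.action]? = some α ∧ ∃ σ ∈ r.cond.ans s.inst,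
    s.map.Calls (α.doo σ s.inst) s'.map ∧
    s'.inst = s'.map.apply (α.doo σ s.inst) ∧
    S.SatConstraints s'.inst

/-- The initial concrete state, with the empty service call map. -/
def initState (S : DCDS C) : CState C := ⟨S.initInst, fun _ => none⟩

/-- The states of the concrete transition system: the smallest set that contains the initial
state and is closed under action execution. -/
inductive Reachable (S : DCDS C) : CState C → Prop
  | init : Reachable S S.initState
  | step {s s' : CState C} : Reachable S s → S.Exec s s' → Reachable S s'

/-- The concrete transition system, with deterministic services. -/
def cts (S : DCDS C) : TransitionSystem C where
  State := {s : CState C // S.Reachable s}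
  init := ⟨S.initState, Reachable.init⟩
  db s := s.1.inst
  Step s s' := S.Exec s.1 s'.1

end DCDS

/-! ### The history preserving first-order mu-calculus -/

/-- Formulas of `μL_A`. `exLive x Φ` is `∃ x. LIVE(x) ∧ Φ`; predicate variables are numbers. -/
inductive MuLA (C : Type*) where
  | query (q : Query C)
  | neg (Φ : MuLA C)
  | and (Φ Ψ : MuLA C)
  | exLive (x : ℕ) (Φ : MuLA C)
  | dia (Φ : MuLA C)
  | pvar (Z : ℕ)
  | mu (Z : ℕ) (Φ : MuLA C)

namespace MuLA
variable {C : Type*}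

/-- The extension of a formula under an individual and a predicate variable valuation. -/
def ext (T : TransitionSystem C) : (ℕ → C) → (ℕ → Set T.State) → MuLA C → Set T.State
  | v, _, query q => {s | q.Holds (T.db s) v}
  | v, V, neg Φ => (ext T v V Φ)ᶜ
  | v, V, and Φ Ψ => ext T v V Φ ∩ ext T v V Ψ
  | v, V, exLive x Φ => {s | ∃ c ∈ adom (T.db s), s ∈ ext T (Function.update v x c) V Φ}
  | v, V, dia Φ => {s | ∃ s', T.Step s s' ∧ s' ∈ ext T v V Φ}
  | _, V, pvar Z => V Z
  | v, V, mu Z Φ => ⋂₀ {E | ext T v (Function.update V Z E) Φ ⊆ E}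

/-- Free individual variables. -/
def fv : MuLA C → Set ℕ
  | query q => q.fv
  | neg Φ => fv Φ
  | and Φ Ψ => fv Φ ∪ fv Ψ
  | exLive x Φ => fv Φ \ {x}
  | dia Φ => fv Φ
  | pvar _ => ∅
  | mu _ Φ => fv Φ

/-- Free predicate variables. -/
def fpv : MuLA C → Set ℕ
  | query _ => ∅
  | neg Φ => fpv Φ
  | and Φ Ψ => fpv Φ ∪ fpv Ψ
  | exLive _ Φ => fpv Φ
  | dia Φ => fpv Φ
  | pvar Z => {Z}
  | mu Z Φ => fpv Φ \ {Z}

def consts : MuLA C → Set C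
  | query q => q.consts
  | neg Φ => consts Φ
  | and Φ Ψ => consts Φ ∪ consts Ψ
  | exLive _ Φ => consts Φ
  | dia Φ => consts Φ
  | pvar _ => ∅
  | mu _ Φ => consts Φ

/-- `Parity Z true Φ` (`Parity Z false Φ`): every free occurrence of the predicate variable `Z`
in `Φ` is in the scope of an even (odd) number of negations. -/
def Parity (Z : ℕ) : Bool → MuLA C → Prop
  | _, query _ => True
  | p, neg Φ => Parity Z (!p) Φ
  | p, and Φ Ψ => Parity Z p Φ ∧ Parity Z p Ψ
  | p, exLive _ Φ => Parity Z p Φ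
  | p, dia Φ => Parity Z p Φ
  | p, pvar Y => Y = Z → p = true
  | p, mu Y Φ => Y = Z ∨ Parity Z p Φ

/-- Syntactic monotonicity of all fixpoint subformulas. -/
def SynMono : MuLA C → Prop
  | query _ => True
  | neg Φ => SynMono Φ
  | and Φ Ψ => SynMono Φ ∧ SynMono Ψ
  | exLive _ Φ => SynMono Φ
  | dia Φ => SynMono Φ
  | pvar _ => True
  | mu Z Φ => Parity Z true Φ ∧ SynMono Φ

/-- Closed syntactically monotone formulas. -/
def IsSentence (Φ : MuLA C) : Prop := Φ.fv = ∅ ∧ Φ.fpv = ∅ ∧ Φ.SynMono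

end MuLA

/-- A closed formula holds in the initial state (its extension is independent of the
valuations). -/
def TransitionSystem.Satisfies {C : Type*} (T : TransitionSystem C) (Φ : MuLA C) : Prop :=
  ∀ v V, T.init ∈ Φ.ext T v V

/-! ### The propositional mu-calculus -/

/-- Kripke structures with atomic propositions in `A`. -/
structure Kripke (A : Type*) where
  State : Type*
  init : State
  Step : State → State → Prop
  True_at : State → A → Prop

/-- Formulas of the propositional mu-calculus over the atomic propositions `A`. -/
inductive PropMu (A : Type*) where
  | tru
  | atom (a : A)
  | neg (φ : PropMu A)
  | and (φ ψ : PropMu A)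
  | dia (φ : PropMu A)
  | pvar (Z : ℕ)
  | mu (Z : ℕ) (φ : PropMu A)

namespace PropMu
variable {A : Type*}

def ext (K : Kripke A) : (ℕ → Set K.State) → PropMu A → Set K.State
  | _, tru => Set.univ
  | _, atom a => {s | K.True_at s a}
  | V, neg φ => (ext K V φ)ᶜ
  | V, and φ ψ => ext K V φ ∩ ext K V ψ
  | V, dia φ => {s | ∃ s', K.Step s s' ∧ s' ∈ ext K V φ}
  | V, pvar Z => V Z
  | V, mu Z φ => ⋂₀ {E | ext K (Function.update V Z E) φ ⊆ E}

/-- Free predicate variables. -/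
def fpv : PropMu A → Set ℕ
  | tru => ∅
  | atom _ => ∅
  | neg φ => fpv φ
  | and φ ψ => fpv φ ∪ fpv ψ
  | dia φ => fpv φ
  | pvar Z => {Z}
  | mu Z φ => fpv φ \ {Z}

/-- `Parity Z true φ` (`Parity Z false φ`): every free occurrence of the predicate variable `Z`
in `φ` is in the scope of an even (odd) number of negations. -/
def Parity (Z : ℕ) : Bool → PropMu A → Prop
  | _, tru => True
  | _, atom _ => True
  | p, neg φ => Parity Z (!p) φ
  | p, and φ ψ => Parity Z p φ ∧ Parity Z p ψ
  | p, dia φ => Parity Z p φ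
  | p, pvar Y => Y = Z → p = true
  | p, mu Y φ => Y = Z ∨ Parity Z p φ

/-- Syntactic monotonicity of all fixpoint subformulas. -/
def SynMono : PropMu A → Prop
  | tru => True
  | atom _ => True
  | neg φ => SynMono φ
  | and φ ψ => SynMono φ ∧ SynMono ψ
  | dia φ => SynMono φ
  | pvar _ => True
  | mu Z φ => Parity Z true φ ∧ SynMono φ

/-- Closed syntactically monotone formulas. -/
def IsSentence (φ : PropMu A) : Prop := φ.fpv = ∅ ∧ φ.SynMono

def or (φ ψ : PropMu A) : PropMu A := neg (and (neg φ) (neg ψ))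

/-- Finite disjunctions; the empty one is false. -/
def disj (l : List (PropMu A)) : PropMu A := l.foldr or (neg tru)

end PropMu

/-- A closed formula holds in the initial state (its extension is independent of the valuation). -/
def Kripke.Satisfies {A : Type*} (K : Kripke A) (φ : PropMu A) : Prop :=
  ∀ V, K.init ∈ φ.ext K V

/-- The atomic propositions used for grounding: boolean queries, and `LIVE(c)`. -/
inductive GroundProp (C : Type*) where
  | query (q : Query C)
  | live (c : C)

/-- The propositional reading of a transition system: a boolean query is true at a state iff it
holds in its database, and `LIVE(c)` is true iff `c` is in the active domain of its database. -/
def TransitionSystem.toKripke {C : Type*} (T : TransitionSystem C) : Kripke (GroundProp C) where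
  State := T.State
  init := T.init
  Step := T.Step
  True_at
    | s, .query q => ∀ v, q.Holds (T.db s) v
    | s, .live c => c ∈ adom (T.db s)

/-- Grounding of the quantifiers over the finite list `D` of values:
`∃ x. LIVE(x) ∧ Ψ(x)` becomes the disjunction of `LIVE(t) ∧ Ψ(t)` over the `t` in `D`. The
argument `σ` records the values that replace the variables quantified so far. -/
def MuLA.groundAux {C : Type*} (D : List C) : (ℕ → Term C) → MuLA C → PropMu (GroundProp C)
  | σ, query q => .atom (.query (q.subst σ))
  | σ, neg Φ => .neg (groundAux D σ Φ)
  | σ, and Φ Ψ => .and (groundAux D σ Φ) (groundAux D σ Ψ)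
  | σ, exLive x Φ => .disj (D.map fun t =>
      .and (.atom (.live t)) (groundAux D (Function.update σ x (Term.const t)) Φ))
  | σ, dia Φ => .dia (groundAux D σ Φ)
  | _, pvar Z => .pvar Z
  | σ, mu Z Φ => .mu Z (groundAux D σ Φ)

/-- The propositional formula obtained from `Φ` by grounding its quantifiers over `D`. -/
def MuLA.ground {C : Type*} (D : List C) (Φ : MuLA C) : PropMu (GroundProp C) :=
  Φ.groundAux D Term.var

/-! ### Finite transition systems -/

/-- Finite descriptions of finite transition systems: the label of the initial state, the labels of
the other states, and the list of transitions. -/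
structure FinTS (C : Type*) where
  initLabel : List (Fact C)
  labels : List (List (Fact C))
  edges : List (ℕ × ℕ)

namespace FinTS
variable {C : Type*}

/-- The transition system described: its states are `0, …, n`, where `n` is the number of
non-initial states and `0` is the initial state. -/
def toTS (F : FinTS C) : TransitionSystem C where
  State := Fin (F.initLabel :: F.labels).length
  init := ⟨0, Nat.succ_pos _⟩
  db s := {f | f ∈ (F.initLabel :: F.labels).get s}
  Step s s' := (s.1, s'.1) ∈ F.edges

/-- A list of the values that occur in the databases of the states (with repetitions). -/
def adomList (F : FinTS C) : List C := (F.initLabel :: F.labels).flatten.flatMap RelAtom.args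

/-- All facts in the databases of the states conform to the schema. -/
def Conforms (F : FinTS C) (R : Schema) : Prop :=
  ∀ l ∈ F.initLabel :: F.labels, ∀ f ∈ l, f.Conforms R

end FinTS

/-! ### Gödel numbers of the finite objects, the inputs and outputs of algorithms -/

/-- The code of a list whose entries have the codes `code a`. -/
def codeList {α : Type*} (code : α → ℕ) (l : List α) : ℕ := Encodable.encode (l.map code)

def RelAtom.code {T : Type*} (code : T → ℕ) (a : RelAtom T) : ℕ :=
  Nat.pair a.rel (codeList code a.args)

section Codes
variable {C : Type*} [Encodable C]

def Fact.code (f : Fact C) : ℕ := RelAtom.code Encodable.encode f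

def Term.code : Term C → ℕ
  | var x => Nat.pair 0 x
  | const c => Nat.pair 1 (Encodable.encode c)

def Query.code : Query C → ℕ
  | tru => Nat.pair 0 0
  | rel a => Nat.pair 1 (a.code Term.code)
  | eq t u => Nat.pair 2 (Nat.pair t.code u.code)
  | neg q => Nat.pair 3 q.code
  | and q r => Nat.pair 4 (Nat.pair q.code r.code)
  | or q r => Nat.pair 5 (Nat.pair q.code r.code)
  | ex x q => Nat.pair 6 (Nat.pair x q.code)

def EqConstraint.code (ec : EqConstraint C) : ℕ :=
  Nat.pair ec.query.code (codeList (fun e => Nat.pair e.1.code e.2.code) ec.eqs)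

def EffTerm.code : EffTerm C → ℕ
  | base t => Nat.pair 0 t.code
  | call f args => Nat.pair 1 (Nat.pair f (codeList Term.code args))

def Effect.code (e : Effect C) : ℕ :=
  Nat.pair e.qpos.code (Nat.pair e.qneg.code (codeList (RelAtom.code EffTerm.code) e.facts))

def Action.code (α : Action C) : ℕ :=
  Nat.pair (codeList id α.params) (codeList Effect.code α.effects)

def Rule.code (r : Rule C) : ℕ := Nat.pair r.cond.code r.action

def DCDS.code (S : DCDS C) : ℕ :=
  Nat.pair (codeList id S.schema) <| Nat.pair (codeList EqConstraint.code S.constraints) <|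
  Nat.pair (codeList Fact.code S.init) <| Nat.pair (codeList id S.services) <|
  Nat.pair (codeList Action.code S.actions) (codeList Rule.code S.rules)

def MuLA.code : MuLA C → ℕ
  | query q => Nat.pair 0 q.code
  | neg Φ => Nat.pair 1 Φ.code
  | and Φ Ψ => Nat.pair 2 (Nat.pair Φ.code Ψ.code)
  | exLive x Φ => Nat.pair 3 (Nat.pair x Φ.code)
  | dia Φ => Nat.pair 4 Φ.code
  | pvar Z => Nat.pair 5 Z
  | mu Z Φ => Nat.pair 6 (Nat.pair Z Φ.code)

def GroundProp.code : GroundProp C → ℕ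
  | query q => Nat.pair 0 q.code
  | live c => Nat.pair 1 (Encodable.encode c)

def PropMu.code : PropMu (GroundProp C) → ℕ
  | tru => Nat.pair 0 0
  | atom a => Nat.pair 1 a.code
  | neg φ => Nat.pair 2 φ.code
  | and φ ψ => Nat.pair 3 (Nat.pair φ.code ψ.code)
  | dia φ => Nat.pair 4 φ.code
  | pvar Z => Nat.pair 5 Z
  | mu Z φ => Nat.pair 6 (Nat.pair Z φ.code)

def FinTS.code (F : FinTS C) : ℕ :=
  Nat.pair (codeList Fact.code F.initLabel) <|
  Nat.pair (codeList (codeList Fact.code) F.labels)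
    (codeList (fun e => Nat.pair e.1 e.2) F.edges)

end Codes

end DataCentric

/-! The concrete transition system is infinite only because new service calls may return any
constant. A DCDS is generic: a permutation of the constants that fixes the initial active domain
maps transitions to transitions (`WellFormed.exec_rename`). It should therefore suffice to let calls
return values from a finite set `D`, provided that `D` always has room for pairwise distinct fresh
results next to all values that the current state refers to.

This condition is `DCDS.Complete a k`: the states reachable in at most `k` steps with results in `D
= S.dom a` are closed under such steps, and each leaves enough room in `D`. It is decidable, and it
alone implies exactness. Given a concrete step, carried over by the renaming `π` of the current
state, a second permutation fixes the old values and moves the new results into `D`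
(`WellFormed.exists_rename_into`). The composed renaming agrees with `π` on the history, that is, on
the initial constants and all results so far. The finite system is thus related to the concrete one
by a history preserving bisimulation, and these preserve `μL_A` (`IsHistoryBisim.mem_ext_iff`): a
quantifier shrinks the bisimulation to the states that remember the chosen value, and least
fixpoints are compared by induction on the fixpoint of the product operator.

Run-boundedness serves only to make the search for `a` and `k` end (`WellFormed.exists_complete`).
Each result of a call occurs in the next instance, so a reachable state refers to fewer than `b`
values. The number of new calls in a step is then bounded by some `K`, and `S.dom (b + K)` has room
everywhere. Over this finite domain there are finitely many states, so the layers stabilise.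

Hence one algorithm searches for a complete layer and lists it as a finite system `F`
(`exists_abstraction_algorithm`). Grounding the quantifiers over the values of `F` gives the
reduction (`MuLA.ext_groundAux`), and evaluating the formula over the subsets of the finite state
set gives the decision (`MuLA.ext_toTS`).

Computability is handled as in realizability: elements have numbers as names, and a function is
`Tracked` if a program maps names of arguments to names of values. Closure under composition,
currying, recursion on lists, finite sets and syntax trees reduces most computability proofs to
unfolding a definition and calling `fun_prop`. -/

namespace DataCentric
set_option linter.unusedSectionVars false

open Nat.Partrec (Code)
open Encodable Denumerable

/-! ### Represented types and tracked functions -/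

/-- A type whose elements have natural numbers as (not necessarily unique) names. -/
class Represented (α : Type*) where
  Names : ℕ → α → Prop

open Represented (Names)

/-- Every element has a name. -/
class Named (α : Type*) [Represented α] : Prop where
  exists_name : ∀ x : α, ∃ n, Names n x

section Basic
variable {α β γ δ : Type*} [Represented α] [Represented β] [Represented γ] [Represented δ]

/-- Some partial recursive function maps the names of arguments to names of values. -/
@[fun_prop]
def Tracked (f : α → β) : Prop :=
  ∃ φ : ℕ →. ℕ, Partrec φ ∧ ∀ n x, Names n x → ∃ m ∈ φ n, Names m (f x)

instance : Represented ℕ := ⟨fun n m => n = m⟩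

instance : Represented Prop := ⟨fun n p => (n = 1 ∧ p) ∨ (n = 0 ∧ ¬ p)⟩

instance : Represented (α × β) := ⟨fun n p => Names n.unpair.1 p.1 ∧ Names n.unpair.2 p.2⟩

instance : Represented (List α) := ⟨fun n l => List.Forall₂ Names (ofNat (List ℕ) n) l⟩

/-- A name of a set is a name of a list of its elements; only finite sets have names. -/
instance : Represented (Set α) := ⟨fun n A => ∃ l : List α, Names n l ∧ A = {x | x ∈ l}⟩

/-- A name of a function is the number of any program that realizes it. Functions without a program
have no name, hence there is no `Named` instance for function types. -/
instance : Represented (α → β) :=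
  ⟨fun e f => ∀ n x, Names n x → ∃ m ∈ (ofNat Code e).eval n, Names m (f x)⟩

instance : Named ℕ := ⟨fun x => ⟨x, rfl⟩⟩

instance : Named Prop := ⟨fun p => by
  by_cases h : p
  exacts [⟨1, .inl ⟨rfl, h⟩⟩, ⟨0, .inr ⟨rfl, h⟩⟩]⟩

theorem names_pair {m n : ℕ} {x : α} {y : β} (hx : Names m x) (hy : Names n y) :
    Names (Nat.pair m n) (x, y) := by
  show Names _ _ ∧ Names _ _
  simpa using ⟨hx, hy⟩

theorem names_pair_iff {m n : ℕ} {p : α × β} :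
    Names (Nat.pair m n) p ↔ Names m p.1 ∧ Names n p.2 := by
  show Names _ _ ∧ Names _ _ ↔ _
  simp

theorem names_fst {n : ℕ} {p : α × β} (h : Names n p) : Names n.unpair.1 p.1 := h.1

theorem names_snd {n : ℕ} {p : α × β} (h : Names n p) : Names n.unpair.2 p.2 := h.2

theorem names_list_iff {n : ℕ} {l : List α} :
    Names n l ↔ List.Forall₂ Names (ofNat (List ℕ) n) l := Iff.rfl

theorem names_nil : Names 0 ([] : List α) := by simp [names_list_iff]

theorem names_cons_iff {n : ℕ} {x : α} {l : List α} :
    Names n (x :: l) ↔ ∃ a b, n = Nat.succ (Nat.pair a b) ∧ Names a x ∧ Names b l := by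
  cases n with
  | zero => simp [names_list_iff]
  | succ n =>
    simp only [names_list_iff, list_ofNat_succ, List.forall₂_cons, ofNat_nat]
    constructor
    · rintro ⟨h1, h2⟩
      exact ⟨n.unpair.1, n.unpair.2, by simp, h1, h2⟩
    · rintro ⟨a, b, h, h1, h2⟩
      obtain rfl : n = Nat.pair a b := by simpa using h
      simpa using ⟨h1, h2⟩

theorem names_nil_iff {n : ℕ} : Names n ([] : List α) ↔ n = 0 := by
  cases n <;> simp [names_list_iff]

theorem names_set_of_list {n : ℕ} {l : List α} (h : Names n l) : Names n {x | x ∈ l} :=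
  ⟨l, h, rfl⟩

instance [Named α] [Named β] : Named (α × β) := ⟨fun p =>
  let ⟨m, hm⟩ := Named.exists_name p.1
  let ⟨n, hn⟩ := Named.exists_name p.2
  ⟨Nat.pair m n, names_pair hm hn⟩⟩

instance [Named α] : Named (List α) := ⟨fun l => by
  induction l with
  | nil => exact ⟨0, names_nil⟩
  | cons x l ih =>
    obtain ⟨m, hm⟩ := Named.exists_name x
    obtain ⟨n, hn⟩ := ih
    exact ⟨_, names_cons_iff.2 ⟨m, n, rfl, hm, hn⟩⟩⟩

theorem Tracked.of_computable {f : α → β} (φ : ℕ → ℕ) (hφ : Computable φ)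
    (h : ∀ n x, Names n x → Names (φ n) (f x)) : Tracked f :=
  ⟨φ, hφ.partrec, fun n x hn => ⟨φ n, Part.mem_some _, h n x hn⟩⟩

@[fun_prop]
theorem Tracked.id : Tracked fun x : α => x := .of_computable _ Computable.id fun _ _ h => h

theorem Tracked.const_of_names {y : β} {m : ℕ} (hm : Names m y) : Tracked fun _ : α => y :=
  .of_computable _ (Computable.const m) fun _ _ _ => hm

@[fun_prop]
theorem Tracked.const [Named β] (y : β) : Tracked fun _ : α => y :=
  let ⟨_, hm⟩ := Named.exists_name y
  .const_of_names hm

@[fun_prop]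
theorem Tracked.comp {g : β → γ} {f : α → β} (hg : Tracked g) (hf : Tracked f) :
    Tracked fun x => g (f x) := by
  obtain ⟨φ, hφ, hf⟩ := hf
  obtain ⟨ψ, hψ, hg⟩ := hg
  refine ⟨fun n => (φ n).bind ψ, hφ.bind (hψ.comp Computable.snd), fun n x hn => ?_⟩
  obtain ⟨m, hm, hmx⟩ := hf n x hn
  obtain ⟨k, hk, hkx⟩ := hg m _ hmx
  exact ⟨k, Part.mem_bind hm hk, hkx⟩

theorem _root_.Computable.natPair {α : Type*} [Primcodable α] {f g : α → ℕ}
    (hf : Computable f) (hg : Computable g) : Computable fun x => Nat.pair (f x) (g x) :=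
  (Primrec₂.natPair.to_comp).comp hf hg

theorem _root_.Computable.fst_unpair {α : Type*} [Primcodable α] {f : α → ℕ}
    (hf : Computable f) : Computable fun x => (f x).unpair.1 :=
  Computable.fst.comp (Computable.unpair.comp hf)

theorem _root_.Computable.snd_unpair {α : Type*} [Primcodable α] {f : α → ℕ}
    (hf : Computable f) : Computable fun x => (f x).unpair.2 :=
  Computable.snd.comp (Computable.unpair.comp hf)

@[fun_prop]
theorem Tracked.prodMk {f : α → β} {g : α → γ} (hf : Tracked f) (hg : Tracked g) :
    Tracked fun x => (f x, g x) := by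
  obtain ⟨φ, hφ, hf⟩ := hf
  obtain ⟨ψ, hψ, hg⟩ := hg
  refine ⟨fun n => (φ n).bind fun a => (ψ n).bind fun b => Part.some (Nat.pair a b),
    hφ.bind (Partrec.bind (hψ.comp Computable.fst) (Computable.natPair
      (Computable.snd.comp Computable.fst) Computable.snd).partrec), fun n x hn => ?_⟩
  obtain ⟨a, ha, hax⟩ := hf n x hn
  obtain ⟨b, hb, hbx⟩ := hg n x hn
  exact ⟨_, Part.mem_bind ha (Part.mem_bind hb (Part.mem_some _)), names_pair hax hbx⟩

@[fun_prop]
theorem Tracked.fst {f : α → β × γ} (hf : Tracked f) : Tracked fun x => (f x).1 :=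
  Tracked.comp (g := Prod.fst)
    (.of_computable _ (Computable.fst_unpair Computable.id) fun _ _ => names_fst) hf

@[fun_prop]
theorem Tracked.snd {f : α → β × γ} (hf : Tracked f) : Tracked fun x => (f x).2 :=
  Tracked.comp (g := Prod.snd)
    (.of_computable _ (Computable.snd_unpair Computable.id) fun _ _ => names_snd) hf

/-- Evaluation of the code with a given number. -/
def evalNat (e n : ℕ) : Part ℕ := (ofNat Code e).eval n

theorem evalNat_partrec : Partrec₂ evalNat :=
  Code.eval_part.comp ((Computable.ofNat Code).comp Computable.fst) Computable.snd

/-- Partial evaluation of codes at the first component of the argument. -/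
theorem exists_curry {φ : ℕ →. ℕ} (hφ : Partrec φ) :
    ∃ κ : ℕ → ℕ, Computable κ ∧ ∀ n m, evalNat (κ n) m = φ (Nat.pair n m) := by
  obtain ⟨c, rfl⟩ := Code.exists_code.1 (Partrec.nat_iff.1 hφ)
  refine ⟨fun n => encode (Code.curry c n), Computable.encode.comp
    ((Code.primrec₂_curry.to_comp).comp (Computable.const c) Computable.id), fun n m => ?_⟩
  simp [evalNat]

theorem names_fun_iff {e : ℕ} {f : α → β} :
    Names e f ↔ ∀ n x, Names n x → ∃ m ∈ evalNat e n, Names m (f x) := Iff.rfl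

/-- The s-m-n theorem: specialising the program at a name of `x` gives a name of the function `f x`.
-/
theorem Tracked.curry {f : α → β → γ} (hf : Tracked fun p : α × β => f p.1 p.2) :
    Tracked f := by
  obtain ⟨φ, hφ, hf⟩ := hf
  obtain ⟨κ, hκ, h⟩ := exists_curry hφ
  refine .of_computable κ hκ fun n x hn => names_fun_iff.2 fun m y hm => ?_
  rw [h]
  exact hf _ (x, y) (names_pair hn hm)

theorem Tracked.app {f : α → β → γ} {g : α → β} (hf : Tracked f) (hg : Tracked g) :
    Tracked fun x => f x (g x) := by
  refine Tracked.comp (g := fun p : (β → γ) × β => p.1 p.2) ?_ (hf.prodMk hg)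
  exact ⟨fun n => evalNat n.unpair.1 n.unpair.2, evalNat_partrec.comp
    (Computable.fst_unpair .id) (Computable.snd_unpair .id), fun n p h => h.1 _ _ h.2⟩

theorem Tracked.uncurry {f : α → β → γ} (hf : Tracked f) :
    Tracked fun p : α × β => f p.1 p.2 :=
  Tracked.app (hf.comp (Tracked.fst .id)) (Tracked.snd .id)

/-- Recursion: it suffices to compute the value at `x` from the values at arguments of smaller
rank, which are available through the code `e`. -/
theorem Tracked.of_rec {f : α → β} (r : α → ℕ) (ψ : ℕ → ℕ →. ℕ) (hψ : Partrec₂ ψ)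
    (h : ∀ e n x, Names n x →
      (∀ m y, r y < r x → Names m y → ∃ k ∈ evalNat e m, Names k (f y)) →
      ∃ k ∈ ψ e n, Names k (f x)) : Tracked f := by
  -- Kleene's recursion theorem: the program `c` runs `ψ` with its own number as the code for
  -- recursive calls. That it halts with the right value follows by strong induction on the rank.
  obtain ⟨c, hc⟩ := Code.fixed_point₂ (f := fun c n => ψ (encode c) n)
    (hψ.comp (Computable.encode.comp Computable.fst) Computable.snd)
  have hE : evalNat (encode c) = ψ (encode c) := by
    funext n; simp [evalNat, hc]
  refine ⟨evalNat (encode c), evalNat_partrec.comp (Computable.const _) Computable.id, ?_⟩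
  intro n x
  induction hr : r x using Nat.strong_induction_on generalizing n x with
  | _ k ih =>
    intro hn
    rw [hE]
    refine h _ n x hn fun m y hy hm => ih _ (hr ▸ hy) m y rfl hm

end Basic

/-! ### Booleans -/

section Logic
variable {α β : Type*} [Represented α] [Represented β]

theorem names_prop_iff {n : ℕ} {p : Prop} : Names n p ↔ (n = 1 ∧ p) ∨ (n = 0 ∧ ¬ p) := Iff.rfl

theorem _root_.Partrec.ite_zero {α σ : Type*} [Primcodable α] [Primcodable σ] {c : α → ℕ}
    {f g : α →. σ} (hc : Computable c) (hf : Partrec f) (hg : Partrec g) :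
    Partrec fun x => if c x = 0 then f x else g x :=
  (Partrec.cond (((PrimrecRel.decide (Primrec.eq (α := ℕ))).to_comp).comp hc
    (Computable.const 0)) hf hg).of_eq fun x => by by_cases h : c x = 0 <;> simp [h]

-- Only the program of the selected branch is run. The test is made by the program for `p`; the
-- `DecidablePred` instance has no algorithmic role, so classical instances are harmless.
@[fun_prop]
theorem Tracked.ite {p : α → Prop} [DecidablePred p] {f g : α → β} (hp : Tracked p)
    (hf : Tracked f) (hg : Tracked g) : Tracked fun x => if p x then f x else g x := by
  obtain ⟨π, hπ, hp⟩ := hp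
  obtain ⟨φ, hφ, hf⟩ := hf
  obtain ⟨ψ, hψ, hg⟩ := hg
  refine ⟨fun n => (π n).bind fun b => (if b = 0 then ψ n else φ n), hπ.bind
    (Partrec.ite_zero (c := fun p : ℕ × ℕ => p.2) Computable.snd (hψ.comp Computable.fst)
      (hφ.comp Computable.fst)), fun n x hn => ?_⟩
  obtain ⟨b, hb, hbp⟩ := hp n x hn
  rcases hbp with ⟨rfl, h⟩ | ⟨rfl, h⟩
  · obtain ⟨m, hm, hmx⟩ := hf n x hn
    exact ⟨m, Part.mem_bind hb (by simpa using hm), by simpa [h] using hmx⟩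
  · obtain ⟨m, hm, hmx⟩ := hg n x hn
    exact ⟨m, Part.mem_bind hb (by simpa using hm), by simpa [h] using hmx⟩

theorem Tracked.prop_congr {p q : α → Prop} (hp : Tracked p) (h : ∀ x, p x ↔ q x) :
    Tracked q := by
  have : p = q := funext fun x => propext (h x)
  exact this ▸ hp

open Classical in
@[fun_prop]
theorem Tracked.and {p q : α → Prop} (hp : Tracked p) (hq : Tracked q) :
    Tracked fun x => p x ∧ q x :=
  (Tracked.ite hp hq (.const False)).prop_congr fun x => by by_cases h : p x <;> simp [h]

open Classical in
@[fun_prop]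
theorem Tracked.or {p q : α → Prop} (hp : Tracked p) (hq : Tracked q) :
    Tracked fun x => p x ∨ q x :=
  (Tracked.ite hp (.const True) hq).prop_congr fun x => by by_cases h : p x <;> simp [h]

open Classical in
@[fun_prop]
theorem Tracked.not {p : α → Prop} (hp : Tracked p) : Tracked fun x => ¬ p x :=
  (Tracked.ite hp (.const False) (.const True)).prop_congr fun x => by
    by_cases h : p x <;> simp [h]

end Logic

end DataCentric

namespace DataCentric
open Nat.Partrec (Code)
open Encodable Denumerable
open Represented (Names)

/-! ### Natural numbers and lists -/

section Lists
variable {α β γ δ : Type*} [Represented α] [Represented β] [Represented γ] [Represented δ]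

theorem Tracked.of_natRec {f : γ → ℕ → β} {H : γ → ℕ → β → β}
    (h0 : Tracked fun g => f g 0) (hH : Tracked fun p : γ × ℕ × β => H p.1 p.2.1 p.2.2)
    (hf : ∀ g n, f g (n + 1) = H g n (f g n)) : Tracked fun p : γ × ℕ => f p.1 p.2 := by
  obtain ⟨φ, hφ, h0⟩ := h0
  obtain ⟨ψ, hψ, hH⟩ := hH
  refine Tracked.of_rec (fun p => p.2) (fun e n => if n.unpair.2 = 0 then φ n.unpair.1 else
    (evalNat e (Nat.pair n.unpair.1 n.unpair.2.pred)).bind fun r =>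
      ψ (Nat.pair n.unpair.1 (Nat.pair n.unpair.2.pred r))) ?_ ?_
  · have h1 : Computable fun p : ℕ × ℕ => p.2.unpair.1 := Computable.fst_unpair .snd
    have h2 : Computable fun p : ℕ × ℕ => p.2.unpair.2 := Computable.snd_unpair .snd
    have h3 := Computable.pred.comp h2
    exact Partrec.ite_zero h2 (hφ.comp h1) ((evalNat_partrec.comp .fst
      (h1.natPair h3)).bind (hψ.comp ((h1.comp .fst).natPair ((h3.comp .fst).natPair .snd))))
  · rintro e n ⟨g, k⟩ hn ih
    obtain ⟨a, b, rfl⟩ : ∃ a b, n = Nat.pair a b := ⟨_, _, (Nat.pair_unpair n).symm⟩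
    obtain ⟨ha, hb⟩ := names_pair_iff.1 hn
    obtain rfl : b = k := hb
    simp only [Nat.unpair_pair]
    cases b with
    | zero => simpa using h0 _ _ ha
    | succ b =>
      obtain ⟨r, hr, hr'⟩ := ih (Nat.pair a b) (g, b) (Nat.lt_succ_self b) (names_pair ha rfl)
      obtain ⟨m, hm, hm'⟩ := hH _ (g, b, f g b) (names_pair ha (names_pair rfl hr'))
      exact ⟨m, by simpa using ⟨r, hr, hm⟩, by simpa [hf] using hm'⟩

@[fun_prop]
theorem Tracked.cons {f : α → β} {g : α → List β} (hf : Tracked f) (hg : Tracked g) :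
    Tracked fun x => f x :: g x :=
  Tracked.comp (g := fun p : β × List β => p.1 :: p.2) (.of_computable Nat.succ .succ
    fun n p h => names_cons_iff.2 ⟨_, _, by simp, h.1, h.2⟩) (hf.prodMk hg)

/-- A name of a nonempty list is the successor of a pair of names of head and tail, so testing for
zero, predecessor and unpairing take the list apart. -/
theorem Tracked.of_listRec {f : γ → List α → β} {H : γ → α → List α → β → β}
    (h0 : Tracked fun g => f g [])
    (hH : Tracked fun p : γ × α × List α × β => H p.1 p.2.1 p.2.2.1 p.2.2.2)
    (hf : ∀ g a l, f g (a :: l) = H g a l (f g l)) :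
    Tracked fun p : γ × List α => f p.1 p.2 := by
  obtain ⟨φ, hφ, h0⟩ := h0
  obtain ⟨ψ, hψ, hH⟩ := hH
  refine Tracked.of_rec (fun p => p.2.length) (fun e n => if n.unpair.2 = 0 then φ n.unpair.1 else
    (evalNat e (Nat.pair n.unpair.1 n.unpair.2.pred.unpair.2)).bind fun r =>
      ψ (Nat.pair n.unpair.1 (Nat.pair n.unpair.2.pred.unpair.1
        (Nat.pair n.unpair.2.pred.unpair.2 r)))) ?_ ?_
  · have h1 : Computable fun p : ℕ × ℕ => p.2.unpair.1 := Computable.fst_unpair .snd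
    have h2 : Computable fun p : ℕ × ℕ => p.2.unpair.2 := Computable.snd_unpair .snd
    have h3 := (Computable.pred.comp h2).fst_unpair
    have h4 := (Computable.pred.comp h2).snd_unpair
    exact Partrec.ite_zero h2 (hφ.comp h1) ((evalNat_partrec.comp .fst (h1.natPair h4)).bind
      (hψ.comp ((h1.comp .fst).natPair ((h3.comp .fst).natPair ((h4.comp .fst).natPair .snd)))))
  · rintro e n ⟨g, l⟩ hn ih
    obtain ⟨a, b, rfl⟩ : ∃ a b, n = Nat.pair a b := ⟨_, _, (Nat.pair_unpair n).symm⟩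
    obtain ⟨ha, hb⟩ := names_pair_iff.1 hn
    simp only [Nat.unpair_pair]
    cases l with
    | nil =>
      obtain rfl : b = 0 := names_nil_iff.1 hb
      simpa using h0 _ _ ha
    | cons x l =>
      obtain ⟨c, d, rfl, hc, hd⟩ := names_cons_iff.1 hb
      obtain ⟨r, hr, hr'⟩ := ih (Nat.pair a d) (g, l) (Nat.lt_succ_self _) (names_pair ha hd)
      obtain ⟨m, hm, hm'⟩ := hH _ (g, x, l, f g l)
        (names_pair ha (names_pair hc (names_pair hd hr')))
      exact ⟨m, by simpa using ⟨r, hr, hm⟩, by simpa [hf] using hm'⟩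

@[fun_prop]
theorem Tracked.nil : Tracked fun _ : γ => ([] : List α) := .const_of_names names_nil

@[fun_prop]
theorem Tracked.append {f g : γ → List α} (hf : Tracked f) (hg : Tracked g) :
    Tracked fun x => f x ++ g x :=
  Tracked.comp (g := fun p : List α × List α => p.2 ++ p.1)
    (.of_listRec (f := fun m l => l ++ m) (H := fun _ a _ r => a :: r) (by simp; fun_prop)
      (by fun_prop) (by simp)) (hg.prodMk hf)

@[fun_prop]
theorem Tracked.listFoldr {f : γ → α → β → β} {b : γ → β} {l : γ → List α}
    (hf : Tracked fun p : γ × α × β => f p.1 p.2.1 p.2.2) (hb : Tracked b) (hl : Tracked l) :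
    Tracked fun x => (l x).foldr (f x) (b x) :=
  Tracked.comp (g := fun p : γ × List α => p.2.foldr (f p.1) (b p.1))
    (.of_listRec (f := fun g l => l.foldr (f g) (b g)) (H := fun g a _ r => f g a r)
      (by simpa) (hf.comp (g := fun p : γ × α × β => f p.1 p.2.1 p.2.2)
        (f := fun p : γ × α × List α × β => (p.1, p.2.1, p.2.2.2)) (by fun_prop)) (by simp))
    (Tracked.id.prodMk hl)

@[fun_prop]
theorem Tracked.listMap {f : γ → α → β} {l : γ → List α}
    (hf : Tracked fun p : γ × α => f p.1 p.2) (hl : Tracked l) :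
    Tracked fun x => (l x).map (f x) := by
  have : (fun x => (l x).map (f x)) = fun x => (l x).foldr (fun a r => f x a :: r) [] := by
    funext x; induction l x <;> simp_all
  rw [this]
  have := hf.comp (g := fun p : γ × α => f p.1 p.2)
        (f := fun p : γ × α × List β => (p.1, p.2.1)) (by fun_prop)
  fun_prop

@[fun_prop]
theorem Tracked.listFlatMap {f : γ → α → List β} {l : γ → List α}
    (hf : Tracked fun p : γ × α => f p.1 p.2) (hl : Tracked l) :
    Tracked fun x => (l x).flatMap (f x) := by
  have : (fun x => (l x).flatMap (f x)) = fun x => (l x).foldr (fun a r => f x a ++ r) [] := by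
    funext x; induction l x <;> simp_all
  rw [this]
  have := hf.comp (g := fun p : γ × α => f p.1 p.2)
        (f := fun p : γ × α × List β => (p.1, p.2.1)) (by fun_prop)
  fun_prop

end Lists

/-! ### Types whose elements have exactly one name -/

/-- Names determine elements and are determined by them. -/
class Coded (α : Type*) [Represented α] : Prop where
  eq_of_names : ∀ {n : ℕ} {x y : α}, Names n x → Names n y → x = y
  names_unique : ∀ {m n : ℕ} {x : α}, Names m x → Names n x → m = n

/-- Equality is decidable on names. -/
class TrackedEq (α : Type*) [Represented α] : Prop where
  tracked_eq : Tracked fun p : α × α => p.1 = p.2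

section Equality
variable {α β γ : Type*} [Represented α] [Represented β] [Represented γ]

instance : Coded ℕ := ⟨fun h1 h2 => h1.symm.trans h2, fun h1 h2 => h1.trans h2.symm⟩

instance [Coded α] [Coded β] : Coded (α × β) :=
  ⟨fun h1 h2 => Prod.ext (Coded.eq_of_names h1.1 h2.1) (Coded.eq_of_names h1.2 h2.2),
   fun {m n _} h1 h2 => by
    rw [← Nat.pair_unpair m, Coded.names_unique h1.1 h2.1, Coded.names_unique h1.2 h2.2,
      Nat.pair_unpair]⟩

instance [Coded α] : Coded (List α) where
  eq_of_names {n x y} h1 h2 := by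
    induction x generalizing n y with
    | nil =>
      rw [names_nil_iff] at h1
      subst h1
      cases y with
      | nil => rfl
      | cons => simp [names_cons_iff] at h2
    | cons a l ih =>
      obtain ⟨c, d, rfl, hc, hd⟩ := names_cons_iff.1 h1
      cases y with
      | nil => simp [names_nil_iff] at h2
      | cons b l' =>
        obtain ⟨c', d', h, hc', hd'⟩ := names_cons_iff.1 h2
        obtain ⟨rfl, rfl⟩ : c = c' ∧ d = d' := by simpa using h
        rw [Coded.eq_of_names hc hc', ih hd hd']
  names_unique {m n x} h1 h2 := by
    induction x generalizing m n with
    | nil => rw [names_nil_iff.1 h1, names_nil_iff.1 h2]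
    | cons a l ih =>
      obtain ⟨c, d, rfl, hc, hd⟩ := names_cons_iff.1 h1
      obtain ⟨c', d', rfl, hc', hd'⟩ := names_cons_iff.1 h2
      rw [Coded.names_unique hc hc', ih hd hd']

@[fun_prop]
theorem Tracked.eq [TrackedEq α] {f g : γ → α} (hf : Tracked f) (hg : Tracked g) :
    Tracked fun x => f x = g x :=
  Tracked.comp (g := fun p : α × α => p.1 = p.2) TrackedEq.tracked_eq (hf.prodMk hg)

theorem Tracked.of_ite_computable {p : α → Prop} (q : ℕ → Prop) [DecidablePred q]
    (hq : Computable fun n => decide (q n)) (h : ∀ n x, Names n x → (q n ↔ p x)) : Tracked p := by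
  refine .of_computable (fun n => bif decide (q n) then 1 else 0)
    (Computable.cond hq (.const _) (.const _)) fun n x hn => ?_
  have := h n x hn
  by_cases hp : p x <;> simp [names_prop_iff, hp, this]

instance [Coded α] : TrackedEq α where
  tracked_eq := .of_ite_computable (fun n => n.unpair.1 = n.unpair.2)
    ((PrimrecRel.decide (Primrec.eq (α := ℕ))).to_comp.comp
      (Computable.fst_unpair .id) (Computable.snd_unpair .id)) fun _ _ h =>
    ⟨fun e => Coded.eq_of_names h.1 (e ▸ h.2), fun e => Coded.names_unique h.1 (e ▸ h.2)⟩

instance [TrackedEq α] [TrackedEq β] : TrackedEq (α × β) where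
  tracked_eq := Tracked.prop_congr (p := fun p : (α × β) × (α × β) =>
    p.1.1 = p.2.1 ∧ p.1.2 = p.2.2) (by fun_prop) (by simp [Prod.ext_iff])

@[fun_prop]
theorem Tracked.le {f g : γ → ℕ} (hf : Tracked f) (hg : Tracked g) :
    Tracked fun x => f x ≤ g x :=
  Tracked.comp (g := fun p : ℕ × ℕ => p.1 ≤ p.2)
    (.of_ite_computable (fun n => n.unpair.1 ≤ n.unpair.2)
      ((PrimrecRel.decide Primrec.nat_le).to_comp.comp
        (Computable.fst_unpair .id) (Computable.snd_unpair .id)) fun n p h => by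
      obtain ⟨a, b⟩ := p
      obtain rfl : n.unpair.1 = a := h.1
      obtain rfl : n.unpair.2 = b := h.2
      rfl) (hf.prodMk hg)

@[fun_prop]
theorem Tracked.succ {f : γ → ℕ} (hf : Tracked f) : Tracked fun x => f x + 1 :=
  Tracked.comp (g := fun n : ℕ => n + 1) (.of_computable Nat.succ .succ
    fun n m h => by obtain rfl : n = m := h; rfl) hf

@[fun_prop]
theorem Tracked.add {f g : γ → ℕ} (hf : Tracked f) (hg : Tracked g) :
    Tracked fun x => f x + g x :=
  Tracked.comp (g := fun p : ℕ × ℕ => p.1 + p.2)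
    (.of_natRec (f := fun a b => a + b) (H := fun _ _ r => r + 1) (by simp; fun_prop)
      (by fun_prop) (by intros; omega)) (hf.prodMk hg)

@[fun_prop]
theorem Tracked.update [TrackedEq α] [DecidableEq α] {f : γ → α → β} {a : γ → α} {b : γ → β}
    (hf : Tracked f) (ha : Tracked a) (hb : Tracked b) :
    Tracked fun x => Function.update (f x) (a x) (b x) := by
  refine Tracked.curry ?_
  have : (fun p : γ × α => Function.update (f p.1) (a p.1) (b p.1) p.2) =
      fun p => if p.2 = a p.1 then b p.1 else f p.1 p.2 := by
    funext p; simp [Function.update_apply]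
  rw [this]
  have := hf.uncurry
  fun_prop

end Equality

/-! ### Finite sets -/

section Sets
variable {α β γ : Type*} [Represented α] [Represented β] [Represented γ]

/-- A name of a set is by definition a name of some list of its elements, so the same program works.
The result is independent of the list because `F` only sees the set. -/
theorem Tracked.of_list {F : γ → Set α → β}
    (h : Tracked fun p : γ × List α => F p.1 {x | x ∈ p.2}) :
    Tracked fun p : γ × Set α => F p.1 p.2 := by
  obtain ⟨φ, hφ, h⟩ := h
  refine ⟨φ, hφ, ?_⟩
  rintro n ⟨g, A⟩ ⟨hg, l, hl, rfl⟩
  exact h n (g, l) ⟨hg, hl⟩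

/-- Functions on finite sets that are defined by recursion on lists. -/
theorem Tracked.of_setRec {F : γ → Set α → β} {H : γ → α → List α → β → β} {A : γ → Set α}
    (h0 : Tracked fun g => F g ∅)
    (hH : Tracked fun p : γ × α × List α × β => H p.1 p.2.1 p.2.2.1 p.2.2.2)
    (hF : ∀ g a (l : List α), F g (insert a {x | x ∈ l}) = H g a l (F g {x | x ∈ l}))
    (hA : Tracked A) : Tracked fun x => F x (A x) :=
  Tracked.comp (g := fun p : γ × Set α => F p.1 p.2) (.of_list
    (.of_listRec (f := fun g l => F g {x | x ∈ l}) (H := H) (by simpa using h0) hH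
      fun g a l => by rw [← hF]; congr 1; ext; simp)) (Tracked.id.prodMk hA)

@[fun_prop]
theorem Tracked.setOf_mem_list {l : γ → List α} (hl : Tracked l) :
    Tracked fun x => {a | a ∈ l x} :=
  Tracked.comp (g := fun l : List α => {a | a ∈ l}) (.of_computable _ Computable.id
    fun _ _ h => names_set_of_list h) hl

@[fun_prop]
theorem Tracked.empty : Tracked fun _ : γ => (∅ : Set α) :=
  .const_of_names ⟨[], names_nil, by simp⟩

@[fun_prop]
theorem Tracked.insert {f : γ → α} {A : γ → Set α} (hf : Tracked f) (hA : Tracked A) :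
    Tracked fun x => insert (f x) (A x) := by
  refine Tracked.comp (g := fun p : α × Set α => Insert.insert p.1 p.2)
    (.of_list (F := fun a A => Insert.insert a A) ?_) (hf.prodMk hA)
  have : (fun p : α × List α => Insert.insert p.1 {x | x ∈ p.2}) = fun p =>
      {x | x ∈ p.1 :: p.2} := by funext p; ext; simp
  rw [this]
  fun_prop

@[fun_prop]
theorem Tracked.singleton {f : γ → α} (hf : Tracked f) : Tracked fun x => ({f x} : Set α) := by
  have : (fun x => ({f x} : Set α)) = fun x => Insert.insert (f x) ∅ := by simp
  rw [this]
  fun_prop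

@[fun_prop]
theorem Tracked.union {A B : γ → Set α} (hA : Tracked A) (hB : Tracked B) :
    Tracked fun x => A x ∪ B x :=
  .of_setRec (F := fun x A => A ∪ B x) (H := fun _ a _ r => Insert.insert a r) (by simpa)
    (by fun_prop) (fun _ _ _ => Set.insert_union) hA

/-- The union of a family of sets indexed by a set. -/
def bUnion (A : Set α) (f : α → Set β) : Set β := {y | ∃ x ∈ A, y ∈ f x}

/-- Bounded existential quantification. -/
def ExIn (A : Set α) (p : α → Prop) : Prop := ∃ x ∈ A, p x

/-- Bounded universal quantification. -/
def AllIn (A : Set α) (p : α → Prop) : Prop := ∀ x ∈ A, p x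

@[fun_prop]
theorem tracked_bUnion {A : γ → Set α} {f : γ → α → Set β} (hA : Tracked A)
    (hf : Tracked fun p : γ × α => f p.1 p.2) : Tracked fun x => bUnion (A x) (f x) := by
  have := hf.comp (g := fun p : γ × α => f p.1 p.2)
        (f := fun p : γ × α × List α × Set β => (p.1, p.2.1)) (by fun_prop)
  refine .of_setRec (F := fun x A => bUnion A (f x)) (H := fun x a _ r => f x a ∪ r)
    ?_ (by fun_prop) ?_ hA
  · simp [bUnion]; fun_prop
  · intro x a l; ext; simp [bUnion]

@[fun_prop]
theorem Tracked.exIn {A : γ → Set α} {p : γ → α → Prop} (hA : Tracked A)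
    (hp : Tracked fun q : γ × α => p q.1 q.2) : Tracked fun x => ExIn (A x) (p x) := by
  have := hp.comp (g := fun q : γ × α => p q.1 q.2)
        (f := fun q : γ × α × List α × Prop => (q.1, q.2.1)) (by fun_prop)
  refine .of_setRec (F := fun x A => ExIn A (p x)) (H := fun x a _ r => p x a ∨ r)
    ?_ (by fun_prop) ?_ hA
  · simp [ExIn]; fun_prop
  · intro x a l; simp [ExIn]

@[fun_prop]
theorem Tracked.allIn {A : γ → Set α} {p : γ → α → Prop} (hA : Tracked A)
    (hp : Tracked fun q : γ × α => p q.1 q.2) : Tracked fun x => AllIn (A x) (p x) := by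
  have : Tracked fun x => ¬ ExIn (A x) (fun a => ¬ p x a) := by fun_prop
  exact this.prop_congr fun x => by simp [ExIn, AllIn]

@[fun_prop]
theorem Tracked.image {A : γ → Set α} {f : γ → α → β} (hA : Tracked A)
    (hf : Tracked fun p : γ × α => f p.1 p.2) : Tracked fun x => f x '' A x := by
  have : (fun x => f x '' A x) = fun x => bUnion (A x) fun a => {f x a} := by
    funext x; ext; simp [bUnion, eq_comm]
  rw [this]
  fun_prop

/-- The elements of a set with a property. -/
def sepSet (A : Set α) (p : α → Prop) : Set α := {x ∈ A | p x}

open Classical in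
@[fun_prop]
theorem tracked_sepSet {A : γ → Set α} {p : γ → α → Prop} (hA : Tracked A)
    (hp : Tracked fun q : γ × α => p q.1 q.2) : Tracked fun x => sepSet (A x) (p x) := by
  have : (fun x => sepSet (A x) (p x)) =
      fun x => bUnion (A x) fun a => if p x a then {a} else ∅ := by
    funext x; ext y
    simp only [bUnion, sepSet, Set.mem_ofPred_eq]
    constructor
    · rintro ⟨h1, h2⟩; exact ⟨y, h1, by simp [h2]⟩
    · rintro ⟨a, h1, h2⟩
      by_cases h : p x a <;> simp [h] at h2
      exact h2 ▸ ⟨h1, h⟩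
  rw [this]
  fun_prop

@[fun_prop]
theorem Tracked.mem [TrackedEq α] {f : γ → α} {A : γ → Set α} (hf : Tracked f) (hA : Tracked A) :
    Tracked fun x => f x ∈ A x := by
  have : Tracked fun x => ExIn (A x) fun a => a = f x := by fun_prop
  exact this.prop_congr fun x => by simp [ExIn]

@[fun_prop]
theorem Tracked.subset [TrackedEq α] {A B : γ → Set α} (hA : Tracked A) (hB : Tracked B) :
    Tracked fun x => A x ⊆ B x := by
  have : Tracked fun x => AllIn (A x) fun a => a ∈ B x := by fun_prop
  exact this.prop_congr fun x => Iff.rfl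

instance [TrackedEq α] : TrackedEq (Set α) where
  tracked_eq := Tracked.prop_congr (p := fun p : Set α × Set α => p.1 ⊆ p.2 ∧ p.2 ⊆ p.1)
    (by fun_prop) fun _ => Set.Subset.antisymm_iff.symm

@[fun_prop]
theorem Tracked.diff [TrackedEq α] {A B : γ → Set α} (hA : Tracked A) (hB : Tracked B) :
    Tracked fun x => A x \ B x := by
  have : (fun x => A x \ B x) = fun x => sepSet (A x) fun a => ¬ a ∈ B x := rfl
  rw [this]
  fun_prop

-- The list may contain repetitions, so the recursion step must look at the tail; this is why `H` in
-- `Tracked.of_setRec` receives it.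
open Classical in
@[fun_prop]
theorem Tracked.ncard [TrackedEq α] {A : γ → Set α} (hA : Tracked A) :
    Tracked fun x => (A x).ncard := by
  refine .of_setRec (F := fun _ A => A.ncard)
    (H := fun _ a l r => if a ∈ {x | x ∈ l} then r else r + 1) (by simp; fun_prop)
    (by fun_prop) (fun _ a l => ?_) hA
  split_ifs with h
  · rw [Set.insert_eq_of_mem h]
  · exact Set.ncard_insert_of_notMem h (List.finite_toSet l)

@[fun_prop]
theorem Tracked.powerset {A : γ → Set α} (hA : Tracked A) : Tracked fun x => 𝒫 (A x) :=
  .of_setRec (F := fun _ A => 𝒫 A)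
    (H := fun _ a _ r => r ∪ (fun B => Insert.insert a B) '' r) (by simp; fun_prop)
    (by fun_prop) (fun _ a l => by simp [Set.powerset_insert]) hA

/-- The functions that agree with `f` outside of `A` and have values in `B` on `A`. -/
def funsOn (A : Set α) (B : Set β) (f : α → β) : Set (α → β) :=
  {h | (∀ x ∈ A, h x ∈ B) ∧ ∀ x, x ∉ A → h x = f x}

-- Prescribing the values outside of `A` keeps the set of functions finite. Valuations of finitely
-- many variables are enumerated in this way, one update for each element of `A`.
open Classical in
@[fun_prop]
theorem tracked_funsOn [TrackedEq α] {A : γ → Set α} {B : γ → Set β} {f : γ → α → β}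
    (hA : Tracked A) (hB : Tracked B) (hf : Tracked f) :
    Tracked fun x => funsOn (A x) (B x) (f x) := by
  refine .of_setRec (F := fun x A => funsOn A (B x) (f x))
    (H := fun x a _ r => bUnion (B x) fun b =>
      (fun h : α → β => Function.update h a b) '' r) ?_ (by fun_prop) (fun x a l => ?_) hA
  · have : (fun x => funsOn ∅ (B x) (f x)) = fun x => {f x} := by
      funext x; ext h; simp [funsOn, funext_iff]
    rw [this]; fun_prop
  · ext h
    simp only [funsOn, bUnion, Set.mem_ofPred_eq, Set.mem_image]
    constructor
    · rintro ⟨h1, h2⟩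
      by_cases ha : a ∈ l
      · exact ⟨h a, h1 a (by simp), h, ⟨fun y hy => h1 y (by simp [hy]), fun y hy =>
          h2 y (by simp [hy]; rintro rfl; exact hy ha)⟩, by simp⟩
      -- When `a` is not in `l`, the function to be updated must have its prescribed value at `a`;
      -- when `a` is in `l`, `h` itself is used.
      · refine ⟨h a, h1 a (by simp), Function.update h a (f x a), ⟨fun y hy => ?_, fun y hy => ?_⟩,
          by simp⟩
        · rw [Function.update_of_ne (by rintro rfl; exact ha hy)]
          exact h1 y (by simp [hy])
        · by_cases hya : y = a
          · subst hya; simp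
          · rw [Function.update_of_ne hya]
            exact h2 y (by simp [hy, hya])
    · rintro ⟨b, hb, g, ⟨h1, h2⟩, rfl⟩
      refine ⟨fun y hy => ?_, fun y hy => ?_⟩
      · by_cases hya : y = a
        · subst hya; simpa
        · rw [Function.update_of_ne hya]
          exact h1 y (by simpa [hya] using hy)
      · rw [Function.update_of_ne (by rintro rfl; simp at hy)]
        exact h2 y (by simp at hy; exact hy.2)

end Sets
end DataCentric

namespace DataCentric
set_option linter.unusedSectionVars false
open Nat.Partrec (Code)
open Encodable Denumerable
open Represented (Names)

/-! ### Recursion on trees -/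

section Trees
variable {β γ δ T B : Type*} [Represented β] [Represented γ] [Represented δ] [Represented T]
  [Represented B]

/-- The function `F` can be computed at trees whose names have the tag `k`, given a code `e` for
the values at smaller trees. -/
def TrackedAtTag (size : T → ℕ) (F : γ → δ → T → β) (k : ℕ) : Prop :=
  ∃ φ : ℕ × ℕ × ℕ × ℕ →. ℕ, Partrec φ ∧ ∀ e a g b d m t,
    Names a g → Names b d → Names (Nat.pair k m) t →
    (∀ b d n u, size u < size t → Names b d → Names n u →
      ∃ r ∈ evalNat e (Nat.pair (Nat.pair a b) n), Names r (F g d u)) →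
    ∃ r ∈ φ (e, a, b, m), Names r (F g d t)

/-- Names of trees are pairs of a constructor tag and a content, so it suffices to treat the
finitely many tags separately. The parameter in `γ` is fixed during the recursion; the one in `δ`,
such as a valuation, may be changed by recursive calls. -/
theorem Tracked.of_treeRec {F : γ → δ → T → β} (size : T → ℕ) (K : ℕ)
    (hK : ∀ n (t : T), Names n t → n.unpair.1 < K) (h : ∀ k < K, TrackedAtTag size F k) :
    Tracked fun p : (γ × δ) × T => F p.1.1 p.1.2 p.2 := by
  have key : ∀ K, (∀ k < K, TrackedAtTag size F k) → ∃ ψ : ℕ × ℕ × ℕ × ℕ × ℕ →. ℕ,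
      Partrec ψ ∧ ∀ k < K, ∀ e a g b d m t,
      Names a g → Names b d → Names (Nat.pair k m) t →
      (∀ b d n u, size u < size t → Names b d → Names n u →
        ∃ r ∈ evalNat e (Nat.pair (Nat.pair a b) n), Names r (F g d u)) →
      ∃ r ∈ ψ (k, e, a, b, m), Names r (F g d t) := by
    intro K
    induction K with
    | zero => exact fun _ => ⟨fun _ => Part.none, Partrec.none, by simp⟩
    | succ K ih =>
      intro h
      obtain ⟨ψ, hψ, H⟩ := ih fun k hk => h k (by omega)
      obtain ⟨φ, hφ, H'⟩ := h K (by omega)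
      -- With truncated subtraction, the two tests together say that the tag equals `K`; smaller
      -- tags are left to the program from the induction hypothesis.
      refine ⟨fun p => if p.1 - K = 0 then if K - p.1 = 0 then φ p.2 else ψ p else Part.none,
        Partrec.ite_zero (Primrec.nat_sub.to_comp.comp .fst (.const K))
          (Partrec.ite_zero (Primrec.nat_sub.to_comp.comp (.const K) .fst) (hφ.comp .snd) hψ)
          Partrec.none, fun k hk => ?_⟩
      rcases Nat.lt_succ_iff_lt_or_eq.1 hk with hk | rfl
      · simpa [Nat.sub_eq_zero_of_le hk.le, Nat.sub_ne_zero_of_lt hk] using H k hk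
      · simpa using H'
  obtain ⟨ψ, hψ, H⟩ := key K h
  have c1 : Computable fun p : ℕ × ℕ => p.2.unpair.1.unpair.1 := .fst_unpair (.fst_unpair .snd)
  have c2 : Computable fun p : ℕ × ℕ => p.2.unpair.1.unpair.2 := .snd_unpair (.fst_unpair .snd)
  have c3 : Computable fun p : ℕ × ℕ => p.2.unpair.2.unpair.1 := .fst_unpair (.snd_unpair .snd)
  have c4 : Computable fun p : ℕ × ℕ => p.2.unpair.2.unpair.2 := .snd_unpair (.snd_unpair .snd)
  refine Tracked.of_rec (fun p => size p.2) (fun e n => ψ (n.unpair.2.unpair.1, e,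
    n.unpair.1.unpair.1, n.unpair.1.unpair.2, n.unpair.2.unpair.2))
    (hψ.comp (c3.pair (Computable.fst.pair (c1.pair (c2.pair c4))))) ?_
  rintro e n ⟨⟨g, d⟩, t⟩ ⟨⟨ha, hb⟩, ht⟩ ih
  exact H _ (hK _ _ ht) e _ g _ d _ t ha hb (by simpa using ht) fun b d n u hu hb hn =>
    ih _ ((g, d), u) hu (names_pair (names_pair ha hb) hn)

theorem TrackedAtTag.leaf {size : T → ℕ} {F : γ → δ → T → β} {k : ℕ} (i : B → T)
    (h : ∀ m t, Names (Nat.pair k m) t → ∃ b, t = i b ∧ Names m b)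
    (hF : Tracked fun p : γ × δ × B => F p.1 p.2.1 (i p.2.2)) : TrackedAtTag size F k := by
  obtain ⟨φ, hφ, hF⟩ := hF
  refine ⟨fun p => φ (Nat.pair p.2.1 (Nat.pair p.2.2.1 p.2.2.2)), hφ.comp
    (.natPair (.comp .fst .snd) (.natPair (.comp .fst (.comp .snd .snd))
      (.comp .snd (.comp .snd .snd)))), fun e a g b d m t ha hb ht _ => ?_⟩
  obtain ⟨x, rfl, hx⟩ := h m t ht
  exact hF _ (g, d, x) (names_pair ha (names_pair hb hx))

/-- The name of the function `fun d => F g d u`. -/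
theorem exists_names_subtree {size : T → ℕ} (F : γ → δ → T → β) : ∃ κ : ℕ × ℕ × ℕ → ℕ,
    Computable κ ∧ ∀ e a g t n u, (∀ b d n u, size u < size t → Names b d → Names n u →
      ∃ r ∈ evalNat e (Nat.pair (Nat.pair a b) n), Names r (F g d u)) →
    size u < size t → Names n u → Names (κ (e, a, n)) fun d => F g d u := by
  obtain ⟨κ, hκ, h⟩ := exists_curry (φ := fun m => evalNat m.unpair.1.unpair.1
    (Nat.pair (Nat.pair m.unpair.1.unpair.2.unpair.1 m.unpair.2) m.unpair.1.unpair.2.unpair.2))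
    (evalNat_partrec.comp (.fst_unpair (.fst_unpair .id)) (.natPair (.natPair
      (.fst_unpair (.snd_unpair (.fst_unpair .id))) (.snd_unpair .id))
      (.snd_unpair (.snd_unpair (.fst_unpair .id)))))
  refine ⟨fun p => κ (Nat.pair p.1 (Nat.pair p.2.1 p.2.2)), hκ.comp
    (.natPair .fst (.natPair (.comp .fst .snd) (.comp .snd .snd))), ?_⟩
  intro e a g t n u ih hu hn
  refine names_fun_iff.2 fun b d hb => ?_
  rw [h]
  simpa using ih b d n u hu hb hn

/-- The step `H` receives the recursive value as a function of the variable parameter. A name of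
this function is available by partial evaluation, so `H` may apply it to changed parameters, and
more than once, as the bounded quantifiers do. -/
theorem TrackedAtTag.unary {size : T → ℕ} {F : γ → δ → T → β} {k : ℕ} (i : T → T)
    (h : ∀ m t, Names (Nat.pair k m) t → ∃ u, t = i u ∧ Names m u)
    (hs : ∀ u, size u < size (i u)) {H : γ → δ → (δ → β) → β}
    (hH : Tracked fun p : γ × δ × (δ → β) => H p.1 p.2.1 p.2.2)
    (hF : ∀ g d u, F g d (i u) = H g d fun d => F g d u) : TrackedAtTag size F k := by
  obtain ⟨φ, hφ, hH⟩ := hH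
  obtain ⟨κ, hκ, hn⟩ := exists_names_subtree (size := size) F
  have c1 : Computable fun p : ℕ × ℕ × ℕ × ℕ => p.2.1 := .comp .fst .snd
  have c2 : Computable fun p : ℕ × ℕ × ℕ × ℕ => p.2.2.1 := .comp .fst (.comp .snd .snd)
  have c3 : Computable fun p : ℕ × ℕ × ℕ × ℕ => p.2.2.2 := .comp .snd (.comp .snd .snd)
  refine ⟨fun p => φ (Nat.pair p.2.1 (Nat.pair p.2.2.1 (κ (p.1, p.2.1, p.2.2.2)))), hφ.comp
    (c1.natPair (c2.natPair (hκ.comp (Computable.fst.pair (c1.pair c3))))),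
    fun e a g b d m t ha hb ht ih => ?_⟩
  obtain ⟨u, rfl, hu⟩ := h m t ht
  rw [hF]
  exact hH _ (g, d, _) (names_pair ha (names_pair hb (hn e a g _ m u ih (hs u) hu)))

theorem TrackedAtTag.labeled {size : T → ℕ} {F : γ → δ → T → β} {k : ℕ} (i : B → T → T)
    (h : ∀ m t, Names (Nat.pair k m) t → ∃ x u, t = i x u ∧ Names m (x, u))
    (hs : ∀ x u, size u < size (i x u)) {H : γ → δ → B → (δ → β) → β}
    (hH : Tracked fun p : γ × δ × B × (δ → β) => H p.1 p.2.1 p.2.2.1 p.2.2.2)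
    (hF : ∀ g d x u, F g d (i x u) = H g d x fun d => F g d u) : TrackedAtTag size F k := by
  obtain ⟨φ, hφ, hH⟩ := hH
  obtain ⟨κ, hκ, hn⟩ := exists_names_subtree (size := size) F
  have c1 : Computable fun p : ℕ × ℕ × ℕ × ℕ => p.2.1 := .comp .fst .snd
  have c2 : Computable fun p : ℕ × ℕ × ℕ × ℕ => p.2.2.1 := .comp .fst (.comp .snd .snd)
  have c3 : Computable fun p : ℕ × ℕ × ℕ × ℕ => p.2.2.2 := .comp .snd (.comp .snd .snd)
  refine ⟨fun p => φ (Nat.pair p.2.1 (Nat.pair p.2.2.1 (Nat.pair p.2.2.2.unpair.1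
    (κ (p.1, p.2.1, p.2.2.2.unpair.2))))), hφ.comp (c1.natPair (c2.natPair (c3.fst_unpair.natPair
      (hκ.comp (Computable.fst.pair (c1.pair c3.snd_unpair)))))),
    fun e a g b d m t ha hb ht ih => ?_⟩
  obtain ⟨x, u, rfl, hx, hu⟩ := h m t ht
  rw [hF]
  exact hH _ (g, d, x, _) (names_pair ha (names_pair hb (names_pair hx
    (hn e a g _ _ u ih (hs x u) hu))))

theorem TrackedAtTag.binary {size : T → ℕ} {F : γ → δ → T → β} {k : ℕ} (i : T → T → T)
    (h : ∀ m t, Names (Nat.pair k m) t → ∃ u v, t = i u v ∧ Names m (u, v))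
    (hs : ∀ u v, size u < size (i u v) ∧ size v < size (i u v))
    {H : γ → δ → (δ → β) → (δ → β) → β}
    (hH : Tracked fun p : γ × δ × (δ → β) × (δ → β) => H p.1 p.2.1 p.2.2.1 p.2.2.2)
    (hF : ∀ g d u v, F g d (i u v) = H g d (fun d => F g d u) fun d => F g d v) :
    TrackedAtTag size F k := by
  obtain ⟨φ, hφ, hH⟩ := hH
  obtain ⟨κ, hκ, hn⟩ := exists_names_subtree (size := size) F
  have c1 : Computable fun p : ℕ × ℕ × ℕ × ℕ => p.2.1 := .comp .fst .snd
  have c2 : Computable fun p : ℕ × ℕ × ℕ × ℕ => p.2.2.1 := .comp .fst (.comp .snd .snd)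
  have c3 : Computable fun p : ℕ × ℕ × ℕ × ℕ => p.2.2.2 := .comp .snd (.comp .snd .snd)
  refine ⟨fun p => φ (Nat.pair p.2.1 (Nat.pair p.2.2.1 (Nat.pair
    (κ (p.1, p.2.1, p.2.2.2.unpair.1)) (κ (p.1, p.2.1, p.2.2.2.unpair.2))))), hφ.comp
    (c1.natPair (c2.natPair (.natPair (hκ.comp (Computable.fst.pair (c1.pair c3.fst_unpair)))
      (hκ.comp (Computable.fst.pair (c1.pair c3.snd_unpair)))))),
    fun e a g b d m t ha hb ht ih => ?_⟩
  obtain ⟨u, v, rfl, hu, hv⟩ := h m t ht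
  rw [hF]
  exact hH _ (g, d, _, _) (names_pair ha (names_pair hb (names_pair
    (hn e a g _ _ u ih (hs u v).1 hu) (hn e a g _ _ v ih (hs u v).2 hv))))

/-- Functions on a type with two constructors. -/
theorem Tracked.of_cases {B' : Type*} [Represented B'] {F : γ → T → β} (i : B → T) (j : B' → T)
    (hT : ∀ n (t : T), Names n t → n.unpair.1 < 2)
    (hi : ∀ m t, Names (Nat.pair 0 m) t → ∃ b, t = i b ∧ Names m b)
    (hj : ∀ m t, Names (Nat.pair 1 m) t → ∃ b, t = j b ∧ Names m b)
    (h0 : Tracked fun p : γ × B => F p.1 (i p.2))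
    (h1 : Tracked fun p : γ × B' => F p.1 (j p.2)) {g : γ → T} (hg : Tracked g) :
    Tracked fun x => F x (g x) := by
  -- No recursion takes place: all sizes are zero and the variable parameter is a dummy number.
  have : Tracked fun p : (γ × ℕ) × T => F p.1.1 p.2 :=
    .of_treeRec (F := fun g _ t => F g t) (fun _ => 0) 2 hT fun k hk => by
      obtain rfl | rfl : k = 0 ∨ k = 1 := by omega
      · exact .leaf i hi (h0.comp (g := fun p : γ × B => F p.1 (i p.2))
          (f := fun p : γ × ℕ × B => (p.1, p.2.2)) (by fun_prop))
      · exact .leaf j hj (h1.comp (g := fun p : γ × B' => F p.1 (j p.2))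
          (f := fun p : γ × ℕ × B' => (p.1, p.2.2)) (by fun_prop))
  exact this.comp (f := fun x => ((x, 0), g x)) (by fun_prop)

end Trees

/-! ### Names of the syntactic objects -/

/-- The names of constants are their Gödel numbers. -/
class GodelNamed (C : Type*) [Encodable C] [Represented C] : Prop where
  names_iff : ∀ {n : ℕ} {c : C}, Names n c ↔ n = encode c

section Atoms
variable {α β γ T : Type*} [Represented α] [Represented β] [Represented γ] [Represented T]

instance : Represented (RelAtom T) := ⟨fun n a => Names n (a.rel, a.args)⟩

theorem names_codeList {code : α → ℕ} {l : List α} (h : ∀ x ∈ l, Names (code x) x) :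
    Names (codeList code l) l := by
  induction l with
  | nil => exact names_nil
  | cons x l ih =>
    refine names_cons_iff.2 ⟨code x, codeList code l, ?_, h x (by simp), ih fun y hy =>
      h y (by simp [hy])⟩
    simp [codeList]

theorem eq_codeList {code : α → ℕ} (h : ∀ n x, Names n x → n = code x) {n : ℕ} {l : List α}
    (hn : Names n l) : n = codeList code l := by
  induction l generalizing n with
  | nil => exact names_nil_iff.1 hn
  | cons x l ih =>
    obtain ⟨a, b, rfl, ha, hb⟩ := names_cons_iff.1 hn
    rw [h _ _ ha, ih hb]
    simp [codeList]

theorem names_relAtom_code {code : T → ℕ} {a : RelAtom T} (h : ∀ x ∈ a.args, Names (code x) x) :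
    Names (a.code code) a := names_pair rfl (names_codeList h)

theorem eq_relAtom_code {code : T → ℕ} (h : ∀ n x, Names n x → n = code x) {n : ℕ}
    {a : RelAtom T} (hn : Names n a) : n = a.code code := by
  have h1 : n.unpair.1 = a.rel := hn.1
  rw [RelAtom.code, ← h1, ← eq_codeList h hn.2, Nat.pair_unpair]

@[fun_prop]
theorem Tracked.relAtom_rel {f : γ → RelAtom T} (hf : Tracked f) : Tracked fun x => (f x).rel :=
  Tracked.comp (g := RelAtom.rel) (.of_computable _ (Computable.fst_unpair .id)
    fun _ _ h => names_fst h) hf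

@[fun_prop]
theorem Tracked.relAtom_args {f : γ → RelAtom T} (hf : Tracked f) : Tracked fun x => (f x).args :=
  Tracked.comp (g := RelAtom.args) (.of_computable _ (Computable.snd_unpair .id)
    fun _ _ h => names_snd h) hf

@[fun_prop]
theorem Tracked.relAtom_mk {f : γ → ℕ} {g : γ → List T} (hf : Tracked f) (hg : Tracked g) :
    Tracked fun x => RelAtom.mk (f x) (g x) :=
  Tracked.comp (g := fun p : ℕ × List T => RelAtom.mk p.1 p.2)
    (.of_computable _ .id fun _ _ h => h) (hf.prodMk hg)

instance [Coded T] : Coded (RelAtom T) where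
  eq_of_names {n a b} h1 h2 := by
    have : (a.rel, a.args) = (b.rel, b.args) := Coded.eq_of_names (n := n) h1 h2
    cases a; cases b; simpa using this
  names_unique {m n a} h1 h2 := Coded.names_unique (x := (a.rel, a.args)) h1 h2

end Atoms

section Descriptions
variable {C : Type*} [Denumerable C] [Represented C] [GodelNamed C]
variable {β γ δ : Type*} [Represented β] [Represented γ] [Represented δ]

theorem names_const_iff {n : ℕ} {c : C} : Names n c ↔ n = encode c := GodelNamed.names_iff

instance : Coded C where
  eq_of_names h1 h2 := encode_injective ((names_const_iff.1 h1).symm.trans (names_const_iff.1 h2))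
  names_unique h1 h2 := (names_const_iff.1 h1).trans (names_const_iff.1 h2).symm

instance : Named C := ⟨fun _ => ⟨_, names_const_iff.2 rfl⟩⟩

@[fun_prop]
theorem Tracked.ofNat_const {f : γ → ℕ} (hf : Tracked f) : Tracked fun x => ofNat C (f x) :=
  Tracked.comp (g := fun n => ofNat C n) (.of_computable _ .id fun n m h => by
    obtain rfl : n = m := h
    exact names_const_iff.2 (by simp)) hf

instance : Represented (Term C) := ⟨fun n t => n = t.code⟩

theorem names_term_iff {n : ℕ} {t : Term C} : Names n t ↔ n = t.code := Iff.rfl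

theorem names_termList_iff {n : ℕ} {l : List (Term C)} : Names n l ↔ n = codeList Term.code l :=
  ⟨eq_codeList fun _ _ h => h, fun h => h ▸ names_codeList fun _ _ => rfl⟩

theorem names_termAtom_iff {n : ℕ} {a : RelAtom (Term C)} : Names n a ↔ n = a.code Term.code :=
  ⟨eq_relAtom_code fun _ _ h => h, fun h => h ▸ names_relAtom_code fun _ _ => rfl⟩

theorem Tracked.of_termCases {F : γ → Term C → β}
    (h0 : Tracked fun p : γ × ℕ => F p.1 (.var p.2))
    (h1 : Tracked fun p : γ × C => F p.1 (.const p.2)) {g : γ → Term C} (hg : Tracked g) :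
    Tracked fun x => F x (g x) :=
  .of_cases Term.var Term.const (fun n t h => by
    rw [names_term_iff] at h; subst h; cases t <;> simp [Term.code])
    (fun m t h => by
      rw [names_term_iff] at h
      cases t <;> simp [Term.code] at h
      exact ⟨_, rfl, h⟩)
    (fun m t h => by
      rw [names_term_iff] at h
      cases t <;> simp [Term.code] at h
      exact ⟨_, rfl, names_const_iff.2 h⟩) h0 h1 hg

@[fun_prop]
theorem Tracked.term_var {f : γ → ℕ} (hf : Tracked f) : Tracked fun x => (Term.var (f x) : Term C) :=
  Tracked.comp (g := fun n => (Term.var n : Term C)) (.of_computable (fun n => Nat.pair 0 n)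
    (.natPair (.const 0) .id) fun n m h => by
      obtain rfl : n = m := h
      rfl) hf

@[fun_prop]
theorem Tracked.term_const {f : γ → C} (hf : Tracked f) : Tracked fun x => Term.const (f x) :=
  Tracked.comp (g := fun n => (Term.const n : Term C)) (.of_computable (fun n => Nat.pair 1 n)
    (.natPair (.const 1) .id) fun n m h => by
      rw [names_const_iff.1 h]
      rfl) hf

instance : Represented (Query C) := ⟨fun n q => n = q.code⟩

theorem names_query_iff {n : ℕ} {q : Query C} : Names n q ↔ n = q.code := Iff.rfl

/-- Recursion on queries, with one hypothesis for each constructor. Names of queries are their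
codes, whose tags are the numbers `0` to `6`. -/
theorem Tracked.of_queryRec {F : γ → δ → Query C → β}
    {Hneg : γ → δ → (δ → β) → β} {Hand Hor : γ → δ → (δ → β) → (δ → β) → β}
    {Hex : γ → δ → ℕ → (δ → β) → β}
    (htru : Tracked fun p : γ × δ => F p.1 p.2 .tru)
    (hrel : Tracked fun p : γ × δ × RelAtom (Term C) => F p.1 p.2.1 (.rel p.2.2))
    (heq : Tracked fun p : γ × δ × Term C × Term C => F p.1 p.2.1 (.eq p.2.2.1 p.2.2.2))
    (hneg : Tracked fun p : γ × δ × (δ → β) => Hneg p.1 p.2.1 p.2.2)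
    (eneg : ∀ g d q, F g d (.neg q) = Hneg g d fun d => F g d q)
    (hand : Tracked fun p : γ × δ × (δ → β) × (δ → β) => Hand p.1 p.2.1 p.2.2.1 p.2.2.2)
    (eand : ∀ g d q r, F g d (.and q r) = Hand g d (fun d => F g d q) fun d => F g d r)
    (hor : Tracked fun p : γ × δ × (δ → β) × (δ → β) => Hor p.1 p.2.1 p.2.2.1 p.2.2.2)
    (eor : ∀ g d q r, F g d (.or q r) = Hor g d (fun d => F g d q) fun d => F g d r)
    (hex : Tracked fun p : γ × δ × ℕ × (δ → β) => Hex p.1 p.2.1 p.2.2.1 p.2.2.2)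
    (eex : ∀ g d x q, F g d (.ex x q) = Hex g d x fun d => F g d q) :
    Tracked fun p : (γ × δ) × Query C => F p.1.1 p.1.2 p.2 := by
  refine .of_treeRec sizeOf 7 (fun n q h => ?_) fun k hk => ?_
  · rw [names_query_iff] at h; subst h; cases q <;> simp [Query.code]
  · interval_cases k
    · refine .leaf (B := ℕ) (fun _ => .tru) (fun m t h => ?_)
        (htru.comp (g := fun p : γ × δ => F p.1 p.2 .tru)
          (f := fun p : γ × δ × ℕ => (p.1, p.2.1)) (by fun_prop))
      rw [names_query_iff] at h
      cases t <;> simp [Query.code] at h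
      exact ⟨m, rfl, rfl⟩
    · refine .leaf .rel (fun m t h => ?_) hrel
      rw [names_query_iff] at h
      cases t <;> simp [Query.code] at h
      exact ⟨_, rfl, names_termAtom_iff.2 h⟩
    · refine .leaf (fun p : Term C × Term C => .eq p.1 p.2) (fun m t h => ?_) heq
      rw [names_query_iff] at h
      cases t <;> simp [Query.code] at h
      exact ⟨(_, _), rfl, h ▸ names_pair rfl rfl⟩
    · refine .unary .neg (fun m t h => ?_) (by simp) hneg eneg
      rw [names_query_iff] at h
      cases t <;> simp [Query.code] at h
      exact ⟨_, rfl, h⟩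
    · refine .binary .and (fun m t h => ?_) (fun _ _ => by simp; omega) hand eand
      rw [names_query_iff] at h
      cases t <;> simp [Query.code] at h
      exact ⟨_, _, rfl, h ▸ names_pair rfl rfl⟩
    · refine .binary .or (fun m t h => ?_) (fun _ _ => by simp; omega) hor eor
      rw [names_query_iff] at h
      cases t <;> simp [Query.code] at h
      exact ⟨_, _, rfl, h ▸ names_pair rfl rfl⟩
    · refine .labeled .ex (fun m t h => ?_) (fun _ _ => by simp) hex eex
      rw [names_query_iff] at h
      cases t <;> simp [Query.code] at h
      exact ⟨_, _, rfl, h ▸ names_pair rfl rfl⟩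

instance : Represented (MuLA C) := ⟨fun n q => n = q.code⟩

theorem names_muLA_iff {n : ℕ} {Φ : MuLA C} : Names n Φ ↔ n = Φ.code := Iff.rfl

theorem Tracked.of_muLARec {F : γ → δ → MuLA C → β}
    {Hneg Hdia : γ → δ → (δ → β) → β} {Hand : γ → δ → (δ → β) → (δ → β) → β}
    {Hex Hmu : γ → δ → ℕ → (δ → β) → β}
    (hquery : Tracked fun p : γ × δ × Query C => F p.1 p.2.1 (.query p.2.2))
    (hneg : Tracked fun p : γ × δ × (δ → β) => Hneg p.1 p.2.1 p.2.2)
    (eneg : ∀ g d q, F g d (.neg q) = Hneg g d fun d => F g d q)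
    (hand : Tracked fun p : γ × δ × (δ → β) × (δ → β) => Hand p.1 p.2.1 p.2.2.1 p.2.2.2)
    (eand : ∀ g d q r, F g d (.and q r) = Hand g d (fun d => F g d q) fun d => F g d r)
    (hex : Tracked fun p : γ × δ × ℕ × (δ → β) => Hex p.1 p.2.1 p.2.2.1 p.2.2.2)
    (eex : ∀ g d x q, F g d (.exLive x q) = Hex g d x fun d => F g d q)
    (hdia : Tracked fun p : γ × δ × (δ → β) => Hdia p.1 p.2.1 p.2.2)
    (edia : ∀ g d q, F g d (.dia q) = Hdia g d fun d => F g d q)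
    (hpvar : Tracked fun p : γ × δ × ℕ => F p.1 p.2.1 (.pvar p.2.2))
    (hmu : Tracked fun p : γ × δ × ℕ × (δ → β) => Hmu p.1 p.2.1 p.2.2.1 p.2.2.2)
    (emu : ∀ g d x q, F g d (.mu x q) = Hmu g d x fun d => F g d q) :
    Tracked fun p : (γ × δ) × MuLA C => F p.1.1 p.1.2 p.2 := by
  refine .of_treeRec sizeOf 7 (fun n q h => ?_) fun k hk => ?_
  · rw [names_muLA_iff] at h; subst h; cases q <;> simp [MuLA.code]
  · interval_cases k
    · refine .leaf .query (fun m t h => ?_) hquery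
      rw [names_muLA_iff] at h
      cases t <;> simp [MuLA.code] at h
      exact ⟨_, rfl, h⟩
    · refine .unary .neg (fun m t h => ?_) (by simp) hneg eneg
      rw [names_muLA_iff] at h
      cases t <;> simp [MuLA.code] at h
      exact ⟨_, rfl, h⟩
    · refine .binary .and (fun m t h => ?_) (fun _ _ => by simp; omega) hand eand
      rw [names_muLA_iff] at h
      cases t <;> simp [MuLA.code] at h
      exact ⟨_, _, rfl, h ▸ names_pair rfl rfl⟩
    · refine .labeled .exLive (fun m t h => ?_) (fun _ _ => by simp) hex eex
      rw [names_muLA_iff] at h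
      cases t <;> simp [MuLA.code] at h
      exact ⟨_, _, rfl, h ▸ names_pair rfl rfl⟩
    · refine .unary .dia (fun m t h => ?_) (by simp) hdia edia
      rw [names_muLA_iff] at h
      cases t <;> simp [MuLA.code] at h
      exact ⟨_, rfl, h⟩
    · refine .leaf .pvar (fun m t h => ?_) hpvar
      rw [names_muLA_iff] at h
      cases t <;> simp [MuLA.code] at h
      exact ⟨_, rfl, h⟩
    · refine .labeled .mu (fun m t h => ?_) (fun _ _ => by simp) hmu emu
      rw [names_muLA_iff] at h
      cases t <;> simp [MuLA.code] at h
      exact ⟨_, _, rfl, h ▸ names_pair rfl rfl⟩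

end Descriptions
end DataCentric

namespace DataCentric
set_option linter.unusedSectionVars false
open Nat.Partrec (Code)
open Encodable Denumerable
open Represented (Names)

/-! ### Names of effects, systems, finite transition systems and propositional formulas -/

section
variable {C : Type*} [Denumerable C] [Represented C] [GodelNamed C]
variable {β γ δ : Type*} [Represented β] [Represented γ] [Represented δ]

instance : Represented (EffTerm C) := ⟨fun n t => n = t.code⟩

theorem names_effTerm_iff {n : ℕ} {t : EffTerm C} : Names n t ↔ n = t.code := Iff.rfl

theorem Tracked.of_effTermCases {F : γ → EffTerm C → β}
    (h0 : Tracked fun p : γ × Term C => F p.1 (.base p.2))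
    (h1 : Tracked fun p : γ × ℕ × List (Term C) => F p.1 (.call p.2.1 p.2.2))
    {g : γ → EffTerm C} (hg : Tracked g) : Tracked fun x => F x (g x) :=
  .of_cases EffTerm.base (fun p : ℕ × List (Term C) => EffTerm.call p.1 p.2) (fun n t h => by
    rw [names_effTerm_iff] at h; subst h; cases t <;> simp [EffTerm.code])
    (fun m t h => by
      rw [names_effTerm_iff] at h
      cases t <;> simp [EffTerm.code] at h
      exact ⟨_, rfl, h⟩)
    (fun m t h => by
      rw [names_effTerm_iff] at h
      cases t <;> simp [EffTerm.code] at h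
      exact ⟨(_, _), rfl, h ▸ names_pair rfl (names_termList_iff.2 rfl)⟩) h0 h1 hg

/-- The name of a ground term consists of a tag and a name of the content. -/
def GroundTerm.NamedBy (n : ℕ) : GroundTerm C → Prop
  | .val c => n.unpair.1 = 0 ∧ Names n.unpair.2 c
  | .call f args => n.unpair.1 = 1 ∧ Names n.unpair.2 (f, args)

instance : Represented (GroundTerm C) := ⟨GroundTerm.NamedBy⟩

@[fun_prop]
theorem Tracked.groundTerm_val {f : γ → C} (hf : Tracked f) : Tracked fun x => GroundTerm.val (f x) :=
  Tracked.comp (g := fun c : C => GroundTerm.val c) (.of_computable (fun n => Nat.pair 0 n)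
    (.natPair (.const 0) .id) fun n c h => show _ ∧ _ by simpa using h) hf

@[fun_prop]
theorem Tracked.groundTerm_call {f : γ → ℕ} {g : γ → List C} (hf : Tracked f) (hg : Tracked g) :
    Tracked fun x => GroundTerm.call (f x) (g x) :=
  Tracked.comp (g := fun p : ℕ × List C => GroundTerm.call p.1 p.2)
    (.of_computable (fun n => Nat.pair 1 n)
    (.natPair (.const 1) .id) fun n c h => show _ ∧ _ by simpa using h) (hf.prodMk hg)

theorem Tracked.of_groundTermCases {F : γ → GroundTerm C → β}
    (h0 : Tracked fun p : γ × C => F p.1 (.val p.2))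
    (h1 : Tracked fun p : γ × ℕ × List C => F p.1 (.call p.2.1 p.2.2))
    {g : γ → GroundTerm C} (hg : Tracked g) : Tracked fun x => F x (g x) := by
  refine .of_cases GroundTerm.val (fun p : ℕ × List C => GroundTerm.call p.1 p.2)
    (fun n t h => ?_) (fun m t h => ?_) (fun m t h => ?_) h0 h1 hg
  · cases t <;> have := h.1 <;> omega
  · cases t <;> obtain ⟨h1, h2⟩ := h <;> simp at h1 h2
    exact ⟨_, rfl, h2⟩
  · cases t <;> obtain ⟨h1, h2⟩ := h <;> simp at h1 h2
    exact ⟨(_, _), rfl, h2⟩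

instance : Represented (EqConstraint C) := ⟨fun n e => Names n (e.query, e.eqs)⟩
instance : Represented (Effect C) := ⟨fun n e => Names n (e.qpos, e.qneg, e.facts)⟩
instance : Represented (Action C) := ⟨fun n α => Names n (α.params, α.effects)⟩
instance : Represented (Rule C) := ⟨fun n r => Names n (r.cond, r.action)⟩
instance : Represented (DCDS C) := ⟨fun n S =>
  Names n (S.schema, S.constraints, S.init, S.services, S.actions, S.rules)⟩
instance : Represented (FinTS C) := ⟨fun n F => Names n (F.initLabel, F.labels, F.edges)⟩

theorem Tracked.eqConstraint_fields :
    Tracked fun e : EqConstraint C => (e.query, e.eqs) := .of_computable _ .id fun _ _ h => h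
theorem Tracked.effect_fields :
    Tracked fun e : Effect C => (e.qpos, e.qneg, e.facts) := .of_computable _ .id fun _ _ h => h
theorem Tracked.action_fields :
    Tracked fun α : Action C => (α.params, α.effects) := .of_computable _ .id fun _ _ h => h
theorem Tracked.rule_fields :
    Tracked fun r : Rule C => (r.cond, r.action) := .of_computable _ .id fun _ _ h => h
theorem Tracked.dcds_fields : Tracked fun S : DCDS C =>
    (S.schema, S.constraints, S.init, S.services, S.actions, S.rules) :=
  .of_computable _ .id fun _ _ h => h
theorem Tracked.finTS_fields :
    Tracked fun F : FinTS C => (F.initLabel, F.labels, F.edges) := .of_computable _ .id fun _ _ h => h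

@[fun_prop]
theorem Tracked.eqConstraint_query {f : γ → EqConstraint C} (hf : Tracked f) :
    Tracked fun x => (f x).query := (eqConstraint_fields.comp hf).fst
@[fun_prop]
theorem Tracked.eqConstraint_eqs {f : γ → EqConstraint C} (hf : Tracked f) :
    Tracked fun x => (f x).eqs := (eqConstraint_fields.comp hf).snd
@[fun_prop]
theorem Tracked.effect_qpos {f : γ → Effect C} (hf : Tracked f) :
    Tracked fun x => (f x).qpos := (effect_fields.comp hf).fst
@[fun_prop]
theorem Tracked.effect_qneg {f : γ → Effect C} (hf : Tracked f) :
    Tracked fun x => (f x).qneg := (effect_fields.comp hf).snd.fst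
@[fun_prop]
theorem Tracked.effect_facts {f : γ → Effect C} (hf : Tracked f) :
    Tracked fun x => (f x).facts := (effect_fields.comp hf).snd.snd
@[fun_prop]
theorem Tracked.action_params {f : γ → Action C} (hf : Tracked f) :
    Tracked fun x => (f x).params := (action_fields.comp hf).fst
@[fun_prop]
theorem Tracked.action_effects {f : γ → Action C} (hf : Tracked f) :
    Tracked fun x => (f x).effects := (action_fields.comp hf).snd
@[fun_prop]
theorem Tracked.rule_cond {f : γ → Rule C} (hf : Tracked f) :
    Tracked fun x => (f x).cond := (rule_fields.comp hf).fst
@[fun_prop]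
theorem Tracked.rule_action {f : γ → Rule C} (hf : Tracked f) :
    Tracked fun x => (f x).action := (rule_fields.comp hf).snd
@[fun_prop]
theorem Tracked.dcds_constraints {f : γ → DCDS C} (hf : Tracked f) :
    Tracked fun x => (f x).constraints := (dcds_fields.comp hf).snd.fst
@[fun_prop]
theorem Tracked.dcds_init {f : γ → DCDS C} (hf : Tracked f) :
    Tracked fun x => (f x).init := (dcds_fields.comp hf).snd.snd.fst
@[fun_prop]
theorem Tracked.dcds_actions {f : γ → DCDS C} (hf : Tracked f) :
    Tracked fun x => (f x).actions := (dcds_fields.comp hf).snd.snd.snd.snd.fst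
@[fun_prop]
theorem Tracked.dcds_rules {f : γ → DCDS C} (hf : Tracked f) :
    Tracked fun x => (f x).rules := (dcds_fields.comp hf).snd.snd.snd.snd.snd
@[fun_prop]
theorem Tracked.finTS_initLabel {f : γ → FinTS C} (hf : Tracked f) :
    Tracked fun x => (f x).initLabel := (finTS_fields.comp hf).fst
@[fun_prop]
theorem Tracked.finTS_labels {f : γ → FinTS C} (hf : Tracked f) :
    Tracked fun x => (f x).labels := (finTS_fields.comp hf).snd.fst
@[fun_prop]
theorem Tracked.finTS_edges {f : γ → FinTS C} (hf : Tracked f) :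
    Tracked fun x => (f x).edges := (finTS_fields.comp hf).snd.snd

theorem names_fact_code (f : Fact C) : Names f.code f :=
  names_relAtom_code fun _ _ => names_const_iff.2 rfl

/-- The code of a data-centric dynamic system is a name of it. -/
theorem names_dcds_code (S : DCDS C) : Names S.code S := by
  refine names_pair (names_codeList fun _ _ => rfl) (names_pair (names_codeList fun e _ => ?_)
    (names_pair (names_codeList fun f _ => names_fact_code f) (names_pair
    (names_codeList fun _ _ => rfl) (names_pair (names_codeList fun α _ => ?_)
    (names_codeList fun r _ => names_pair rfl rfl)))))
  · exact names_pair rfl (names_codeList fun _ _ => names_pair rfl rfl)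
  · exact names_pair (names_codeList fun _ _ => rfl) (names_codeList fun e _ =>
      names_pair rfl (names_pair rfl (names_codeList fun E _ => names_relAtom_code fun _ _ => rfl)))

theorem eq_fact_code {n : ℕ} {f : Fact C} (h : Names n f) : n = f.code :=
  eq_relAtom_code (fun _ _ => names_const_iff.1) h

/-- The algorithms are only known to produce names. Names of finite transition systems are unique,
so the number produced is the code that the theorem asks for. -/
theorem eq_finTS_code {n : ℕ} {F : FinTS C} (h : Names n F) : n = F.code := by
  have h1 := eq_codeList (fun _ _ => eq_fact_code) (names_fst h)
  have h2 := eq_codeList (fun _ _ => eq_codeList fun _ _ => eq_fact_code)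
    (names_fst (names_snd h))
  have h3 := eq_codeList (code := fun e : ℕ × ℕ => Nat.pair e.1 e.2) (fun n x hx => by
    have h1 : n.unpair.1 = x.1 := hx.1
    have h2 : n.unpair.2 = x.2 := hx.2
    rw [← h1, ← h2, Nat.pair_unpair]) (names_snd (names_snd h))
  dsimp only at h1 h2 h3
  rw [FinTS.code, ← h1, ← h2, ← h3]
  simp

instance : Represented (GroundProp C) := ⟨fun n a => n = a.code⟩
instance : Represented (PropMu (GroundProp C)) := ⟨fun n φ => n = φ.code⟩

@[fun_prop]
theorem Tracked.groundProp_query {f : γ → Query C} (hf : Tracked f) :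
    Tracked fun x => GroundProp.query (f x) :=
  Tracked.comp (g := fun q : Query C => GroundProp.query q) (.of_computable
    (fun n => Nat.pair 0 n) (.natPair (.const _) .id) fun n q h => by
      obtain rfl : n = _ := h; rfl) hf

@[fun_prop]
theorem Tracked.groundProp_live {f : γ → C} (hf : Tracked f) :
    Tracked fun x => GroundProp.live (f x) :=
  Tracked.comp (g := fun q : C => GroundProp.live q) (.of_computable
    (fun n => Nat.pair 1 n) (.natPair (.const _) .id) fun n q h => by
      rw [names_const_iff] at h
      subst h; rfl) hf

@[fun_prop]
theorem Tracked.propMu_atom {f : γ → GroundProp C} (hf : Tracked f) :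
    Tracked fun x => PropMu.atom (f x) :=
  Tracked.comp (g := fun q : GroundProp C => PropMu.atom q) (.of_computable
    (fun n => Nat.pair 1 n) (.natPair (.const _) .id) fun n q h => by
      obtain rfl : n = _ := h; rfl) hf

@[fun_prop]
theorem Tracked.propMu_tru : Tracked fun _ : γ => (PropMu.tru : PropMu (GroundProp C)) :=
  .const_of_names (m := Nat.pair 0 0) rfl

@[fun_prop]
theorem Tracked.propMu_neg {f : γ → PropMu (GroundProp C)} (hf : Tracked f) :
    Tracked fun x => PropMu.neg (f x) :=
  Tracked.comp (g := fun q : PropMu (GroundProp C) => PropMu.neg q) (.of_computable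
    (fun n => Nat.pair 2 n) (.natPair (.const _) .id) fun n q h => by
      obtain rfl : n = _ := h; rfl) hf

@[fun_prop]
theorem Tracked.propMu_and {f g : γ → PropMu (GroundProp C)} (hf : Tracked f) (hg : Tracked g) :
    Tracked fun x => PropMu.and (f x) (g x) :=
  Tracked.comp (g := fun q : PropMu (GroundProp C) × PropMu (GroundProp C) => PropMu.and q.1 q.2)
    (.of_computable (fun n => Nat.pair 3 n) (.natPair (.const _) .id) fun n q h => by
      obtain ⟨h1, h2⟩ : n.unpair.1 = _ ∧ n.unpair.2 = _ := h
      show _ = _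
      rw [PropMu.code, ← h1, ← h2, Nat.pair_unpair]) (hf.prodMk hg)

@[fun_prop]
theorem Tracked.propMu_dia {f : γ → PropMu (GroundProp C)} (hf : Tracked f) :
    Tracked fun x => PropMu.dia (f x) :=
  Tracked.comp (g := fun q : PropMu (GroundProp C) => PropMu.dia q) (.of_computable
    (fun n => Nat.pair 4 n) (.natPair (.const _) .id) fun n q h => by
      obtain rfl : n = _ := h; rfl) hf

@[fun_prop]
theorem Tracked.propMu_pvar {f : γ → ℕ} (hf : Tracked f) :
    Tracked fun x => (PropMu.pvar (f x) : PropMu (GroundProp C)) :=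
  Tracked.comp (g := fun q : ℕ => (PropMu.pvar q : PropMu (GroundProp C))) (.of_computable
    (fun n => Nat.pair 5 n) (.natPair (.const _) .id) fun n q h => by
      obtain rfl : n = _ := h; rfl) hf

@[fun_prop]
theorem Tracked.propMu_mu {f : γ → ℕ} {g : γ → PropMu (GroundProp C)} (hf : Tracked f)
    (hg : Tracked g) : Tracked fun x => PropMu.mu (f x) (g x) :=
  Tracked.comp (g := fun q : ℕ × PropMu (GroundProp C) => PropMu.mu q.1 q.2)
    (.of_computable (fun n => Nat.pair 6 n) (.natPair (.const _) .id) fun n q h => by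
      obtain ⟨h1, h2⟩ : n.unpair.1 = _ ∧ n.unpair.2 = _ := h
      show _ = _
      rw [PropMu.code, ← h1, ← h2, Nat.pair_unpair]) (hf.prodMk hg)

@[fun_prop]
theorem Tracked.query_rel {f : γ → RelAtom (Term C)} (hf : Tracked f) :
    Tracked fun x => Query.rel (f x) :=
  Tracked.comp (g := fun q : RelAtom (Term C) => Query.rel q) (.of_computable
    (fun n => Nat.pair 1 n) (.natPair (.const _) .id) fun n q h => by
      rw [names_termAtom_iff] at h
      subst h; rfl) hf

@[fun_prop]
theorem Tracked.query_tru : Tracked fun _ : γ => (Query.tru : Query C) :=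
  .const_of_names (m := Nat.pair 0 0) rfl

@[fun_prop]
theorem Tracked.query_neg {f : γ → Query C} (hf : Tracked f) :
    Tracked fun x => Query.neg (f x) :=
  Tracked.comp (g := fun q : Query C => Query.neg q) (.of_computable
    (fun n => Nat.pair 3 n) (.natPair (.const _) .id) fun n q h => by
      obtain rfl : n = _ := h; rfl) hf

@[fun_prop]
theorem Tracked.query_eq {f g : γ → Term C} (hf : Tracked f) (hg : Tracked g) :
    Tracked fun x => Query.eq (f x) (g x) :=
  Tracked.comp (g := fun q : Term C × Term C => Query.eq q.1 q.2)
    (.of_computable (fun n => Nat.pair 2 n) (.natPair (.const _) .id) fun n q h => by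
      obtain ⟨h1, h2⟩ : n.unpair.1 = _ ∧ n.unpair.2 = _ := h
      show _ = _
      rw [Query.code, ← h1, ← h2, Nat.pair_unpair]) (hf.prodMk hg)

@[fun_prop]
theorem Tracked.query_and {f g : γ → Query C} (hf : Tracked f) (hg : Tracked g) :
    Tracked fun x => Query.and (f x) (g x) :=
  Tracked.comp (g := fun q : Query C × Query C => Query.and q.1 q.2)
    (.of_computable (fun n => Nat.pair 4 n) (.natPair (.const _) .id) fun n q h => by
      obtain ⟨h1, h2⟩ : n.unpair.1 = _ ∧ n.unpair.2 = _ := h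
      show _ = _
      rw [Query.code, ← h1, ← h2, Nat.pair_unpair]) (hf.prodMk hg)

@[fun_prop]
theorem Tracked.query_or {f g : γ → Query C} (hf : Tracked f) (hg : Tracked g) :
    Tracked fun x => Query.or (f x) (g x) :=
  Tracked.comp (g := fun q : Query C × Query C => Query.or q.1 q.2)
    (.of_computable (fun n => Nat.pair 5 n) (.natPair (.const _) .id) fun n q h => by
      obtain ⟨h1, h2⟩ : n.unpair.1 = _ ∧ n.unpair.2 = _ := h
      show _ = _
      rw [Query.code, ← h1, ← h2, Nat.pair_unpair]) (hf.prodMk hg)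

@[fun_prop]
theorem Tracked.query_ex {f : γ → ℕ} {g : γ → Query C} (hf : Tracked f) (hg : Tracked g) :
    Tracked fun x => Query.ex (f x) (g x) :=
  Tracked.comp (g := fun q : ℕ × Query C => Query.ex q.1 q.2)
    (.of_computable (fun n => Nat.pair 6 n) (.natPair (.const _) .id) fun n q h => by
      obtain ⟨h1, h2⟩ : n.unpair.1 = _ ∧ n.unpair.2 = _ := h
      show _ = _
      rw [Query.code, ← h1, ← h2, Nat.pair_unpair]) (hf.prodMk hg)

/-! ### Semantics of queries is tracked -/

@[fun_prop]
theorem Tracked.term_eval {v : γ → ℕ → C} {t : γ → Term C} (hv : Tracked v) (ht : Tracked t) :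
    Tracked fun x => (t x).eval (v x) :=
  .of_termCases (F := fun x t => t.eval (v x))
    (by simp only [Term.eval]; exact .app (hv.comp (.fst .id)) (.snd .id))
    (by simp only [Term.eval]; fun_prop) ht

@[fun_prop]
theorem Tracked.term_subst {v : γ → ℕ → Term C} {t : γ → Term C} (hv : Tracked v)
    (ht : Tracked t) : Tracked fun x => (t x).subst (v x) :=
  .of_termCases (F := fun x t => t.subst (v x))
    (by simp only [Term.subst]; exact .app (hv.comp (.fst .id)) (.snd .id))
    (by simp only [Term.subst]; fun_prop) ht

@[fun_prop]
theorem Tracked.term_vars {t : γ → Term C} (ht : Tracked t) : Tracked fun x => (t x).vars :=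
  .of_termCases (F := fun _ t => t.vars) (by simp only [Term.vars]; fun_prop)
    (by simp only [Term.vars]; fun_prop) ht

@[fun_prop]
theorem tracked_adom {I : γ → Instance C} (hI : Tracked I) : Tracked fun x => adom (I x) := by
  have : (fun x => adom (I x)) = fun x => bUnion (I x) fun f => {c | c ∈ f.args} := rfl
  rw [this]
  fun_prop

-- The valuation is the variable parameter of the recursion, since quantifiers update it. They range
-- over the active domain of an instance, which is finite as soon as the instance has a name.
@[fun_prop]
theorem Tracked.holds {I : γ → Instance C} {v : γ → ℕ → C} {q : γ → Query C} (hI : Tracked I)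
    (hv : Tracked v) (hq : Tracked q) : Tracked fun x => (q x).Holds (I x) (v x) := by
  refine Tracked.comp (g := fun p : (Instance C × (ℕ → C)) × Query C => p.2.Holds p.1.1 p.1.2)
    (.of_queryRec (F := fun I v q => q.Holds I v) (Hneg := fun _ v r => ¬ r v)
      (Hand := fun _ v r s => r v ∧ s v) (Hor := fun _ v r s => r v ∨ s v)
      (Hex := fun I v x r => ExIn (adom I) fun c => r (Function.update v x c))
      ?_ ?_ ?_ ?_ ?_ ?_ ?_ ?_ ?_ ?_ ?_) ((hI.prodMk hv).prodMk hq)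
  · simp only [Query.Holds]; fun_prop
  · simp only [Query.Holds]; fun_prop
  · simp only [Query.Holds]; fun_prop
  · exact .not (.app (.snd (.snd .id)) (.fst (.snd .id)))
  · intros; rfl
  · exact .and (.app (.fst (.snd (.snd .id))) (.fst (.snd .id)))
      (.app (.snd (.snd (.snd .id))) (.fst (.snd .id)))
  · intros; rfl
  · exact .or (.app (.fst (.snd (.snd .id))) (.fst (.snd .id)))
      (.app (.snd (.snd (.snd .id))) (.fst (.snd .id)))
  · intros; rfl
  · exact .exIn (by fun_prop) (.app (by fun_prop) (by fun_prop))
  · intros; rfl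

@[fun_prop]
theorem Tracked.query_fv {q : γ → Query C} (hq : Tracked q) : Tracked fun x => (q x).fv := by
  refine Tracked.comp (g := fun p : (ℕ × ℕ) × Query C => p.2.fv)
    (.of_queryRec (F := fun _ _ q => q.fv) (Hneg := fun _ v r => r v)
      (Hand := fun _ v r s => r v ∪ s v) (Hor := fun _ v r s => r v ∪ s v)
      (Hex := fun _ v x r => r v \ {x})
      ?_ ?_ ?_ ?_ ?_ ?_ ?_ ?_ ?_ ?_ ?_) (f := fun x => ((0, 0), q x)) (by fun_prop)
  · simp only [Query.fv]; fun_prop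
  · have : (fun p : ℕ × ℕ × RelAtom (Term C) => (Query.rel p.2.2).fv) =
      fun p => bUnion {t | t ∈ p.2.2.args} Term.vars := rfl
    rw [this]; fun_prop
  · simp only [Query.fv]; fun_prop
  · exact .app (.snd (.snd .id)) (.fst (.snd .id))
  · intros; rfl
  · exact .union (.app (.fst (.snd (.snd .id))) (.fst (.snd .id)))
      (.app (.snd (.snd (.snd .id))) (.fst (.snd .id)))
  · intros; rfl
  · exact .union (.app (.fst (.snd (.snd .id))) (.fst (.snd .id)))
      (.app (.snd (.snd (.snd .id))) (.fst (.snd .id)))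
  · intros; rfl
  · exact .diff (.app (by fun_prop) (by fun_prop)) (by fun_prop)
  · intros; rfl

@[fun_prop]
theorem Tracked.query_subst {v : γ → ℕ → Term C} {q : γ → Query C}
    (hv : Tracked v) (hq : Tracked q) : Tracked fun x => (q x).subst (v x) := by
  refine Tracked.comp (g := fun p : (ℕ × (ℕ → Term C)) × Query C => p.2.subst p.1.2)
    (.of_queryRec (F := fun _ v q => q.subst v) (Hneg := fun _ v r => .neg (r v))
      (Hand := fun _ v r s => .and (r v) (s v)) (Hor := fun _ v r s => .or (r v) (s v))
      (Hex := fun _ v x r => .ex x (r (Function.update v x (Term.var x))))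
      ?_ ?_ ?_ ?_ ?_ ?_ ?_ ?_ ?_ ?_ ?_) (f := fun x => ((0, v x), q x)) (by fun_prop)
  · simp only [Query.subst]; fun_prop
  · simp only [Query.subst]; fun_prop
  · simp only [Query.subst]; fun_prop
  · exact .query_neg (.app (.snd (.snd .id)) (.fst (.snd .id)))
  · intros; rfl
  · exact .query_and (.app (.fst (.snd (.snd .id))) (.fst (.snd .id)))
      (.app (.snd (.snd (.snd .id))) (.fst (.snd .id)))
  · intros; rfl
  · exact .query_or (.app (.fst (.snd (.snd .id))) (.fst (.snd .id)))
      (.app (.snd (.snd (.snd .id))) (.fst (.snd .id)))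
  · intros; rfl
  · exact .query_ex (by fun_prop) (.app (by fun_prop) (by fun_prop))
  · intros; rfl

/-! ### Grounding is tracked -/

theorem Tracked.groundAux : Tracked fun p : (List C × (ℕ → Term C)) × MuLA C =>
    p.2.groundAux p.1.1 p.1.2 := by
  refine .of_muLARec (F := fun D σ Φ => Φ.groundAux D σ) (Hneg := fun _ σ r => .neg (r σ))
    (Hdia := fun _ σ r => .dia (r σ)) (Hand := fun _ σ r s => .and (r σ) (s σ))
    (Hex := fun D σ x r => .disj (D.map fun t =>
      .and (.atom (.live t)) (r (Function.update σ x (Term.const t)))))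
    (Hmu := fun _ σ Z r => .mu Z (r σ)) ?_ ?_ ?_ ?_ ?_ ?_ ?_ ?_ ?_ ?_ ?_ ?_
  · simp only [MuLA.groundAux]; fun_prop
  · exact .propMu_neg (.app (.snd (.snd .id)) (.fst (.snd .id)))
  · intros; rfl
  · exact .propMu_and (.app (.fst (.snd (.snd .id))) (.fst (.snd .id)))
      (.app (.snd (.snd (.snd .id))) (.fst (.snd .id)))
  · intros; rfl
  · unfold PropMu.disj PropMu.or
    refine .listFoldr (by fun_prop) (by fun_prop) (.listMap ?_ (by fun_prop))
    exact .propMu_and (by fun_prop) (.app (by fun_prop) (by fun_prop))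
  · intros; rfl
  · exact .propMu_dia (.app (.snd (.snd .id)) (.fst (.snd .id)))
  · intros; rfl
  · simp only [MuLA.groundAux]; fun_prop
  · exact .propMu_mu (by fun_prop) (.app (by fun_prop) (by fun_prop))
  · intros; rfl

theorem Tracked.ground {F : γ → FinTS C} {Φ : γ → MuLA C} (hF : Tracked F) (hΦ : Tracked Φ) :
    Tracked fun x => (Φ x).ground (F x).adomList := by
  have h1 : Tracked fun x => (F x).adomList := by
    have : (fun x => (F x).adomList) = fun x => ((((F x).initLabel :: (F x).labels).flatMap
        fun l => l).flatMap fun f => f.args) := by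
      funext x; simp [FinTS.adomList, List.flatMap_def]
    rw [this]
    fun_prop
  have h2 : Tracked fun _ : γ => (Term.var : ℕ → Term C) := .curry (by fun_prop)
  exact Tracked.groundAux.comp (f := fun x => (((F x).adomList, Term.var), Φ x)) (by fun_prop)

end
end DataCentric

namespace DataCentric
set_option linter.unusedSectionVars false
open Nat.Partrec (Code)
open Encodable Denumerable
open Represented (Names)

/-! ### The finite abstraction of a data-centric dynamic system -/

/-- An instance together with the graph of a service call map. -/
abbrev GState (C : Type*) := Instance C × Set ((ℕ × List C) × C)

/-- A function that is constant. -/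
def defaultFun (α C : Type*) [Denumerable C] : α → C := fun _ => ofNat C 0

section
variable {C : Type*}

/-- The service call that a ground term is, if any. -/
def GroundTerm.callSet : GroundTerm C → Set (ℕ × List C)
  | .val _ => ∅
  | .call f args => {(f, args)}

/-- The values of a ground term for the graph of a service call map. -/
def GroundTerm.valSet (G : Set ((ℕ × List C) × C)) : GroundTerm C → Set C
  | .val c => {c}
  | .call f args => Prod.snd '' sepSet G fun p => p.1 = (f, args)

/-- The lists of values of a list of ground terms. -/
def argVals (G : Set ((ℕ × List C) × C)) : List (GroundTerm C) → Set (List C)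
  | [] => {[]}
  | t :: ts => bUnion (t.valSet G) fun c => (fun l => c :: l) '' argVals G ts

/-- The instance obtained by evaluating ground facts with the graph of a service call map. -/
def applyGraph (G : Set ((ℕ × List C) × C)) (E : Set (RelAtom (GroundTerm C))) : Instance C :=
  bUnion E fun g => (fun l => RelAtom.mk g.rel l) '' argVals G g.args

/-- The service calls in a set of ground facts that have no result yet. -/
def newCalls (E : Set (RelAtom (GroundTerm C))) (G : Set ((ℕ × List C) × C)) : Set (ℕ × List C) :=
  (bUnion E fun g => bUnion {u | u ∈ g.args} GroundTerm.callSet) \ (Prod.fst '' G)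

/-- The constants that are initially active or are results of service calls. -/
def DCDS.vals (S : DCDS C) (G : Set ((ℕ × List C) × C)) : Set C := adom S.initInst ∪ Prod.snd '' G

variable [Denumerable C]

/-- Satisfaction of an equality constraint, tested on finitely many assignments. -/
def EqConstraint.SatFin (ec : EqConstraint C) (I : Instance C) : Prop :=
  AllIn (sepSet (funsOn ec.query.fv (adom I) (defaultFun ℕ C)) fun θ => ec.query.Holds I θ)
    fun θ => AllIn {e | e ∈ ec.eqs} fun e => e.1.eval θ = e.2.eval θ

/-- The ground facts derived by an action, computed with finitely many assignments. -/
def Action.dooFin (α : Action C) (σ : ℕ → C) (I : Instance C) : Set (RelAtom (GroundTerm C)) :=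
  bUnion {e | e ∈ α.effects} fun e =>
    bUnion (sepSet (funsOn ((e.qpos.and e.qneg).fv \ {p | p ∈ α.params}) (adom I) σ)
      fun θ => (e.qpos.and e.qneg).Holds I θ) fun θ =>
      (fun E : RelAtom (EffTerm C) => RelAtom.mk E.rel (E.args.map (EffTerm.ground θ))) ''
        {E | E ∈ e.facts}

/-- The sets of ground facts derived by the executable actions. -/
def DCDS.moves (S : DCDS C) (I : Instance C) : Set (Set (RelAtom (GroundTerm C))) :=
  bUnion {r | r ∈ S.rules} fun r =>
    bUnion (Prod.fst '' sepSet {p | p ∈ S.actions.zipIdx} fun p => p.2 = r.action) fun α =>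
      (fun σ => α.dooFin σ I) ''
        sepSet (funsOn r.cond.fv (adom I) (defaultFun ℕ C)) fun σ => r.cond.Holds I σ

/-- The extension of the graph of a service call map by results of new calls. -/
def extendGraph (G : Set ((ℕ × List C) × C)) (N : Set (ℕ × List C)) (h : ℕ × List C → C) :
    Set ((ℕ × List C) × C) := G ∪ (fun t => (t, h t)) '' N

/-- The successor states in which the results of new calls are in `D`. -/
def DCDS.succs (S : DCDS C) (D : Set C) (X : GState C) : Set (GState C) :=
  bUnion (S.moves X.1) fun E =>
    bUnion (funsOn (newCalls E X.2) D (defaultFun _ C)) fun h =>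
      sepSet {(applyGraph (extendGraph X.2 (newCalls E X.2) h) E,
        extendGraph X.2 (newCalls E X.2) h)} fun Y =>
        AllIn {ec | ec ∈ S.constraints} fun ec => ec.SatFin Y.1

/-- There is room in `D` for distinct results of all new service calls. -/
def DCDS.Roomy (S : DCDS C) (D : Set C) (X : GState C) : Prop :=
  AllIn (S.moves X.1) fun E => (S.vals X.2).ncard + (newCalls E X.2).ncard ≤ D.ncard

/-- The initially active constants and the first `a` constants. -/
def DCDS.dom (S : DCDS C) (a : ℕ) : Set C := adom S.initInst ∪ {c | encode c < a}

def DCDS.initG (S : DCDS C) : GState C := (S.initInst, ∅)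

/-- The states reachable in at most `k` steps with service results in `S.dom a`. -/
def DCDS.layer (S : DCDS C) (a : ℕ) : ℕ → Set (GState C)
  | 0 => {S.initG}
  | k + 1 => S.layer a k ∪ bUnion (S.layer a k) (S.succs (S.dom a))

/-- The states reachable in `k` steps are all reachable states, and `S.dom a` is large enough. -/
def DCDS.Complete (S : DCDS C) (a k : ℕ) : Prop :=
  AllIn (S.layer a k) fun X => S.succs (S.dom a) X ⊆ S.layer a k ∧ S.Roomy (S.dom a) X

open Classical in
/-- The transitions between listed states. -/
noncomputable def DCDS.edgeList (S : DCDS C) (D : Set C) (Xs : List (GState C)) : List (ℕ × ℕ) :=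
  Xs.zipIdx.flatMap fun p => Xs.zipIdx.flatMap fun q =>
    if q.1 ∈ S.succs D p.1 then [(p.2, q.2)] else []

end

/-! ### Unbounded search and lists of finite sets -/

section
variable {α β γ : Type*} [Represented α] [Represented β] [Represented γ]

-- The start index changes along the list, so the recursion computes the indexed list as a function
-- of this index.
@[fun_prop]
theorem Tracked.zipIdx {l : γ → List α} (hl : Tracked l) : Tracked fun x => (l x).zipIdx := by
  have h : Tracked fun p : ℕ × List α => fun k => p.2.zipIdx k :=
    .of_listRec (f := fun _ l k => l.zipIdx k) (H := fun _ a _ r k => (a, k) :: r (k + 1))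
      (.curry (by simp only [List.zipIdx_nil]; fun_prop))
      (.curry (.cons (by fun_prop) (.app (by fun_prop) (by fun_prop))))
      (by intros; funext k; simp [List.zipIdx_cons])
  exact Tracked.app (f := fun x k => (l x).zipIdx k)
    (h.comp (f := fun x => (0, l x)) (by fun_prop)) (.const 0)

@[fun_prop]
theorem Tracked.unpair {f : γ → ℕ} (hf : Tracked f) : Tracked fun x => (f x).unpair :=
  Tracked.comp (g := Nat.unpair) (.of_computable _ .id fun n m h => by
    obtain rfl : n = m := h; exact ⟨rfl, rfl⟩) hf

/-- Unbounded search. -/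
theorem Tracked.exists_search {p : γ → ℕ → Prop} (hp : Tracked fun q : γ × ℕ => p q.1 q.2) :
    ∃ φ : ℕ →. ℕ, Partrec φ ∧ ∀ n g, Names n g → (∃ m, p g m) → ∃ m ∈ φ n, p g m := by
  obtain ⟨π, hπ, hp⟩ := hp
  refine ⟨fun n => Nat.rfind fun m => (π (Nat.pair n m)).map fun b => decide (b = 1),
    Partrec.rfind (Partrec.map (hπ.comp (Computable.natPair .fst .snd))
      ((PrimrecRel.decide (Primrec.eq (α := ℕ))).to_comp.comp .snd (.const 1))),
    fun n g hn ⟨m, hm⟩ => ?_⟩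
  have key : ∀ m, ∃ b ∈ π (Nat.pair n m), (b = 1 ↔ p g m) := fun m => by
    obtain ⟨b, hb, h⟩ := hp (Nat.pair n m) (g, m) (names_pair hn rfl)
    refine ⟨b, hb, ?_⟩
    rcases h with ⟨rfl, h⟩ | ⟨rfl, h⟩ <;> simpa using h
  have hdom : (Nat.rfind fun m => (π (Nat.pair n m)).map fun b => decide (b = 1)).Dom := by
    refine Nat.rfind_dom.2 ⟨m, ?_, fun {k} _ => ?_⟩
    · obtain ⟨b, hb, h⟩ := key m
      exact (Part.mem_map_iff _).2 ⟨b, hb, by simpa using h.2 hm⟩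
    · obtain ⟨b, hb, _⟩ := key k
      exact Part.dom_iff_mem.2 ⟨_, (Part.mem_map_iff _).2 ⟨b, hb, rfl⟩⟩
  obtain ⟨r, hr⟩ := Part.dom_iff_mem.1 hdom
  refine ⟨r, hr, ?_⟩
  obtain ⟨b, hb, h⟩ := (Part.mem_map_iff _).1 (Nat.rfind_spec hr)
  obtain ⟨b', hb', h'⟩ := key r
  obtain rfl := Part.mem_unique hb hb'
  exact h'.1 (by simpa using h)

/-- A name of a set is already a name of a list, so a name of a list of sets is also a name of a
list of lists. This turns instances into the labels of a `FinTS`, without changing the number. -/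
theorem exists_lists_of_names {n : ℕ} {Is : List (Set α)} (h : Names n Is) :
    ∃ ls : List (List α), Names n ls ∧ List.Forall₂ (fun I l => I = {f | f ∈ l}) Is ls := by
  induction Is generalizing n with
  | nil => exact ⟨[], by rw [names_nil_iff] at h ⊢; exact h, .nil⟩
  | cons I Is ih =>
    obtain ⟨a, b, rfl, ⟨l, hl, hI⟩, hb⟩ := names_cons_iff.1 h
    obtain ⟨ls, hls, h'⟩ := ih hb
    exact ⟨l :: ls, names_cons_iff.2 ⟨a, b, rfl, hl, hls⟩, .cons hI h'⟩

end

/-! ### Computability of the finite abstraction -/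

section
variable {C : Type*} [Denumerable C] [Represented C] [GodelNamed C]
variable {γ : Type*} [Represented γ]

@[fun_prop]
theorem tracked_defaultFun {α : Type*} [Represented α] : Tracked fun _ : γ => defaultFun α C :=
  .curry (by unfold defaultFun; fun_prop)

@[fun_prop]
theorem tracked_callSet {t : γ → GroundTerm C} (ht : Tracked t) : Tracked fun x => (t x).callSet :=
  .of_groundTermCases (F := fun _ t => t.callSet) (by simp only [GroundTerm.callSet]; fun_prop)
    (by simp only [GroundTerm.callSet]; fun_prop) ht

@[fun_prop]
theorem tracked_valSet {G : γ → Set ((ℕ × List C) × C)} {t : γ → GroundTerm C} (hG : Tracked G)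
    (ht : Tracked t) : Tracked fun x => (t x).valSet (G x) :=
  .of_groundTermCases (F := fun x t => t.valSet (G x))
    (by simp only [GroundTerm.valSet]; fun_prop)
    (by simp only [GroundTerm.valSet]; fun_prop) ht

@[fun_prop]
theorem tracked_argVals {G : γ → Set ((ℕ × List C) × C)} {l : γ → List (GroundTerm C)}
    (hG : Tracked G) (hl : Tracked l) : Tracked fun x => argVals (G x) (l x) :=
  Tracked.comp (g := fun p : Set ((ℕ × List C) × C) × List (GroundTerm C) => argVals p.1 p.2)
    (.of_listRec (H := fun G t _ r => bUnion (t.valSet G) fun c => (fun l => c :: l) '' r)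
      (by simp only [argVals]; fun_prop) (by fun_prop) (fun _ _ _ => rfl)) (hG.prodMk hl)

@[fun_prop]
theorem tracked_applyGraph {G : γ → Set ((ℕ × List C) × C)} {E : γ → Set (RelAtom (GroundTerm C))}
    (hG : Tracked G) (hE : Tracked E) : Tracked fun x => applyGraph (G x) (E x) := by
  unfold applyGraph; fun_prop

@[fun_prop]
theorem tracked_newCalls {G : γ → Set ((ℕ × List C) × C)} {E : γ → Set (RelAtom (GroundTerm C))}
    (hE : Tracked E) (hG : Tracked G) : Tracked fun x => newCalls (E x) (G x) := by
  unfold newCalls; fun_prop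

@[fun_prop]
theorem tracked_initInst {S : γ → DCDS C} (hS : Tracked S) : Tracked fun x => (S x).initInst := by
  unfold DCDS.initInst; fun_prop

@[fun_prop]
theorem tracked_vals {S : γ → DCDS C} {G : γ → Set ((ℕ × List C) × C)} (hS : Tracked S)
    (hG : Tracked G) : Tracked fun x => (S x).vals (G x) := by
  unfold DCDS.vals; fun_prop

@[fun_prop]
theorem tracked_satFin {ec : γ → EqConstraint C} {I : γ → Instance C} (hec : Tracked ec)
    (hI : Tracked I) : Tracked fun x => (ec x).SatFin (I x) := by
  unfold EqConstraint.SatFin; fun_prop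

@[fun_prop]
theorem tracked_ground {θ : γ → ℕ → C} {t : γ → EffTerm C} (hθ : Tracked θ) (ht : Tracked t) :
    Tracked fun x => (t x).ground (θ x) :=
  .of_effTermCases (F := fun x t => t.ground (θ x))
    (by simp only [EffTerm.ground]; fun_prop) (by simp only [EffTerm.ground]; fun_prop) ht

@[fun_prop]
theorem tracked_dooFin {α : γ → Action C} {σ : γ → ℕ → C} {I : γ → Instance C} (hα : Tracked α)
    (hσ : Tracked σ) (hI : Tracked I) : Tracked fun x => (α x).dooFin (σ x) (I x) := by
  unfold Action.dooFin; fun_prop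

@[fun_prop]
theorem tracked_moves {S : γ → DCDS C} {I : γ → Instance C} (hS : Tracked S)
    (hI : Tracked I) : Tracked fun x => (S x).moves (I x) := by
  unfold DCDS.moves; fun_prop

@[fun_prop]
theorem tracked_extendGraph {G : γ → Set ((ℕ × List C) × C)} {N : γ → Set (ℕ × List C)}
    {h : γ → ℕ × List C → C} (hG : Tracked G) (hN : Tracked N) (hh : Tracked h) :
    Tracked fun x => extendGraph (G x) (N x) (h x) := by
  unfold extendGraph
  exact .union hG (.image hN (.prodMk (by fun_prop) hh.uncurry))

@[fun_prop]
theorem tracked_succs {S : γ → DCDS C} {D : γ → Set C} {X : γ → GState C} (hS : Tracked S)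
    (hD : Tracked D) (hX : Tracked X) : Tracked fun x => (S x).succs (D x) (X x) := by
  unfold DCDS.succs; fun_prop

@[fun_prop]
theorem tracked_roomy {S : γ → DCDS C} {D : γ → Set C} {X : γ → GState C} (hS : Tracked S)
    (hD : Tracked D) (hX : Tracked X) : Tracked fun x => (S x).Roomy (D x) (X x) := by
  unfold DCDS.Roomy; fun_prop

@[fun_prop]
theorem tracked_dom {S : γ → DCDS C} {a : γ → ℕ} (hS : Tracked S) (ha : Tracked a) :
    Tracked fun x => (S x).dom (a x) := by
  unfold DCDS.dom
  refine .union (by fun_prop) ?_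
  refine Tracked.comp (g := fun p : ℕ × ℕ => {c : C | encode c < p.2})
    (.of_natRec (f := fun _ a => {c : C | encode c < a}) (H := fun _ n r => insert (ofNat C n) r)
      (by simp; fun_prop) (by fun_prop) ?_) (f := fun x => (0, a x)) (by fun_prop)
  intro _ n
  ext c
  simp only [Set.mem_ofPred_eq, Set.mem_insert_iff]
  rw [Nat.lt_succ_iff_lt_or_eq, or_comm]
  refine or_congr_left ⟨fun h => by rw [← h, ofNat_encode], fun h => by rw [h, encode_ofNat]⟩

@[fun_prop]
theorem tracked_initG {S : γ → DCDS C} (hS : Tracked S) : Tracked fun x => (S x).initG := by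
  unfold DCDS.initG; fun_prop

@[fun_prop]
theorem tracked_layer {S : γ → DCDS C} {a k : γ → ℕ} (hS : Tracked S) (ha : Tracked a)
    (hk : Tracked k) : Tracked fun x => (S x).layer (a x) (k x) :=
  Tracked.comp (g := fun p : (DCDS C × ℕ) × ℕ => p.1.1.layer p.1.2 p.2)
    (.of_natRec (f := fun (p : DCDS C × ℕ) k => p.1.layer p.2 k)
      (H := fun p _ r => r ∪ bUnion r (p.1.succs (p.1.dom p.2)))
      (by simp only [DCDS.layer]; fun_prop) (by fun_prop) fun _ _ => rfl)
    ((hS.prodMk ha).prodMk hk)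

@[fun_prop]
theorem tracked_complete {S : γ → DCDS C} {a k : γ → ℕ} (hS : Tracked S) (ha : Tracked a)
    (hk : Tracked k) : Tracked fun x => (S x).Complete (a x) (k x) := by
  unfold DCDS.Complete; fun_prop

open Classical in
@[fun_prop]
theorem tracked_edgeList {S : γ → DCDS C} {D : γ → Set C} {Xs : γ → List (GState C)}
    (hS : Tracked S) (hD : Tracked D) (hX : Tracked Xs) :
    Tracked fun x => (S x).edgeList (D x) (Xs x) := by
  unfold DCDS.edgeList; fun_prop

/-- The description `F` lists the states of a complete layer. -/
structure DCDS.IsAbstraction (S : DCDS C) (F : FinTS C) (a k : ℕ) (Xs : List (GState C)) :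
    Prop where
  complete : S.Complete a k
  states : S.layer a k = {X | X ∈ Xs}
  initLabel : F.initLabel = S.init
  labels : List.Forall₂ (fun X l => X.1 = {f | f ∈ l}) Xs F.labels
  edges : F.edges = S.edgeList (S.dom a) (S.initG :: Xs)

/-- An algorithm that computes a finite abstraction if there is one. -/
theorem exists_abstraction_algorithm : ∃ φ : ℕ →. ℕ, Partrec φ ∧
    ∀ S : DCDS C, (∃ a k, S.Complete a k) →
      ∃ F a k Xs, S.IsAbstraction F a k Xs ∧ ∃ m ∈ φ S.code, Names m F := by
  -- The search runs over the single number `m` that codes the pair of `a` and `k`.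
  obtain ⟨φ, hφ, h1⟩ := Tracked.exists_search
    (p := fun (S : DCDS C) m => S.Complete m.unpair.1 m.unpair.2) (by fun_prop)
  obtain ⟨ψ, hψ, h2⟩ : Tracked fun p : DCDS C × ℕ => p.1.layer p.2.unpair.1 p.2.unpair.2 := by
    fun_prop
  obtain ⟨χ, hχ, h3⟩ : Tracked fun p : (DCDS C × ℕ) × List (GState C) =>
      (p.1.1.init, p.2.map Prod.fst,
        p.1.1.edgeList (p.1.1.dom p.1.2.unpair.1) (p.1.1.initG :: p.2)) := by
    fun_prop
  refine ⟨fun n => (φ n).bind fun m => (ψ (Nat.pair n m)).bind fun l =>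
    χ (Nat.pair (Nat.pair n m) l), hφ.bind (Partrec.bind (hψ.comp (.natPair .fst .snd))
      (hχ.comp (.natPair (.natPair (.comp .fst .fst) (.comp .snd .fst)) .snd))),
    fun S ⟨a, k, hak⟩ => ?_⟩
  have hS := names_dcds_code S
  obtain ⟨m, hm, hc⟩ := h1 _ S hS ⟨Nat.pair a k, by simpa using hak⟩
  -- The number `l` names the layer as a set, hence also a list `Xs` of its elements. This list
  -- fixes the numbering of the abstract states.
  obtain ⟨l, hl, Xs, hXs, hlayer⟩ := h2 _ (S, m) (names_pair hS rfl)
  obtain ⟨r, hr, hr1, hr2, hr3⟩ := h3 _ ((S, m), Xs) (names_pair (names_pair hS rfl) hXs)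
  obtain ⟨ls, hls, hlab⟩ := exists_lists_of_names hr2
  exact ⟨⟨S.init, ls, _⟩, m.unpair.1, m.unpair.2, Xs,
    ⟨hc, hlayer, rfl, List.forall₂_map_left_iff.1 hlab, rfl⟩, r,
    Part.mem_bind hm (Part.mem_bind hl hr), ⟨hr1, hls, hr3⟩⟩

end
end DataCentric

namespace DataCentric
set_option linter.unusedSectionVars false
open Nat.Partrec (Code)
open Encodable Denumerable
open Represented (Names)

/-! ### Dependence on the valuations of the free variables -/

section
variable {C : Type*}

theorem Term.eval_congr {t : Term C} {v w : ℕ → C} (h : ∀ x ∈ t.vars, v x = w x) :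
    t.eval v = t.eval w := by
  cases t with
  | var x => exact h x rfl
  | const c => rfl

theorem Query.holds_congr {I : Instance C} {q : Query C} {v w : ℕ → C}
    (h : ∀ x ∈ q.fv, v x = w x) : q.Holds I v ↔ q.Holds I w := by
  induction q generalizing v w with
  | tru => rfl
  | rel a =>
    have : a.args.map (Term.eval v) = a.args.map (Term.eval w) :=
      List.map_congr_left fun t ht => Term.eval_congr fun x hx => h x ⟨t, ht, hx⟩
    simp only [Query.Holds, this]
  | eq t u =>
    simp only [Query.Holds]
    rw [Term.eval_congr fun x hx => h x (.inl hx), Term.eval_congr fun x hx => h x (.inr hx)]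
  | neg q ih => exact not_congr (ih h)
  | and q r ih1 ih2 =>
    exact and_congr (ih1 fun x hx => h x (.inl hx)) (ih2 fun x hx => h x (.inr hx))
  | or q r ih1 ih2 =>
    exact or_congr (ih1 fun x hx => h x (.inl hx)) (ih2 fun x hx => h x (.inr hx))
  | ex y q ih =>
    refine exists_congr fun c => and_congr_right fun _ => ih fun x hx => ?_
    by_cases hxy : x = y
    · subst hxy; simp
    · simpa [hxy] using h x ⟨hx, hxy⟩

theorem MuLA.ext_congr {T : TransitionSystem C} {Φ : MuLA C} {v w : ℕ → C}
    {V W : ℕ → Set T.State} (h : ∀ x ∈ Φ.fv, v x = w x) (H : ∀ Z ∈ Φ.fpv, V Z = W Z) :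
    Φ.ext T v V = Φ.ext T w W := by
  induction Φ generalizing v w V W with
  | query q => exact Set.ext fun s => Query.holds_congr h
  | neg Φ ih => simp only [ext, ih h H]
  | and Φ Ψ ih1 ih2 =>
    simp only [ext]
    rw [ih1 (fun x hx => h x (.inl hx)) fun x hx => H x (.inl hx),
      ih2 (fun x hx => h x (.inr hx)) fun x hx => H x (.inr hx)]
  | exLive y Φ ih =>
    have : ∀ c, Φ.ext T (Function.update v y c) V = Φ.ext T (Function.update w y c) W :=
      fun c => ih (fun x hx => by
        by_cases hxy : x = y
        · subst hxy; simp
        · simpa [hxy] using h x ⟨hx, hxy⟩) H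
    simp only [ext, this]
  | dia Φ ih => simp only [ext, ih h H]
  | pvar Z => exact H Z rfl
  | mu Y Φ ih =>
    have : ∀ E, Φ.ext T v (Function.update V Y E) = Φ.ext T w (Function.update W Y E) :=
      fun E => ih h fun Z hZ => by
        by_cases hZY : Z = Y
        · subst hZY; simp
        · simpa [hZY] using H Z ⟨hZ, hZY⟩
    simp only [ext, this]

/-- The truth of a sentence can be tested with any valuations. -/
theorem MuLA.IsSentence.satisfies_iff [Nonempty C] {T : TransitionSystem C} {Φ : MuLA C}
    (h : Φ.IsSentence) (v : ℕ → C) (V : ℕ → Set T.State) : T.Satisfies Φ ↔ T.init ∈ Φ.ext T v V :=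
  ⟨fun H => H v V, fun H w W => by
    rwa [MuLA.ext_congr (w := v) (W := V)]
    · simp [h.1]
    · simp [h.2.1]⟩

end

/-! ### Model checking of finite transition systems -/

section
variable {C : Type*}

/-- The numbers of the states. -/
def FinTS.stateSet (F : FinTS C) : Set ℕ := Prod.snd '' {p | p ∈ (F.initLabel :: F.labels).zipIdx}

/-- The database of the state with a given number. -/
def FinTS.dbAt (F : FinTS C) (i : ℕ) : Instance C :=
  bUnion (sepSet {p | p ∈ (F.initLabel :: F.labels).zipIdx} fun p => p.2 = i)
    fun p => {f | f ∈ p.1}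

/-- The numbers of the states that satisfy a formula. -/
def MuLA.extFin (F : FinTS C) : (ℕ → C) × (ℕ → Set ℕ) → MuLA C → Set ℕ
  | d, query q => sepSet F.stateSet fun i => q.Holds (F.dbAt i) d.1
  | d, neg Φ => F.stateSet \ extFin F d Φ
  | d, and Φ Ψ => sepSet (extFin F d Φ) fun i => i ∈ extFin F d Ψ
  | d, exLive x Φ => sepSet F.stateSet fun i =>
      ExIn (adom (F.dbAt i)) fun c => i ∈ extFin F (Function.update d.1 x c, d.2) Φ
  | d, dia Φ => sepSet F.stateSet fun i =>
      ExIn {e | e ∈ F.edges} fun e => e.1 = i ∧ e.2 ∈ F.stateSet ∧ e.2 ∈ extFin F d Φ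
  | d, pvar Z => sepSet (d.2 Z) fun i => i ∈ F.stateSet
  | d, mu Z Φ => sepSet F.stateSet fun i => AllIn (𝒫 F.stateSet) fun E =>
      ¬ extFin F (d.1, Function.update d.2 Z E) Φ ⊆ E ∨ i ∈ E

theorem FinTS.mem_stateSet {F : FinTS C} {i : ℕ} :
    i ∈ F.stateSet ↔ i < (F.initLabel :: F.labels).length := by
  simp only [FinTS.stateSet, Set.mem_image, Set.mem_ofPred_eq, Prod.exists, exists_eq_right]
  simp only [List.mem_zipIdx_iff_getElem?]
  constructor
  · rintro ⟨a, h⟩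
    exact (List.getElem?_eq_some_iff.1 h).1
  · intro h
    exact ⟨_, List.getElem?_eq_getElem h⟩

theorem FinTS.dbAt_eq (F : FinTS C) (s : F.toTS.State) : F.dbAt s.1 = F.toTS.db s := by
  ext f
  have : (F.initLabel :: F.labels)[s.1]? = some ((F.initLabel :: F.labels).get s) :=
    List.getElem?_eq_getElem s.2
  simp only [FinTS.dbAt, bUnion, sepSet, Set.mem_ofPred_eq, Prod.exists,
    List.mem_zipIdx_iff_getElem?, FinTS.toTS]
  constructor
  · rintro ⟨l, i, ⟨h1, rfl⟩, h3⟩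
    rw [this] at h1
    simp only [Option.some.injEq] at h1
    exact h1 ▸ h3
  · intro h
    exact ⟨_, _, ⟨this, rfl⟩, h⟩

theorem MuLA.extFin_subset (F : FinTS C) (d : (ℕ → C) × (ℕ → Set ℕ)) (Φ : MuLA C) :
    Φ.extFin F d ⊆ F.stateSet := by
  induction Φ with
  | and Φ Ψ ih1 _ => exact fun i hi => ih1 hi.1
  | pvar Z => exact fun i hi => hi.2
  | _ => exact fun i hi => hi.1

/-- A least fixpoint is an intersection over sets of states, and sets of states correspond to
subsets of `F.stateSet`. So `extFin`, which tests the members of a finite power set, computes the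
extension. -/
theorem MuLA.ext_toTS (F : FinTS C) (Φ : MuLA C) (v : ℕ → C) (V : ℕ → Set F.toTS.State)
    (V' : ℕ → Set ℕ) (hV : ∀ Z s, s ∈ V Z ↔ s.1 ∈ V' Z) (s : F.toTS.State) :
    s ∈ Φ.ext F.toTS v V ↔ s.1 ∈ Φ.extFin F (v, V') := by
  have hs : ∀ s : F.toTS.State, s.1 ∈ F.stateSet := fun s => FinTS.mem_stateSet.2 s.2
  induction Φ generalizing v V V' s with
  | query q => simp [ext, extFin, sepSet, FinTS.dbAt_eq, hs]
  | neg Φ ih => simp [ext, extFin, hs, ih v V V' hV]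
  | and Φ Ψ ih1 ih2 => simp [ext, extFin, sepSet, ih1 v V V' hV, ih2 v V V' hV]
  | exLive x Φ ih =>
    simp [ext, extFin, sepSet, FinTS.dbAt_eq, hs, ExIn, fun c => ih (Function.update v x c) V V' hV]
  | dia Φ ih =>
    simp only [ext, extFin, sepSet, hs, ExIn, ih v V V' hV, Set.mem_ofPred_eq, true_and]
    constructor
    · rintro ⟨s', h1, h2⟩
      exact ⟨(s.1, s'.1), h1, rfl, hs s', h2⟩
    · rintro ⟨⟨i, j⟩, h1, rfl, hj, h2⟩
      exact ⟨⟨j, FinTS.mem_stateSet.1 hj⟩, h1, h2⟩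
  | pvar Z => simpa [ext, extFin, sepSet, hs] using hV Z s
  | mu Z Φ ih =>
    simp only [ext, extFin, sepSet, hs, AllIn, Set.mem_sInter, Set.mem_ofPred_eq, true_and]
    have key : ∀ (E : Set F.toTS.State) (E' : Set ℕ), (∀ s, s ∈ E ↔ s.1 ∈ E') →
        ∀ s, s ∈ ext F.toTS v (Function.update V Z E) Φ ↔
          s.1 ∈ extFin F (v, Function.update V' Z E') Φ := fun E E' hE s =>
      ih v _ _ (fun Y s => by
        by_cases hY : Y = Z
        · subst hY; simpa using hE s
        · simpa [hY] using hV Y s) s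
    constructor
    · intro h E' hE'
      -- A set of numbers is pulled back to a set of states; in the converse direction a set of
      -- states is replaced by its image in the numbers.
      refine or_iff_not_imp_left.2 fun hsub => h {s | s.1 ∈ E'} fun t ht => ?_
      exact not_not.1 hsub ((key _ E' (fun _ => Iff.rfl) t).1 ht)
    · intro h E hE
      have hmem : ∀ t : F.toTS.State, t ∈ E ↔ t.1 ∈ Fin.val '' E := fun t =>
        ⟨fun h => ⟨t, h, rfl⟩, fun ⟨u, hu, he⟩ => Fin.ext he ▸ hu⟩
      rcases h (Fin.val '' E) (by rintro _ ⟨t, _, rfl⟩; exact hs t) with h | h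
      · refine absurd (fun i hi => ?_) h
        have hi' := extFin_subset F _ Φ hi
        exact ⟨⟨i, FinTS.mem_stateSet.1 hi'⟩, hE ((key E _ hmem _).2 hi), rfl⟩
      · exact (hmem s).2 h

end

/-! ### Computability of model checking -/

section
variable {C : Type*} [Denumerable C] [Represented C] [GodelNamed C]
variable {γ : Type*} [Represented γ]

@[fun_prop]
theorem tracked_stateSet {F : γ → FinTS C} (hF : Tracked F) : Tracked fun x => (F x).stateSet := by
  unfold FinTS.stateSet; fun_prop

@[fun_prop]
theorem tracked_dbAt {F : γ → FinTS C} {i : γ → ℕ} (hF : Tracked F) (hi : Tracked i) :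
    Tracked fun x => (F x).dbAt (i x) := by
  unfold FinTS.dbAt; fun_prop

theorem tracked_extFin :
    Tracked fun p : (FinTS C × ((ℕ → C) × (ℕ → Set ℕ))) × MuLA C => p.2.extFin p.1.1 p.1.2 := by
  refine .of_muLARec (F := fun F d Φ => Φ.extFin F d) (Hneg := fun F d r => F.stateSet \ r d)
    (Hdia := fun F d r => sepSet F.stateSet fun i =>
      ExIn {e | e ∈ F.edges} fun e => e.1 = i ∧ e.2 ∈ F.stateSet ∧ e.2 ∈ r d)
    (Hand := fun _ d r s => sepSet (r d) fun i => i ∈ s d)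
    (Hex := fun F d x r => sepSet F.stateSet fun i =>
      ExIn (adom (F.dbAt i)) fun c => i ∈ r (Function.update d.1 x c, d.2))
    (Hmu := fun F d Z r => sepSet F.stateSet fun i => AllIn (𝒫 F.stateSet) fun E =>
      ¬ r (d.1, Function.update d.2 Z E) ⊆ E ∨ i ∈ E)
    ?_ ?_ ?_ ?_ ?_ ?_ ?_ ?_ ?_ ?_ ?_ ?_
  · simp only [MuLA.extFin]; fun_prop
  · exact .diff (by fun_prop) (.app (.snd (.snd .id)) (.fst (.snd .id)))
  · intros; rfl
  · exact tracked_sepSet (.app (by fun_prop) (by fun_prop))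
      (.mem (by fun_prop) (.app (by fun_prop) (by fun_prop)))
  · intros; rfl
  · refine tracked_sepSet (by fun_prop) (.exIn (by fun_prop) (.mem (by fun_prop) ?_))
    exact .app (by fun_prop) (by fun_prop)
  · intros; rfl
  · refine tracked_sepSet (by fun_prop) (.exIn (by fun_prop) (.and (by fun_prop)
      (.and (by fun_prop) (.mem (by fun_prop) ?_))))
    exact .app (by fun_prop) (by fun_prop)
  · intros; rfl
  · simp only [MuLA.extFin]
    exact tracked_sepSet (.app (by fun_prop) (by fun_prop)) (by fun_prop)
  · refine tracked_sepSet (by fun_prop) (.allIn (by fun_prop) (.or (.not (.subset ?_ (by fun_prop)))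
      (by fun_prop)))
    exact .app (by fun_prop) (by fun_prop)
  · intros; rfl

/-- Model checking of finite transition systems is tracked. -/
theorem tracked_satisfies : ∃ p : FinTS C × MuLA C → Prop, Tracked p ∧
    ∀ F Φ, Φ.IsSentence → (p (F, Φ) ↔ F.toTS.Satisfies Φ) := by
  -- The number of the initial state is `0`. For a sentence the valuations do not matter, so
  -- computable ones are chosen.
  refine ⟨fun p => 0 ∈ p.2.extFin p.1 (defaultFun ℕ C, fun _ => ∅), ?_, fun F Φ h => ?_⟩
  · have : Tracked fun _ : FinTS C × MuLA C => (fun _ => ∅ : ℕ → Set ℕ) := .curry (by fun_prop)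
    exact .mem (by fun_prop) (tracked_extFin.comp
      (f := fun p : FinTS C × MuLA C => ((p.1, (defaultFun ℕ C, fun _ => ∅)), p.2))
      (.prodMk (.prodMk (by fun_prop) (.prodMk (by fun_prop) this)) (by fun_prop)))
  · have : Nonempty C := ⟨ofNat C 0⟩
    rw [h.satisfies_iff (defaultFun ℕ C) fun _ => ∅, MuLA.ext_toTS F Φ _ _ (fun _ => ∅) (by simp)]
    rfl

end
end DataCentric

namespace DataCentric
set_option linter.unusedSectionVars false

/-! ### Grounding -/

section
variable {C : Type*}

/-- The second alternative of the hypothesis is there for the induction: below a quantifier the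
bound variable is left in place, and both valuations are updated in the same way. -/
theorem Query.holds_subst {I : Instance C} {q : Query C} {σ : ℕ → Term C} {v w : ℕ → C}
    (h : ∀ x ∈ q.fv, σ x = .const (v x) ∨ σ x = .var x ∧ v x = w x) :
    (q.subst σ).Holds I w ↔ q.Holds I v := by
  have hT : ∀ (t : Term C) (w v : ℕ → C) (σ : ℕ → Term C),
      (∀ x ∈ t.vars, σ x = .const (v x) ∨ σ x = .var x ∧ v x = w x) →
      (t.subst σ).eval w = t.eval v := by
    intro t w v σ h
    cases t with
    | var x =>
      rcases h x rfl with h | ⟨h, h'⟩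
      · simp [Term.subst, h, Term.eval]
      · simp [Term.subst, h, Term.eval, h']
    | const c => rfl
  induction q generalizing σ v w with
  | tru => rfl
  | rel a =>
    have : (a.args.map (Term.subst σ)).map (Term.eval w) = a.args.map (Term.eval v) := by
      rw [List.map_map]
      exact List.map_congr_left fun t ht => hT t _ _ _ fun x hx => h x ⟨t, ht, hx⟩
    simp only [Query.Holds, Query.subst, this]
  | eq t u =>
    simp only [Query.Holds, Query.subst]
    rw [hT t w v σ fun x hx => h x (.inl hx), hT u w v σ fun x hx => h x (.inr hx)]
  | neg q ih => exact not_congr (ih h)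
  | and q r ih1 ih2 =>
    exact and_congr (ih1 fun x hx => h x (.inl hx)) (ih2 fun x hx => h x (.inr hx))
  | or q r ih1 ih2 =>
    exact or_congr (ih1 fun x hx => h x (.inl hx)) (ih2 fun x hx => h x (.inr hx))
  | ex y q ih =>
    refine exists_congr fun c => and_congr_right fun _ => ih fun x hx => ?_
    by_cases hxy : x = y
    · subst hxy; simp
    · simpa [hxy] using h x ⟨hx, hxy⟩

theorem PropMu.mem_ext_disj {A : Type*} {K : Kripke A} {V : ℕ → Set K.State} {s : K.State}
    {l : List (PropMu A)} : s ∈ (PropMu.disj l).ext K V ↔ ∃ φ ∈ l, s ∈ φ.ext K V := by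
  induction l with
  | nil => simp [PropMu.disj, PropMu.ext]
  | cons φ l ih =>
    have : PropMu.disj (φ :: l) = .or φ (.disj l) := rfl
    rw [this]
    simp only [PropMu.or, PropMu.ext, List.exists_mem_cons_iff, ← ih, Set.mem_compl_iff,
      Set.mem_inter_iff]
    tauto

theorem PropMu.fpv_disj {A : Type*} {l : List (PropMu A)} {Z : ℕ} :
    Z ∈ (PropMu.disj l).fpv ↔ ∃ φ ∈ l, Z ∈ φ.fpv := by
  induction l with
  | nil => simp [PropMu.disj, PropMu.fpv]
  | cons φ l ih =>
    have : PropMu.disj (φ :: l) = .or φ (.disj l) := rfl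
    rw [this]
    simp only [PropMu.or, PropMu.fpv, List.exists_mem_cons_iff, ← ih, Set.mem_union]

/-- A disjunction is written with two negations around each disjunct, so parities do not change. -/
theorem PropMu.parity_disj {A : Type*} {l : List (PropMu A)} {Z : ℕ} {p : Bool} :
    (PropMu.disj l).Parity Z p ↔ ∀ φ ∈ l, φ.Parity Z p := by
  induction l with
  | nil => simp [PropMu.disj, PropMu.Parity]
  | cons φ l ih =>
    have : PropMu.disj (φ :: l) = .or φ (.disj l) := rfl
    rw [this]
    simp only [PropMu.or, PropMu.Parity, List.forall_mem_cons, ← ih, Bool.not_not]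

theorem PropMu.synMono_disj {A : Type*} {l : List (PropMu A)} :
    (PropMu.disj l).SynMono ↔ ∀ φ ∈ l, φ.SynMono := by
  induction l with
  | nil => simp [PropMu.disj, PropMu.SynMono]
  | cons φ l ih =>
    have : PropMu.disj (φ :: l) = .or φ (.disj l) := rfl
    rw [this]
    simp only [PropMu.or, PropMu.SynMono, List.forall_mem_cons, ← ih]

namespace MuLA

theorem fpv_groundAux {D : List C} {σ : ℕ → Term C} (Φ : MuLA C) :
    (Φ.groundAux D σ).fpv ⊆ Φ.fpv := by
  induction Φ generalizing σ with
  | query q => exact fun _ h => h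
  | neg Φ ih => exact ih
  | and Φ Ψ ih1 ih2 => exact Set.union_subset_union ih1 ih2
  | exLive x Φ ih =>
    intro Z hZ
    obtain ⟨φ, hφ, h⟩ := PropMu.fpv_disj.1 hZ
    obtain ⟨t, _, rfl⟩ := List.mem_map.1 hφ
    exact ih (h.resolve_left fun h => h)
  | dia Φ ih => exact ih
  | pvar Z => exact fun _ h => h
  | mu Z Φ ih => exact Set.sdiff_subset_sdiff_left ih

theorem parity_groundAux {D : List C} {σ : ℕ → Term C} {Z : ℕ} {p : Bool} {Φ : MuLA C}
    (h : Φ.Parity Z p) : (Φ.groundAux D σ).Parity Z p := by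
  induction Φ generalizing σ p with
  | query q => trivial
  | neg Φ ih => exact ih h
  | and Φ Ψ ih1 ih2 => exact ⟨ih1 h.1, ih2 h.2⟩
  | exLive x Φ ih =>
    refine PropMu.parity_disj.2 fun φ hφ => ?_
    obtain ⟨t, _, rfl⟩ := List.mem_map.1 hφ
    exact ⟨trivial, ih h⟩
  | dia Φ ih => exact ih h
  | pvar Y => exact h
  | mu Y Φ ih => exact h.imp_right fun h => ih h

theorem synMono_groundAux {D : List C} {σ : ℕ → Term C} {Φ : MuLA C} (h : Φ.SynMono) :
    (Φ.groundAux D σ).SynMono := by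
  induction Φ generalizing σ with
  | query q => trivial
  | neg Φ ih => exact ih h
  | and Φ Ψ ih1 ih2 => exact ⟨ih1 h.1, ih2 h.2⟩
  | exLive x Φ ih =>
    refine PropMu.synMono_disj.2 fun φ hφ => ?_
    obtain ⟨t, _, rfl⟩ := List.mem_map.1 hφ
    exact ⟨trivial, ih h⟩
  | dia Φ ih => exact ih h
  | pvar Y => trivial
  | mu Y Φ ih => exact ⟨parity_groundAux h.1, ih h.2⟩

theorem IsSentence.ground {Φ : MuLA C} (h : Φ.IsSentence) (D : List C) :
    (Φ.ground D).IsSentence :=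
  ⟨Set.subset_empty_iff.1 (h.2.1 ▸ fpv_groundAux Φ), synMono_groundAux h.2.2⟩

/-- Grounding over a list of all values preserves the meaning of formulas. -/
theorem ext_groundAux {T : TransitionSystem C} {D : List C} (hD : ∀ s, ∀ c ∈ adom (T.db s), c ∈ D)
    {σ : ℕ → Term C} {v : ℕ → C} {V : ℕ → Set T.State} {Φ : MuLA C}
    (h : ∀ x ∈ Φ.fv, σ x = .const (v x)) :
    (Φ.groundAux D σ).ext T.toKripke V = Φ.ext T v V := by
  induction Φ generalizing σ v V with
  | query q =>
    ext s
    -- All free variables of `q` are replaced by constants, so the quantification over valuations in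
    -- the truth of an atom is vacuous.
    have key : ∀ w, (q.subst σ).Holds (T.db s) w ↔ q.Holds (T.db s) v := fun w =>
      Query.holds_subst fun x hx => .inl (h x hx)
    exact ⟨fun H => (key v).1 (H v), fun H w => (key w).2 H⟩
  | neg Φ ih => exact congrArg compl (ih h)
  | and Φ Ψ ih1 ih2 =>
    exact congrArg₂ _ (ih1 fun x hx => h x (.inl hx)) (ih2 fun x hx => h x (.inr hx))
  | exLive x Φ ih =>
    have key : ∀ c, (Φ.groundAux D (Function.update σ x (.const c))).ext T.toKripke V =
        Φ.ext T (Function.update v x c) V := fun c => ih fun y hy => by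
      by_cases hyx : y = x
      · subst hyx; simp
      · simpa [hyx] using h y ⟨hy, hyx⟩
    ext s
    refine (PropMu.mem_ext_disj (K := T.toKripke)).trans ⟨?_, ?_⟩
    · rintro ⟨φ, hφ, hs⟩
      obtain ⟨c, _, rfl⟩ := List.mem_map.1 hφ
      exact ⟨c, hs.1, key c ▸ hs.2⟩
    · rintro ⟨c, h1, h2⟩
      refine ⟨_, List.mem_map.2 ⟨c, hD s c h1, rfl⟩, h1, ?_⟩
      exact (Set.ext_iff.1 (key c) s).2 h2
  | dia Φ ih =>
    ext s
    simp only [groundAux, PropMu.ext, ext, ih h]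
    rfl
  | pvar Z => rfl
  | mu Z Φ ih =>
    simp only [groundAux, PropMu.ext, ext]
    congr 1
    ext E
    exact Iff.of_eq (congrArg (fun A : Set T.State => A ⊆ E) (ih (V := Function.update V Z E) h))

theorem satisfies_ground_iff {F : FinTS C} {Φ : MuLA C} (h : Φ.IsSentence) [Nonempty C] :
    F.toTS.Satisfies Φ ↔ F.toTS.toKripke.Satisfies (Φ.ground F.adomList) := by
  have hD : ∀ s, ∀ c ∈ adom (F.toTS.db s), c ∈ F.adomList := by
    rintro s c ⟨f, hf, hc⟩
    refine List.mem_flatMap.2 ⟨f, List.mem_flatten.2 ⟨_, List.get_mem _ _, hf⟩, hc⟩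
  have key : ∀ v V, (Φ.ground F.adomList).ext F.toTS.toKripke V = Φ.ext F.toTS v V := fun v V =>
    ext_groundAux hD (by simp [h.1])
  constructor
  · intro H V
    rw [key (fun _ => Classical.arbitrary C) V]
    exact H _ V
  · intro H v V
    rw [← key v V]
    exact H V

end MuLA
end
end DataCentric

namespace DataCentric
set_option linter.unusedSectionVars false

/-! ### Renaming of constants -/

section
variable {C : Type*}

/-- Renaming of the constants in a fact. -/
def RelAtom.rename {D : Type*} (π : C → D) (f : RelAtom C) : RelAtom D := ⟨f.rel, f.args.map π⟩

/-- Renaming of the constants in an instance. -/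
def Instance.rename (π : Equiv.Perm C) (I : Instance C) : Instance C := RelAtom.rename π '' I

theorem RelAtom.rename_injective (π : Equiv.Perm C) :
    Function.Injective (RelAtom.rename π : Fact C → Fact C) := by
  rintro ⟨r, l⟩ ⟨r', l'⟩ h
  simp only [RelAtom.rename, RelAtom.mk.injEq] at h
  rw [h.1, List.map_injective_iff.2 π.injective h.2]

theorem Instance.mk_map_mem_rename {π : Equiv.Perm C} {I : Instance C} {r : ℕ} {l : List C} :
    (⟨r, l.map π⟩ : Fact C) ∈ I.rename π ↔ (⟨r, l⟩ : Fact C) ∈ I :=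
  (RelAtom.rename_injective π).mem_set_image (a := ⟨r, l⟩)

theorem adom_rename (π : Equiv.Perm C) (I : Instance C) : adom (I.rename π) = π '' adom I := by
  ext c
  constructor
  · rintro ⟨_, ⟨f, hf, rfl⟩, hc⟩
    obtain ⟨d, hd, rfl⟩ := List.mem_map.1 hc
    exact ⟨d, ⟨f, hf, hd⟩, rfl⟩
  · rintro ⟨d, ⟨f, hf, hd⟩, rfl⟩
    exact ⟨_, ⟨f, hf, rfl⟩, List.mem_map.2 ⟨d, hd, rfl⟩⟩

theorem Term.eval_rename {π : Equiv.Perm C} {t : Term C} {v : ℕ → C}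
    (h : ∀ c ∈ t.consts, π c = c) : t.eval (π ∘ v) = π (t.eval v) := by
  cases t with
  | var x => rfl
  | const c => exact (h c rfl).symm

theorem Term.map_eval_rename {π : Equiv.Perm C} {l : List (Term C)} {v : ℕ → C}
    (h : ∀ t ∈ l, ∀ c ∈ t.consts, π c = c) :
    l.map (Term.eval (π ∘ v)) = (l.map (Term.eval v)).map π := by
  rw [List.map_map]
  exact List.map_congr_left fun t ht => Term.eval_rename (h t ht)

theorem Query.holds_rename {π : Equiv.Perm C} {I : Instance C} {q : Query C} {v : ℕ → C}
    (h : ∀ c ∈ q.consts, π c = c) : q.Holds (I.rename π) (π ∘ v) ↔ q.Holds I v := by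
  induction q generalizing v with
  | tru => rfl
  | rel a =>
    simp only [Query.Holds]
    rw [Term.map_eval_rename fun t ht c hc => h c ⟨t, ht, hc⟩, Instance.mk_map_mem_rename]
  | eq t u =>
    simp only [Query.Holds]
    rw [Term.eval_rename fun c hc => h c (.inl hc), Term.eval_rename fun c hc => h c (.inr hc),
      π.apply_eq_iff_eq]
  | neg q ih => exact not_congr (ih h)
  | and q r ih1 ih2 => exact and_congr (ih1 fun c hc => h c (.inl hc)) (ih2 fun c hc => h c (.inr hc))
  | or q r ih1 ih2 => exact or_congr (ih1 fun c hc => h c (.inl hc)) (ih2 fun c hc => h c (.inr hc))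
  | ex x q ih =>
    have key : ∀ c, q.Holds (I.rename π) (Function.update (π ∘ v) x (π c)) ↔
        q.Holds I (Function.update v x c) := fun c => by
      rw [← Function.comp_update]
      exact ih h
    simp only [Query.Holds, adom_rename, Set.exists_mem_image, key]

/-! ### Invariance under history preserving bisimulations -/

/-- A family of relations between the states of two transition systems that match the databases
up to a renaming and are preserved by transitions, where the renaming of the values in the history
of a state is kept. -/
structure IsHistoryBisim (T₁ T₂ : TransitionSystem C) (K : Set C) (hist : T₁.State → Set C)
    (Q : Equiv.Perm C → T₁.State → T₂.State → Prop) : Prop where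
  fixed : ∀ {π s t}, Q π s t → ∀ c ∈ K, π c = c
  db : ∀ {π s t}, Q π s t → T₂.db t = (T₁.db s).rename π
  live : ∀ {π s t}, Q π s t → adom (T₁.db s) ⊆ hist s
  forth : ∀ {π s t s'}, Q π s t → T₁.Step s s' → ∃ π' t', T₂.Step t t' ∧ Q π' s' t' ∧
    (∀ c ∈ hist s, π' c = π c) ∧ hist s ⊆ hist s'
  back : ∀ {π s t t'}, Q π s t → T₂.Step t t' → ∃ π' s', T₁.Step s s' ∧ Q π' s' t' ∧
    (∀ c ∈ hist s, π' c = π c) ∧ hist s ⊆ hist s'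

/-- This is what makes the quantifier case work. Renamings are kept on the history and histories
grow, so the related states that remember `c` and rename it to `d` again form a bisimulation. A
valuation with value `c` on one side and `d` on the other therefore stays correct at all related
states reached later. -/
theorem IsHistoryBisim.restrict {T₁ T₂ : TransitionSystem C} {K : Set C} {hist : T₁.State → Set C}
    {Q : Equiv.Perm C → T₁.State → T₂.State → Prop} (h : IsHistoryBisim T₁ T₂ K hist Q) (c d : C) :
    IsHistoryBisim T₁ T₂ K hist fun π s t => Q π s t ∧ c ∈ hist s ∧ d = π c where
  fixed hq := h.fixed hq.1
  db hq := h.db hq.1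
  live hq := h.live hq.1
  forth := by
    rintro π s t s' ⟨hq, hc, rfl⟩ hs
    obtain ⟨π', t', h1, h2, h3, h4⟩ := h.forth hq hs
    exact ⟨π', t', h1, ⟨h2, h4 hc, (h3 c hc).symm⟩, h3, h4⟩
  back := by
    rintro π s t s' ⟨hq, hc, rfl⟩ hs
    obtain ⟨π', t', h1, h2, h3, h4⟩ := h.back hq hs
    exact ⟨π', t', h1, ⟨h2, h4 hc, (h3 c hc).symm⟩, h3, h4⟩

/-- A negation exchanges the two parities, so monotonicity and antitonicity are proved together. A
fixpoint that binds `Z` itself makes both valuations equal. -/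
theorem MuLA.ext_mono {T : TransitionSystem C} {Z : ℕ} {Φ : MuLA C} {p : Bool}
    (hp : Φ.Parity Z p) {v : ℕ → C} {V W : ℕ → Set T.State} (hVW : ∀ Y, Y ≠ Z → V Y = W Y)
    (hZ : V Z ⊆ W Z) : (p = true → Φ.ext T v V ⊆ Φ.ext T v W) ∧
      (p = false → Φ.ext T v W ⊆ Φ.ext T v V) := by
  induction Φ generalizing p v V W with
  | query q => exact ⟨fun _ => subset_rfl, fun _ => subset_rfl⟩
  | neg Φ ih =>
    have := ih hp (v := v) hVW hZ
    exact ⟨fun h => Set.compl_subset_compl.2 (this.2 (by simp [h])),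
      fun h => Set.compl_subset_compl.2 (this.1 (by simp [h]))⟩
  | and Φ Ψ ih1 ih2 =>
    have h1 := ih1 hp.1 (v := v) hVW hZ
    have h2 := ih2 hp.2 (v := v) hVW hZ
    exact ⟨fun h => Set.inter_subset_inter (h1.1 h) (h2.1 h),
      fun h => Set.inter_subset_inter (h1.2 h) (h2.2 h)⟩
  | exLive x Φ ih =>
    have := fun c => ih hp (v := Function.update v x c) hVW hZ
    exact ⟨fun h s ⟨c, hc, hs⟩ => ⟨c, hc, (this c).1 h hs⟩,
      fun h s ⟨c, hc, hs⟩ => ⟨c, hc, (this c).2 h hs⟩⟩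
  | dia Φ ih =>
    have := ih hp (v := v) hVW hZ
    exact ⟨fun h s ⟨t, ht, hs⟩ => ⟨t, ht, this.1 h hs⟩,
      fun h s ⟨t, ht, hs⟩ => ⟨t, ht, this.2 h hs⟩⟩
  | pvar Y =>
    by_cases hY : Y = Z
    · subst hY
      have : p = true := hp rfl
      exact ⟨fun _ => hZ, fun h => by simp [this] at h⟩
    · simp only [ext, hVW Y hY]
      exact ⟨fun _ => subset_rfl, fun _ => subset_rfl⟩
  | mu Y Φ ih =>
    by_cases hY : Y = Z
    · subst hY
      have : ∀ E, Function.update V Y E = Function.update W Y E := fun E => by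
        funext X
        by_cases hX : X = Y
        · subst hX; simp
        · simpa [hX] using hVW X hX
      simp only [ext, this]
      exact ⟨fun _ => subset_rfl, fun _ => subset_rfl⟩
    · have key := fun E => ih (hp.resolve_left hY) (v := v) (V := Function.update V Y E)
        (W := Function.update W Y E) (fun X hX => by
          by_cases hXY : X = Y
          · subst hXY; simp
          · simpa [hXY] using hVW X hX) (by simpa [Ne.symm hY] using hZ)
      exact ⟨fun h => Set.sInter_subset_sInter fun E hE => ((key E).1 h).trans hE,
        fun h => Set.sInter_subset_sInter fun E hE => ((key E).2 h).trans hE⟩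

/-- The operator whose least fixpoint is the extension of `mu Z Φ`. -/
def MuLA.operator (T : TransitionSystem C) (v : ℕ → C) (V : ℕ → Set T.State) (Z : ℕ) (Φ : MuLA C)
    (h : Φ.Parity Z true) : Set T.State →o Set T.State where
  toFun E := Φ.ext T v (Function.update V Z E)
  monotone' E E' hE := (ext_mono h (fun Y hY => by simp [hY]) (by simpa using hE)).1 rfl

/-- The least fixpoint of a monotone operator is defined as the infimum of the prefixpoints, which
is the semantics of `mu`. -/
theorem MuLA.ext_mu {T : TransitionSystem C} {v : ℕ → C} {V : ℕ → Set T.State} {Z : ℕ}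
    {Φ : MuLA C} (h : Φ.Parity Z true) : (mu Z Φ).ext T v V = (operator T v V Z Φ h).lfp := rfl

/-- Least fixpoints of two operators are related if the operators preserve the relation. -/
theorem lfp_rel_lfp {α β : Type*} [CompleteLattice α] [CompleteLattice β] (f : α →o α)
    (g : β →o β) (r : α → β → Prop) (hfg : ∀ a b, r a b → r (f a) (g b))
    (hs : ∀ s : Set (α × β), (∀ p ∈ s, r p.1 p.2) → r (sSup s).1 (sSup s).2) :
    r f.lfp g.lfp := by
  -- Both operators run in parallel on pairs. The least fixpoint of the product is the pair of the
  -- least fixpoints, and fixpoint induction needs the relation only to pass to images and to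
  -- suprema.
  let F : α × β →o α × β := ⟨fun p => (f p.1, g p.2), fun p q h => ⟨f.mono h.1, g.mono h.2⟩⟩
  have h1 : F.lfp ≤ (f.lfp, g.lfp) := F.lfp_le ⟨f.map_lfp.le, g.map_lfp.le⟩
  have h2 : (f.lfp, g.lfp) ≤ F.lfp :=
    ⟨f.lfp_le (congrArg Prod.fst F.map_lfp).le, g.lfp_le (congrArg Prod.snd F.map_lfp).le⟩
  have h3 : r F.lfp.1 F.lfp.2 :=
    F.lfp_induction (p := fun p => r p.1 p.2) (fun p hp _ => hfg _ _ hp) hs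
  rwa [le_antisymm h1 h2] at h3

/-- Formulas are invariant under history preserving bisimulations. -/
theorem IsHistoryBisim.mem_ext_iff {T₁ T₂ : TransitionSystem C} {K : Set C}
    {hist : T₁.State → Set C} {Q : Equiv.Perm C → T₁.State → T₂.State → Prop}
    (hQ : IsHistoryBisim T₁ T₂ K hist Q) {Φ : MuLA C} (hK : Φ.consts ⊆ K) (hΦ : Φ.SynMono)
    {v₁ v₂ : ℕ → C} {V₁ : ℕ → Set T₁.State} {V₂ : ℕ → Set T₂.State}
    (hv : ∀ π s t, Q π s t → ∀ x ∈ Φ.fv, v₁ x ∈ hist s ∧ v₂ x = π (v₁ x))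
    (hV : ∀ Z ∈ Φ.fpv, ∀ π s t, Q π s t → (s ∈ V₁ Z ↔ t ∈ V₂ Z))
    {π : Equiv.Perm C} {s : T₁.State} {t : T₂.State} (h : Q π s t) :
    s ∈ Φ.ext T₁ v₁ V₁ ↔ t ∈ Φ.ext T₂ v₂ V₂ := by
  induction Φ generalizing Q v₁ v₂ V₁ V₂ π s t with
  | query q =>
    show q.Holds _ _ ↔ q.Holds _ _
    rw [hQ.db h, Query.holds_congr (v := v₂) (w := π ∘ v₁) fun x hx => (hv π s t h x hx).2,
      Query.holds_rename fun c hc => hQ.fixed h c (hK hc)]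
  | neg Φ ih => exact not_congr (ih hQ hK hΦ hv hV h)
  | and Φ Ψ ih1 ih2 =>
    exact and_congr
      (ih1 hQ (fun c hc => hK (.inl hc)) hΦ.1 (fun π s t h x hx => hv π s t h x (.inl hx))
        (fun Z hZ => hV Z (.inl hZ)) h)
      (ih2 hQ (fun c hc => hK (.inr hc)) hΦ.2 (fun π s t h x hx => hv π s t h x (.inr hx))
        (fun Z hZ => hV Z (.inr hZ)) h)
  | exLive x Φ ih =>
    -- The bisimulation is restricted to the states that remember `c` and rename it to `π c`; the
    -- values assigned to `x` on both sides then match at all of them.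
    have key : ∀ c ∈ adom (T₁.db s), s ∈ Φ.ext T₁ (Function.update v₁ x c) V₁ ↔
        t ∈ Φ.ext T₂ (Function.update v₂ x (π c)) V₂ := fun c hc => by
      refine ih (hQ.restrict c (π c)) hK hΦ (fun π' s' t' h' y hy => ?_)
        (fun Z hZ π' s' t' h' => hV Z hZ π' s' t' h'.1) ⟨h, hQ.live h hc, rfl⟩
      by_cases hyx : y = x
      · subst hyx; simpa using h'.2
      · simpa [hyx] using hv π' s' t' h'.1 y ⟨hy, hyx⟩
    simp only [MuLA.ext, Set.mem_ofPred_eq, hQ.db h, adom_rename, Set.exists_mem_image]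
    exact exists_congr fun c => and_congr_right fun hc => key c hc
  | dia Φ ih =>
    constructor
    · rintro ⟨s', hs, h'⟩
      obtain ⟨π', t', h1, h2, _⟩ := hQ.forth h hs
      exact ⟨t', h1, (ih hQ hK hΦ hv hV h2).1 h'⟩
    · rintro ⟨t', ht, h'⟩
      obtain ⟨π', s', h1, h2, _⟩ := hQ.back h ht
      exact ⟨s', h1, (ih hQ hK hΦ hv hV h2).2 h'⟩
  | pvar Z => exact hV Z rfl π s t h
  | mu Z Φ ih =>
    rw [MuLA.ext_mu hΦ.1, MuLA.ext_mu hΦ.1]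
    -- The relation between sets of states is to have the same members up to `Q`. It passes to
    -- unions of families of related pairs.
    refine lfp_rel_lfp _ _ (fun E₁ E₂ => ∀ π s t, Q π s t → (s ∈ E₁ ↔ t ∈ E₂))
      (fun E₁ E₂ hE π s t h => ?_) (fun A hA π s t h => ?_) π s t h
    · refine ih hQ hK hΦ.2 hv (fun Y hY π s t h => ?_) h
      by_cases hYZ : Y = Z
      · subst hYZ; simpa using hE π s t h
      · simpa [hYZ] using hV Y ⟨hY, hYZ⟩ π s t h
    · simp only [Prod.fst_sSup, Prod.snd_sSup, Set.sSup_eq_sUnion, Set.mem_sUnion,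
        Set.exists_mem_image]
      exact exists_congr fun p => and_congr_right fun hp => hA p hp π s t h

theorem IsHistoryBisim.satisfies_iff [Nonempty C] {T₁ T₂ : TransitionSystem C} {K : Set C}
    {hist : T₁.State → Set C} {Q : Equiv.Perm C → T₁.State → T₂.State → Prop}
    (hQ : IsHistoryBisim T₁ T₂ K hist Q) {π : Equiv.Perm C} (h : Q π T₁.init T₂.init)
    {Φ : MuLA C} (hΦ : Φ.IsSentence) (hK : Φ.consts ⊆ K) : T₁.Satisfies Φ ↔ T₂.Satisfies Φ := by
  let v : ℕ → C := fun _ => Classical.arbitrary C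
  rw [hΦ.satisfies_iff v fun _ => ∅, hΦ.satisfies_iff v fun _ => ∅]
  exact hQ.mem_ext_iff hK hΦ.2.2 (by simp [hΦ.1]) (by simp [hΦ.2.1]) h

end
end DataCentric

namespace DataCentric
set_option linter.unusedSectionVars false
open Encodable Denumerable

/-! ### Exactness of the finite abstraction -/

section
variable {C : Type*}

/-- The graph of a service call map. -/
def CallMap.graph (M : CallMap C) : Set ((ℕ × List C) × C) := {p | M p.1 = some p.2}

def CState.toG (s : CState C) : GState C := (s.inst, CallMap.graph s.map)

theorem mem_valSet_graph {M : CallMap C} {t : GroundTerm C} {c : C} :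
    c ∈ t.valSet M.graph ↔ t.value M = some c := by
  cases t with
  | val d => simp [GroundTerm.valSet, GroundTerm.value, eq_comm]
  | call f args => simp [GroundTerm.valSet, GroundTerm.value, sepSet, CallMap.graph]

theorem mem_argVals_graph {M : CallMap C} {ts : List (GroundTerm C)} {l : List C} :
    l ∈ argVals M.graph ts ↔ List.Forall₂ (fun t c => t.value M = some c) ts l := by
  induction ts generalizing l with
  | nil => simp [argVals]
  | cons t ts ih =>
    simp only [argVals, bUnion, Set.mem_ofPred_eq, mem_valSet_graph, Set.mem_image, ih]
    constructor
    · rintro ⟨c, hc, l, hl, rfl⟩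
      exact .cons hc hl
    · rintro (_ | ⟨hc, hl⟩)
      exact ⟨_, hc, _, hl, rfl⟩

theorem applyGraph_graph (M : CallMap C) (E : Set (RelAtom (GroundTerm C))) :
    applyGraph M.graph E = M.apply E := by
  ext ⟨r, l⟩
  simp only [applyGraph, bUnion, CallMap.apply, Set.mem_ofPred_eq, Set.mem_image,
    mem_argVals_graph, RelAtom.mk.injEq]
  constructor
  · rintro ⟨g, hg, l', hl, rfl, rfl⟩
    exact ⟨g, hg, rfl, hl⟩
  · rintro ⟨g, hg, h, hl⟩
    exact ⟨g, hg, l, hl, h.symm, rfl⟩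

theorem mem_newCalls_graph {M : CallMap C} {E : Set (RelAtom (GroundTerm C))} {t : ℕ × List C} :
    t ∈ newCalls E M.graph ↔ (∃ g ∈ E, GroundTerm.call t.1 t.2 ∈ g.args) ∧ M t = none := by
  have h : ∀ u : GroundTerm C, t ∈ u.callSet ↔ u = .call t.1 t.2 := fun u => by
    cases u <;> simp [GroundTerm.callSet, Prod.ext_iff, eq_comm]
  simp only [newCalls, bUnion, Set.mem_sdiff, Set.mem_ofPred_eq, Set.mem_image, Prod.exists,
    exists_and_right, exists_eq_right, h, CallMap.graph, ← Option.eq_none_iff_forall_ne_some,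
    not_exists, exists_eq_right]

theorem Term.eval_mem {t : Term C} {θ : ℕ → C} {A : Set C} (hv : ∀ x ∈ t.vars, θ x ∈ A)
    (hc : t.consts ⊆ A) : t.eval θ ∈ A := by
  cases t with
  | var x => exact hv x rfl
  | const c => exact hc rfl

theorem EffTerm.ground_congr {t : EffTerm C} {θ η : ℕ → C} (h : ∀ x ∈ t.vars, θ x = η x) :
    t.ground θ = t.ground η := by
  cases t with
  | base t => exact congrArg _ (Term.eval_congr h)
  | call f args =>
    exact congrArg _ (List.map_congr_left fun t ht => Term.eval_congr fun x hx => h x ⟨t, ht, hx⟩)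

theorem Action.doo_congr {α : Action C} {σ τ : ℕ → C} {I : Instance C}
    (h : ∀ p ∈ α.params, σ p = τ p) : α.doo σ I = α.doo τ I := by
  have : ∀ θ : ℕ → C, (∀ p ∈ α.params, θ p = σ p) ↔ ∀ p ∈ α.params, θ p = τ p := fun θ =>
    forall₂_congr fun p hp => by rw [h p hp]
  simp only [Action.doo, this]

/-- A ground term uses declared services and arguments from `A` only. -/
def GroundTerm.Within (F : List ℕ) (A : Set C) : GroundTerm C → Prop
  | .val c => c ∈ A
  | .call f args => F[f]? = some args.length ∧ ∀ a ∈ args, a ∈ A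

variable [Denumerable C]

theorem funsOn_default_congr {α : Type*} (A : Set α) [∀ x, Decidable (x ∈ A)] (B : Set C) (f θ : α → C)
    (h : ∀ x ∈ A, θ x ∈ B) : (fun x => if x ∈ A then θ x else f x) ∈ funsOn A B f :=
  ⟨fun x hx => by simpa [hx] using h x hx, fun x hx => by simp [hx]⟩

-- The query and the equated terms depend only on the free variables of the query. Assignments that
-- are constant elsewhere are therefore enough, and there are finitely many of them over a finite
-- instance.
open Classical in
theorem EqConstraint.satFin_iff {ec : EqConstraint C} {I : Instance C}
    (h : ∀ e ∈ ec.eqs, e.1.vars ∪ e.2.vars ⊆ ec.query.fv) : ec.SatFin I ↔ ec.Sat I := by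
  constructor
  · intro H θ hθ e he
    let η : ℕ → C := fun x => if x ∈ ec.query.fv then θ x else defaultFun ℕ C x
    have hη : ∀ x ∈ ec.query.fv, η x = θ x := fun x hx => by simp [η, hx]
    have : e.1.eval η = e.2.eval η := H η ⟨funsOn_default_congr _ _ _ _ hθ.1, (Query.holds_congr hη).2 hθ.2⟩ e he
    rwa [Term.eval_congr fun x hx => hη x (h e he (.inl hx)),
      Term.eval_congr (w := θ) fun x hx => hη x (h e he (.inr hx))] at this
  · intro H θ hθ e he
    exact H θ ⟨hθ.1.1, hθ.2⟩ e he

-- Free variables other than parameters range over the active domain, and all other variables have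
-- their value under `σ`, so that the parameters are set correctly. No derived fact sees the
-- remaining variables, by the hypothesis on its terms.
open Classical in
theorem Action.dooFin_eq {α : Action C} {σ : ℕ → C} {I : Instance C}
    (h : ∀ e ∈ α.effects, ∀ E ∈ e.facts, ∀ t ∈ E.args,
      t.vars ⊆ e.qpos.fv ∪ {p | p ∈ α.params}) : α.dooFin σ I = α.doo σ I := by
  ext g
  constructor
  · rintro ⟨e, he, θ, ⟨⟨h1, h2⟩, h3⟩, E, hE, rfl⟩
    exact ⟨e, he, θ, fun p hp => h2 p fun h => h.2 hp, fun x hx hp => h1 x ⟨hx, hp⟩, h3, E, hE, rfl⟩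
  · rintro ⟨e, he, θ, h1, h2, h3, E, hE, rfl⟩
    let η : ℕ → C := fun x => if x ∈ (e.qpos.and e.qneg).fv \ {p | p ∈ α.params} then θ x else σ x
    have hη : ∀ x, x ∈ (e.qpos.and e.qneg).fv ∨ x ∈ α.params → η x = θ x := fun x hx => by
      by_cases hp : x ∈ α.params
      · simp [η, hp, h1 x hp]
      · simp [η, hp, hx.resolve_right hp]
    refine ⟨e, he, η, ⟨funsOn_default_congr _ _ σ θ fun x hx => h2 x hx.1 hx.2,
      (Query.holds_congr fun x hx => hη x (.inl hx)).2 h3⟩, E, hE, ?_⟩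
    have : E.args.map (EffTerm.ground η) = E.args.map (EffTerm.ground θ) :=
      List.map_congr_left fun t ht => EffTerm.ground_congr fun x hx =>
        hη x ((h e he E hE t ht hx).imp_left fun h => .inl h)
    simp only [this]

end

/-! ### Abstract successors are concrete transitions; invariants of reachable states -/

namespace DCDS
variable {C : Type*} [Denumerable C] {S : DCDS C}

theorem WellFormed.action_mem (hS : S.WellFormed) {r : Rule C} (hr : r ∈ S.rules) {α : Action C}
    (hα : S.actions[r.action]? = some α) : α ∈ S.actions ∧ r.cond.fv = {p | p ∈ α.params} := by
  obtain ⟨_, _, β, hβ, h⟩ := hS.rule r hr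
  obtain rfl : α = β := by rw [hα] at hβ; exact Option.some.inj hβ
  exact ⟨List.mem_of_getElem? hα, h⟩

open Classical in
theorem WellFormed.mem_moves (hS : S.WellFormed) {I : Instance C}
    {E : Set (RelAtom (GroundTerm C))} : E ∈ S.moves I ↔ ∃ r ∈ S.rules, ∃ α,
      S.actions[r.action]? = some α ∧ ∃ σ ∈ r.cond.ans I, E = α.doo σ I := by
  have hdoo : ∀ r ∈ S.rules, ∀ α, S.actions[r.action]? = some α → ∀ σ,
      α.dooFin σ I = α.doo σ I := fun r hr α hα σ =>
    Action.dooFin_eq fun e he E hE t ht =>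
      ((hS.effect_facts α (hS.action_mem hr hα).1 e he E hE).2 t ht).2.2
  have hact : ∀ (r : Rule C) α, α ∈ Prod.fst '' (sepSet {p | p ∈ S.actions.zipIdx}
      fun p => p.2 = r.action) ↔ S.actions[r.action]? = some α := fun r α => by
    simp only [sepSet, Set.mem_image, Set.mem_ofPred_eq, Prod.exists, List.mem_zipIdx_iff_getElem?]
    constructor
    · rintro ⟨_, _, ⟨h, rfl⟩, rfl⟩; exact h
    · intro h; exact ⟨_, _, ⟨h, rfl⟩, rfl⟩
  constructor
  · rintro ⟨r, hr, α, hα, σ, ⟨h1, h2⟩, rfl⟩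
    rw [hact] at hα
    exact ⟨r, hr, α, hα, σ, ⟨h1.1, h2⟩, hdoo r hr α hα σ⟩
  · rintro ⟨r, hr, α, hα, σ, hσ, rfl⟩
    let τ : ℕ → C := fun x => if x ∈ r.cond.fv then σ x else defaultFun ℕ C x
    have hτ : ∀ x ∈ r.cond.fv, τ x = σ x := fun x hx => by simp [τ, hx]
    refine ⟨r, hr, α, (hact r α).2 hα, τ, ⟨funsOn_default_congr _ _ _ _ hσ.1,
      (Query.holds_congr hτ).2 hσ.2⟩, ?_⟩
    refine (hdoo r hr α hα τ).trans (Action.doo_congr fun p hp => hτ p ?_)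
    rw [(hS.action_mem hr hα).2]
    exact hp

theorem WellFormed.exec_iff (hS : S.WellFormed) {s s' : CState C} : S.Exec s s' ↔
    ∃ E ∈ S.moves s.inst, s.map.Calls E s'.map ∧ s'.inst = s'.map.apply E ∧
      S.SatConstraints s'.inst := by
  simp only [hS.mem_moves]
  constructor
  · rintro ⟨r, hr, α, hα, σ, hσ, h⟩
    exact ⟨_, ⟨r, hr, α, hα, σ, hσ, rfl⟩, h⟩
  · rintro ⟨_, ⟨r, hr, α, hα, σ, hσ, rfl⟩, h⟩
    exact ⟨r, hr, α, hα, σ, hσ, h⟩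

-- The abstract successors are exactly the concrete ones whose results are old or in `D`: choosing
-- values on the new calls is the same as choosing an extension of the service call map.
open Classical in
theorem WellFormed.mem_succs (hS : S.WellFormed) {D : Set C} {s : CState C} {Y : GState C} :
    Y ∈ S.succs D s.toG ↔ ∃ s', S.Exec s s' ∧ s'.toG = Y ∧
      ∀ t c, s'.map t = some c → s.map t = some c ∨ c ∈ D := by
  have hsat : ∀ I : Instance C, (∀ ec ∈ S.constraints, ec.SatFin I) ↔ S.SatConstraints I :=
    fun I => forall₂_congr fun ec hec =>
      EqConstraint.satFin_iff fun e he => (hS.constraint_eqs ec hec e he).1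
  constructor
  · rintro ⟨E, hE, h, ⟨h1, h2⟩, h3, h4⟩
    rw [Set.mem_singleton_iff] at h3
    subst h3
    set N := newCalls E s.toG.2 with hN
    have hN' : ∀ t, t ∈ N ↔ _ := fun t => mem_newCalls_graph (M := s.map)
    let M' : CallMap C := fun t => if t ∈ N then some (h t) else s.map t
    have hG : extendGraph s.toG.2 N h = M'.graph := by
      ext ⟨t, c⟩
      show s.map t = some c ∨ (∃ u ∈ N, (u, h u) = (t, c)) ↔ M' t = some c
      by_cases ht : t ∈ N
      · have := ((hN' t).1 ht).2
        simp only [this, M', ht, if_true]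
        simp [ht, Prod.ext_iff]
      · simp only [M', ht, if_false]
        refine or_iff_left ?_
        rintro ⟨u, hu, he⟩
        obtain rfl : u = t := (Prod.ext_iff.1 he).1
        exact ht hu
    have hcalls : s.map.Calls E M' := by
      refine ⟨fun t c htc => ?_, fun t => ?_⟩
      · have : t ∉ N := fun ht => by simp [((hN' t).1 ht).2] at htc
        simpa [M', this] using htc
      · by_cases ht : t ∈ N
        · simpa [M', ht] using Or.inr ((hN' t).1 ht).1
        · simp only [M', ht, if_false]
          refine (or_iff_left_of_imp fun hg => ?_).symm
          by_contra hne
          exact ht ((hN' t).2 ⟨hg, by simpa using hne⟩)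
    refine ⟨⟨M'.apply E, M'⟩, hS.exec_iff.2 ⟨E, hE, hcalls, rfl, ?_⟩, ?_, ?_⟩
    · rw [hG, applyGraph_graph] at h4
      exact (hsat _).1 h4
    · rw [hG, applyGraph_graph]
      rfl
    · intro t c htc
      by_cases ht : t ∈ N
      · refine .inr ?_
        have : h t = c := by simpa [M', ht] using htc
        exact this ▸ h1 t ht
      · exact .inl (by simpa [M', ht] using htc)
  · rintro ⟨s', hs', rfl, hD⟩
    obtain ⟨E, hE, hcalls, hinst, hsat'⟩ := hS.exec_iff.1 hs'
    have hN' : ∀ t, t ∈ newCalls E s.toG.2 ↔ _ := fun t => mem_newCalls_graph (M := s.map)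
    have hval : ∀ t ∈ newCalls E s.toG.2, s'.map t = some ((s'.map t).getD (defaultFun ℕ C 0)) :=
      fun t ht => by
        obtain ⟨c, hc⟩ := Option.isSome_iff_exists.1 ((hcalls.2 t).2 (.inr ((hN' t).1 ht).1))
        simp [hc]
    -- The results are read off from the new map. Outside the new calls the values are those
    -- prescribed by `funsOn`; the default of `getD` is never reached on new calls, by `hval`.
    let h : ℕ × List C → C := fun t => if t ∈ newCalls E s.toG.2 then
      (s'.map t).getD (defaultFun ℕ C 0) else defaultFun _ C t
    have hG : extendGraph s.toG.2 (newCalls E s.toG.2) h = s'.map.graph := by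
      ext ⟨t, c⟩
      show s.map t = some c ∨ (∃ u ∈ newCalls E s.toG.2, (u, h u) = (t, c)) ↔ s'.map t = some c
      constructor
      · rintro (h1 | ⟨u, hu, he⟩)
        · exact hcalls.1 t c h1
        · simp only [Prod.mk.injEq] at he
          obtain ⟨rfl, rfl⟩ := he
          simpa [h, hu] using hval u hu
      · intro htc
        rcases (hcalls.2 t).1 (by simp [htc]) with h1 | h1
        · obtain ⟨d, hd⟩ := Option.isSome_iff_exists.1 h1
          exact .inl (by rw [hd, ← hcalls.1 t d hd, htc])
        · by_cases hn : s.map t = none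
          · have ht := (hN' t).2 ⟨h1, hn⟩
            exact .inr ⟨t, ht, by simp [h, ht, htc]⟩
          · obtain ⟨d, hd⟩ := Option.ne_none_iff_exists'.1 hn
            exact .inl (by rw [hd, ← hcalls.1 t d hd, htc])
    refine ⟨E, hE, h, funsOn_default_congr _ _ _ _ fun t ht => ?_, ?_, ?_⟩
    · refine (hD t _ (hval t ht)).resolve_left ?_
      simp [((hN' t).1 ht).2]
    · rw [hG, applyGraph_graph, ← hinst]
      rfl
    · exact (hsat _).2 hsat'

/-- A term of an effect is built from constants of the initial instance, from parameters, whose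
values answer the condition of the rule, and from variables of the positive query. All of their
values are initially or currently active. -/
theorem WellFormed.within_of_mem_moves (hS : S.WellFormed) {I : Instance C}
    {E : Set (RelAtom (GroundTerm C))} (hE : E ∈ S.moves I) {g : RelAtom (GroundTerm C)}
    (hg : g ∈ E) : S.schema[g.rel]? = some g.args.length ∧
      ∀ u ∈ g.args, u.Within S.services (adom S.initInst ∪ adom I) := by
  obtain ⟨r, hr, α, hα, σ, hσ, rfl⟩ := hS.mem_moves.1 hE
  obtain ⟨hα', hfv⟩ := hS.action_mem hr hα
  obtain ⟨e, he, θ, h1, h2, h3, F, hF, rfl⟩ := hg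
  obtain ⟨hc, ht⟩ := hS.effect_facts α hα' e he F hF
  refine ⟨by simpa [RelAtom.Conforms] using hc, fun u hu => ?_⟩
  obtain ⟨t, htF, rfl⟩ := List.mem_map.1 hu
  obtain ⟨h4, h5, h6⟩ := ht t htF
  have hθ : ∀ x ∈ t.vars, θ x ∈ adom S.initInst ∪ adom I := fun x hx => by
    refine .inr ?_
    by_cases hp : x ∈ α.params
    · rw [h1 x hp]
      exact hσ.1 x (by rw [hfv]; exact hp)
    · exact h2 x (.inl ((h6 hx).resolve_right hp)) hp
  cases t with
  | base t => exact Term.eval_mem hθ (h5.trans Set.subset_union_left)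
  | call f args =>
    refine ⟨by simpa [EffTerm.Conforms] using h4, fun a ha => ?_⟩
    obtain ⟨t, ht, rfl⟩ := List.mem_map.1 ha
    exact Term.eval_mem (fun x hx => hθ x ⟨t, ht, hx⟩)
      fun c hc => .inl (h5 ⟨t, ht, hc⟩)

/-- Properties of the reachable states. -/
structure Invariant (S : DCDS C) (s : CState C) : Prop where
  adom_subset : adom s.inst ⊆ S.vals s.map.graph
  conforms : ∀ f ∈ s.inst, f.Conforms S.schema
  calls : ∀ t c, s.map t = some c → S.services[t.1]? = some t.2.length ∧
    ∀ a ∈ t.2, a ∈ S.vals s.map.graph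

theorem WellFormed.invariant_init (hS : S.WellFormed) : S.Invariant S.initState where
  adom_subset _ h := .inl h
  conforms f hf := hS.init_conforms f hf
  calls t c h := by simp [initState] at h

theorem vals_mono {M M' : CallMap C} (h : ∀ t c, M t = some c → M' t = some c) :
    S.vals M.graph ⊆ S.vals M'.graph :=
  Set.union_subset_union_right _ (Set.image_mono fun _ => h _ _)

theorem mem_vals_of_eq_some {M : CallMap C} {t : ℕ × List C} {c : C} (h : M t = some c) :
    c ∈ S.vals M.graph := .inr ⟨(t, c), h, rfl⟩

/-- The service call map only grows, so everything it accounts for in the old state remains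
accounted for. -/
theorem WellFormed.invariant_step (hS : S.WellFormed) {s s' : CState C} (h : S.Invariant s)
    (hs : S.Exec s s') : S.Invariant s' ∧ ∀ t c, s.map t = some c → s'.map t = some c := by
  obtain ⟨E, hE, hcalls, hinst, _⟩ := hS.exec_iff.1 hs
  have hmono := vals_mono (S := S) hcalls.1
  have hsub : adom S.initInst ∪ adom s.inst ⊆ S.vals s'.map.graph :=
    Set.union_subset (fun _ h => .inl h) (h.adom_subset.trans hmono)
  refine ⟨⟨?_, ?_, ?_⟩, hcalls.1⟩
  · rintro c ⟨f, hf, hc⟩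
    rw [hinst] at hf
    obtain ⟨g, hg, _, h2⟩ := hf
    obtain ⟨i, hi, rfl⟩ := List.mem_iff_getElem.1 hc
    have hi' : i < g.args.length := by rw [h2.length_eq]; exact hi
    have hv := h2.get hi' hi
    simp only [List.get_eq_getElem] at hv
    have hw := (hS.within_of_mem_moves hE hg).2 _ (List.getElem_mem hi')
    -- A value of the new instance is either a constant of a ground fact, which was referred to
    -- before, or the result of a call, which the new map stores.
    cases hu : g.args[i] with
    | val d =>
      rw [hu] at hv hw
      obtain rfl : d = f.args[i] := Option.some.inj hv
      exact hsub hw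
    | call k args =>
      rw [hu] at hv
      exact mem_vals_of_eq_some hv
  · intro f hf
    rw [hinst] at hf
    obtain ⟨g, hg, h1, h2⟩ := hf
    have := (hS.within_of_mem_moves hE hg).1
    rwa [← h1, h2.length_eq] at this
  · intro t c htc
    rcases (hcalls.2 t).1 (by simp [htc]) with h1 | ⟨g, hg, h1⟩
    · obtain ⟨d, hd⟩ := Option.isSome_iff_exists.1 h1
      exact ⟨(h.calls t d hd).1, fun a ha => hmono ((h.calls t d hd).2 a ha)⟩
    · have hw := (hS.within_of_mem_moves hE hg).2 _ h1
      exact ⟨hw.1, fun a ha => hsub (hw.2 a ha)⟩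

theorem WellFormed.invariant (hS : S.WellFormed) {s : CState C} (h : S.Reachable s) :
    S.Invariant s := by
  induction h with
  | init => exact hS.invariant_init
  | step _ hs ih => exact (hS.invariant_step ih hs).1

end DCDS
end DataCentric

namespace DataCentric
set_option linter.unusedSectionVars false
open Encodable Denumerable

/-! ### Renaming of states -/

section
variable {C : Type*}

def GroundTerm.rename (π : Equiv.Perm C) : GroundTerm C → GroundTerm C
  | .val c => .val (π c)
  | .call f args => .call f (args.map π)

def renameFacts (π : Equiv.Perm C) (E : Set (RelAtom (GroundTerm C))) :
    Set (RelAtom (GroundTerm C)) :=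
  (fun g => RelAtom.mk g.rel (g.args.map (GroundTerm.rename π))) '' E

/-- The graph of the map is renamed, in arguments as well as results; this is why arguments are
looked up through the inverse. -/
def CallMap.rename (π : Equiv.Perm C) (M : CallMap C) : CallMap C :=
  fun t => (M (t.1, t.2.map π.symm)).map π

def CState.rename (π : Equiv.Perm C) (s : CState C) : CState C :=
  ⟨s.inst.rename π, CallMap.rename π s.map⟩

theorem exists_eq_map_perm (π : Equiv.Perm C) (l : List C) : ∃ k : List C, l = k.map π :=
  ⟨l.map π.symm, by simp⟩

theorem CallMap.rename_map (π : Equiv.Perm C) (M : CallMap C) (f : ℕ) (l : List C) :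
    M.rename π (f, l.map π) = (M (f, l)).map π := by
  simp [CallMap.rename]

theorem GroundTerm.value_rename (π : Equiv.Perm C) (M : CallMap C) (u : GroundTerm C) :
    (u.rename π).value (M.rename π) = (u.value M).map π := by
  cases u with
  | val c => rfl
  | call f l => exact CallMap.rename_map π M f l

theorem GroundTerm.rename_eq_call_iff (π : Equiv.Perm C) (u : GroundTerm C) (f : ℕ) (l : List C) :
    u.rename π = .call f (l.map π) ↔ u = .call f l := by
  cases u with
  | val c => simp [GroundTerm.rename]
  | call g k =>
    simp only [GroundTerm.rename, GroundTerm.call.injEq]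
    rw [(List.map_injective_iff.2 π.injective).eq_iff]

theorem EffTerm.ground_rename {π : Equiv.Perm C} {t : EffTerm C} {θ : ℕ → C}
    (h : ∀ c ∈ t.consts, π c = c) : t.ground (π ∘ θ) = (t.ground θ).rename π := by
  cases t with
  | base t => exact congrArg _ (Term.eval_rename h)
  | call f args => exact congrArg _ (Term.map_eval_rename fun t ht c hc => h c ⟨t, ht, hc⟩)

theorem Query.mem_ans_rename {π : Equiv.Perm C} {I : Instance C} {q : Query C} {θ : ℕ → C}
    (h : ∀ c ∈ q.consts, π c = c) : π ∘ θ ∈ q.ans (I.rename π) ↔ θ ∈ q.ans I := by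
  refine and_congr (forall₂_congr fun x _ => ?_) (Query.holds_rename h)
  rw [adom_rename]
  exact π.injective.mem_set_image

theorem exists_eq_perm_comp {α : Type*} (π : Equiv.Perm C) (θ : α → C) : ∃ η, θ = π ∘ η :=
  ⟨π.symm ∘ θ, by funext x; simp⟩

theorem EqConstraint.sat_rename {π : Equiv.Perm C} {I : Instance C} {ec : EqConstraint C}
    (hq : ∀ c ∈ ec.query.consts, π c = c)
    (he : ∀ e ∈ ec.eqs, ∀ c ∈ e.1.consts ∪ e.2.consts, π c = c) (h : ec.Sat I) :
    ec.Sat (I.rename π) := by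
  intro θ hθ e hee
  obtain ⟨η, rfl⟩ := exists_eq_perm_comp π θ
  rw [Term.eval_rename fun c hc => he e hee c (.inl hc),
    Term.eval_rename fun c hc => he e hee c (.inr hc),
    h η ((Query.mem_ans_rename hq).1 hθ) e hee]

/-- Genericity: queries and terms whose constants are fixed by `π` commute with the renaming. Every
assignment over the renamed instance has the form `π ∘ η`, so the derivations correspond one to one.
-/
theorem Action.doo_rename {π : Equiv.Perm C} {α : Action C} {σ : ℕ → C} {I : Instance C}
    (hq : ∀ e ∈ α.effects, ∀ c ∈ (e.qpos.and e.qneg).consts, π c = c)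
    (hE : ∀ e ∈ α.effects, ∀ E ∈ e.facts, ∀ t ∈ E.args, ∀ c ∈ t.consts, π c = c) :
    α.doo (π ∘ σ) (I.rename π) = renameFacts π (α.doo σ I) := by
  have key : ∀ e ∈ α.effects, ∀ E ∈ e.facts, ∀ θ : ℕ → C,
      E.args.map (EffTerm.ground (π ∘ θ)) =
        (E.args.map (EffTerm.ground θ)).map (GroundTerm.rename π) := fun e he E hEe θ => by
    rw [List.map_map]
    exact List.map_congr_left fun t ht => EffTerm.ground_rename (hE e he E hEe t ht)
  have hmem : ∀ (θ : ℕ → C) x, (π ∘ θ) x ∈ adom (I.rename π) ↔ θ x ∈ adom I := fun θ x => by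
    rw [adom_rename]
    exact π.injective.mem_set_image
  ext g
  constructor
  · rintro ⟨e, he, θ, h1, h2, h3, E, hEe, rfl⟩
    obtain ⟨η, rfl⟩ := exists_eq_perm_comp π θ
    refine ⟨_, ⟨e, he, η, fun p hp => π.injective (h1 p hp), fun x hx hp =>
      (hmem η x).1 (h2 x hx hp), (Query.holds_rename (hq e he)).1 h3, E, hEe, rfl⟩, ?_⟩
    simp only [key e he E hEe]
  · rintro ⟨_, ⟨e, he, η, h1, h2, h3, E, hEe, rfl⟩, rfl⟩
    refine ⟨e, he, π ∘ η, fun p hp => congrArg π (h1 p hp), fun x hx hp =>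
      (hmem η x).2 (h2 x hx hp), (Query.holds_rename (hq e he)).2 h3, E, hEe, ?_⟩
    simp only [key e he E hEe]

theorem CallMap.Calls.rename {π : Equiv.Perm C} {M M' : CallMap C}
    {E : Set (RelAtom (GroundTerm C))} (h : M.Calls E M') :
    (M.rename π).Calls (renameFacts π E) (M'.rename π) := by
  constructor
  · rintro ⟨f, l⟩ c hc
    obtain ⟨l, rfl⟩ := exists_eq_map_perm π l
    rw [CallMap.rename_map] at hc ⊢
    obtain ⟨d, hd, rfl⟩ := Option.map_eq_some_iff.1 hc
    rw [h.1 _ d hd]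
    rfl
  · rintro ⟨f, l⟩
    obtain ⟨l, rfl⟩ := exists_eq_map_perm π l
    rw [CallMap.rename_map, CallMap.rename_map, Option.isSome_map, Option.isSome_map, h.2]
    simp only [renameFacts, Set.exists_mem_image, List.mem_map, GroundTerm.rename_eq_call_iff,
      exists_eq_right]

theorem CallMap.apply_rename (π : Equiv.Perm C) (M : CallMap C)
    (E : Set (RelAtom (GroundTerm C))) :
    (M.rename π).apply (renameFacts π E) = (M.apply E).rename π := by
  ext ⟨r, l⟩
  obtain ⟨l, rfl⟩ := exists_eq_map_perm π l
  rw [Instance.mk_map_mem_rename]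
  simp only [CallMap.apply, renameFacts, Set.exists_mem_image, Set.mem_ofPred_eq,
    List.forall₂_map_left_iff, List.forall₂_map_right_iff, GroundTerm.value_rename]
  simp only [Option.map_eq_some_iff, π.apply_eq_iff_eq, exists_eq_right]

theorem CState.rename_trans (π ρ : Equiv.Perm C) (s : CState C) :
    s.rename (π.trans ρ) = (s.rename π).rename ρ := by
  simp only [CState.rename, Instance.rename, Set.image_image, CState.mk.injEq]
  constructor
  · refine Set.image_congr fun f _ => ?_
    simp [RelAtom.rename]
  · funext t
    simp [CallMap.rename, Function.comp_def]

/-- A renaming acts on a state only through the values that occur in its instance, its calls and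
their results. It is applied to permutations that fix all of these, and hence the state. -/
theorem CState.rename_congr {π ρ : Equiv.Perm C} {s : CState C} (A : Set C)
    (h1 : adom s.inst ⊆ A) (h2 : ∀ t c, s.map t = some c → c ∈ A ∧ ∀ a ∈ t.2, a ∈ A)
    (h : ∀ c ∈ A, π c = ρ c) : s.rename π = s.rename ρ := by
  have key : ∀ (π ρ : Equiv.Perm C), (∀ c ∈ A, π c = ρ c) → ∀ t c,
      CallMap.rename π s.map t = some c → CallMap.rename ρ s.map t = some c := by
    rintro π ρ h ⟨f, l⟩ c hc
    obtain ⟨l, rfl⟩ := exists_eq_map_perm π l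
    rw [CallMap.rename_map] at hc
    obtain ⟨d, hd, rfl⟩ := Option.map_eq_some_iff.1 hc
    have : l.map π = l.map ρ := List.map_congr_left fun a ha => h a ((h2 _ d hd).2 a ha)
    rw [this, CallMap.rename_map, hd, h d (h2 _ d hd).1]
    rfl
  simp only [CState.rename, CState.mk.injEq]
  constructor
  · refine Set.image_congr fun f hf => ?_
    have : f.args.map π = f.args.map ρ :=
      List.map_congr_left fun a ha => h a (h1 ⟨f, hf, ha⟩)
    simp [RelAtom.rename, this]
  · funext t
    exact Option.ext fun c => ⟨key π ρ h t c, key ρ π (fun c hc => (h c hc).symm) t c⟩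

theorem CState.rename_refl (s : CState C) : s.rename (Equiv.refl C) = s := by
  have h1 : RelAtom.rename (Equiv.refl C) = id := by
    funext f; simp [RelAtom.rename]
  have h2 : CallMap.rename (Equiv.refl C) s.map = s.map := by
    funext t; simp [CallMap.rename]
  simp only [CState.rename, Instance.rename, h1, h2, Set.image_id]

theorem CState.rename_symm_rename (π : Equiv.Perm C) (s : CState C) :
    (s.rename π).rename π.symm = s := by
  rw [← CState.rename_trans, Equiv.self_trans_symm, CState.rename_refl]

theorem CState.rename_rename_symm (π : Equiv.Perm C) (s : CState C) :
    (s.rename π.symm).rename π = s := by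
  rw [← CState.rename_trans, Equiv.symm_trans_self, CState.rename_refl]

/-- Finitely many elements can be moved into a set that is large enough. -/
theorem exists_perm_maps_into {A B D : Set C} (hB : B.Finite) (hD : D.Finite) (hAB : A ⊆ B)
    (hAD : A ⊆ D) (hcard : B.ncard ≤ D.ncard) :
    ∃ ρ : Equiv.Perm C, (∀ a ∈ A, ρ a = a) ∧ ∀ b ∈ B, ρ b ∈ D := by
  classical
  -- The target `t` lies between `A` and `D` and has as many elements as `B`; the identity on `A`
  -- then extends to a bijection from `B` onto `t`.
  obtain ⟨t, hAt, htD, ht⟩ := Set.exists_subsuperset_card_eq hAD (Set.ncard_le_ncard hAB hB) hcard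
  have htf := hD.subset htD
  have := hB.fintype
  have := htf.fintype
  have hmem : ∀ x, x ∈ t.toFinset ↔ x ∈ t := fun x => Set.mem_toFinset
  obtain ⟨e, he⟩ := Finset.exists_equiv_extend_of_card_eq (α := B) (t := t.toFinset)
    (by rw [Set.toFinset_card, ← Nat.card_eq_fintype_card, ← Nat.card_eq_fintype_card]; exact ht.symm)
    (s := Finset.univ.filter fun b : B => b.1 ∈ A) (f := fun b => b.1)
    (by
      intro c hc
      obtain ⟨b, hb, rfl⟩ := Finset.mem_image.1 hc
      exact (hmem _).2 (hAt (Finset.mem_filter.1 hb).2))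
    Subtype.val_injective.injOn
  have := (hB.union htf).fintype
  -- A bijection between two subsets of the finite set `B ∪ t` extends to a permutation of `B ∪ t`,
  -- which is the identity on all other constants.
  let e' : {u : {c // c ∈ B ∪ t} // u.1 ∈ B} ≃ {u : {c // c ∈ B ∪ t} // u.1 ∈ t} :=
    { toFun := fun u => ⟨⟨(e ⟨u.1.1, u.2⟩).1, .inr ((hmem _).1 (e ⟨u.1.1, u.2⟩).2)⟩,
        (hmem _).1 (e ⟨u.1.1, u.2⟩).2⟩
      invFun := fun u => ⟨⟨(e.symm ⟨u.1.1, (hmem _).2 u.2⟩).1,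
        .inl (e.symm ⟨u.1.1, (hmem _).2 u.2⟩).2⟩, (e.symm ⟨u.1.1, (hmem _).2 u.2⟩).2⟩
      left_inv := fun u => by simp
      right_inv := fun u => by simp }
  have hρ : ∀ b (hb : b ∈ B), Equiv.Perm.ofSubtype e'.extendSubtype b = (e ⟨b, hb⟩).1 := by
    intro b hb
    rw [Equiv.Perm.ofSubtype_apply_of_mem _ (p := fun c => c ∈ B ∪ t) (.inl hb),
      Equiv.extendSubtype_apply_of_mem e' ⟨b, .inl hb⟩ hb]
    rfl
  refine ⟨Equiv.Perm.ofSubtype e'.extendSubtype, fun a ha => ?_, fun b hb => ?_⟩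
  · rw [hρ a (hAB ha)]
    exact he ⟨a, hAB ha⟩ (Finset.mem_filter.2 ⟨Finset.mem_univ _, ha⟩)
  · rw [hρ b hb]
    exact htD ((hmem _).1 (e ⟨b, hb⟩).2)

/-- There are finitely many lists of bounded length over a finite set. -/
theorem finite_lists {A : Set C} (hA : A.Finite) (n : ℕ) :
    {l : List C | l.length ≤ n ∧ ∀ a ∈ l, a ∈ A}.Finite := by
  have := hA.to_subtype
  refine ((List.finite_length_le A n).image (List.map Subtype.val)).subset fun l hl => ?_
  refine ⟨l.attach.map fun a => ⟨a.1, hl.2 a.1 a.2⟩, by simpa using hl.1, by simp⟩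

/-- There are finitely many tuples that conform to a list of arities and are over a finite set. -/
theorem finite_calls (F : List ℕ) {A : Set C} (hA : A.Finite) :
    {t : ℕ × List C | F[t.1]? = some t.2.length ∧ ∀ a ∈ t.2, a ∈ A}.Finite := by
  -- The sum of the arities is a common bound for the lengths.
  refine ((Set.finite_lt_nat F.length).prod (finite_lists hA F.sum)).subset ?_
  rintro ⟨f, l⟩ ⟨h1, h2⟩
  obtain ⟨h3, h4⟩ := List.getElem?_eq_some_iff.1 h1
  exact ⟨h3, h4 ▸ List.le_sum_of_mem (List.getElem_mem h3), h2⟩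

end

/-! ### Genericity of transitions, and moving new results into a finite set -/

namespace DCDS
variable {C : Type*} [Denumerable C] {S : DCDS C}

theorem WellFormed.moves_rename (hS : S.WellFormed) {π : Equiv.Perm C}
    (hπ : ∀ c ∈ adom S.initInst, π c = c) {I : Instance C} {E : Set (RelAtom (GroundTerm C))}
    (hE : E ∈ S.moves I) : renameFacts π E ∈ S.moves (I.rename π) := by
  obtain ⟨r, hr, α, hα, σ, hσ, rfl⟩ := hS.mem_moves.1 hE
  have hα' := (hS.action_mem hr hα).1
  refine hS.mem_moves.2 ⟨r, hr, α, hα, π ∘ σ,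
    (Query.mem_ans_rename fun c hc => hπ c ((hS.rule r hr).2.1 hc)).2 hσ, ?_⟩
  exact (Action.doo_rename (fun e he c hc => hπ c ((hS.effect_query α hα' e he).2.2.2.1 hc))
    fun e he F hF t ht c hc => hπ c (((hS.effect_facts α hα' e he F hF).2 t ht).2.1 hc)).symm

/-- All constants in the description are initially active and thus fixed, and new results are
arbitrary, so a step remains a step when both of its states are renamed. -/
theorem WellFormed.exec_rename (hS : S.WellFormed) {π : Equiv.Perm C}
    (hπ : ∀ c ∈ adom S.initInst, π c = c) {s s' : CState C} (h : S.Exec s s') :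
    S.Exec (s.rename π) (s'.rename π) := by
  obtain ⟨E, hE, hcalls, hinst, hsat⟩ := hS.exec_iff.1 h
  refine hS.exec_iff.2 ⟨_, hS.moves_rename hπ hE, hcalls.rename, ?_, fun ec hec => ?_⟩
  · simp only [CState.rename]
    rw [hinst, CallMap.apply_rename]
  · exact EqConstraint.sat_rename (fun c hc => hπ c ((hS.constraint_query ec hec).2 hc))
      (fun e he c hc => hπ c ((hS.constraint_eqs ec hec e he).2 hc)) (hsat ec hec)

theorem mem_vals_iff {M : CallMap C} {c : C} :
    c ∈ S.vals M.graph ↔ c ∈ adom S.initInst ∨ ∃ t, M t = some c := by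
  simp [vals, CallMap.graph]

theorem vals_rename {π : Equiv.Perm C} (hπ : ∀ c ∈ adom S.initInst, π c = c) (M : CallMap C) :
    S.vals (M.rename π).graph = π '' S.vals M.graph := by
  have key : ∀ c, (∃ t, M.rename π t = some (π c)) ↔ ∃ t, M t = some c := fun c => by
    constructor
    · rintro ⟨⟨f, l⟩, h⟩
      obtain ⟨d, hd, h⟩ := Option.map_eq_some_iff.1 h
      exact ⟨_, π.injective h ▸ hd⟩
    · rintro ⟨⟨f, l⟩, h⟩
      exact ⟨(f, l.map π), by rw [CallMap.rename_map, h]; rfl⟩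
  have hfix : ∀ c, π c ∈ adom S.initInst ↔ c ∈ adom S.initInst := fun c =>
    ⟨fun h => by have := π.injective (hπ _ h); rwa [this] at h, fun h => (hπ c h).symm ▸ h⟩
  ext c
  obtain ⟨c, rfl⟩ := π.surjective c
  rw [π.injective.mem_set_image, mem_vals_iff, mem_vals_iff, hfix, key]

theorem finite_adom_init : (adom S.initInst).Finite := by
  refine (S.init.flatMap RelAtom.args).finite_toSet.subset ?_
  rintro c ⟨f, hf, hc⟩
  exact List.mem_flatMap.2 ⟨f, hf, hc⟩

theorem finite_dom (a : ℕ) : (S.dom a).Finite := by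
  refine finite_adom_init.union (((Set.finite_lt_nat a).image (ofNat C)).subset fun c hc => ?_)
  exact ⟨encode c, hc, ofNat_encode c⟩

/-- The arguments of new calls are values that the state already refers to. This gives finiteness of
the set of new calls, and later a bound on its size. -/
theorem WellFormed.newCalls_subset (hS : S.WellFormed) {s : CState C} (h : S.Invariant s)
    {E : Set (RelAtom (GroundTerm C))} (hE : E ∈ S.moves s.inst) :
    newCalls E s.map.graph ⊆ {t | S.services[t.1]? = some t.2.length ∧
      ∀ a ∈ t.2, a ∈ S.vals s.map.graph} := by
  intro t ht
  obtain ⟨g, hg, h1⟩ := (mem_newCalls_graph.1 ht).1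
  obtain ⟨h2, h3⟩ := (hS.within_of_mem_moves hE hg).2 _ h1
  exact ⟨h2, fun a ha => (h3 a ha).elim .inl fun h' => h.adom_subset h'⟩

theorem invariant_rename {π : Equiv.Perm C} (hπ : ∀ c ∈ adom S.initInst, π c = c) {s : CState C}
    (h : S.Invariant s) : S.Invariant (s.rename π) where
  adom_subset := by
    simp only [CState.rename, adom_rename, vals_rename hπ]
    exact Set.image_mono h.adom_subset
  conforms := by
    rintro _ ⟨f, hf, rfl⟩
    simpa [RelAtom.Conforms, RelAtom.rename] using h.conforms f hf
  calls := by
    rintro ⟨f, l⟩ c hc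
    obtain ⟨l, rfl⟩ := exists_eq_map_perm π l
    simp only [CState.rename] at hc ⊢
    rw [CallMap.rename_map] at hc
    obtain ⟨d, hd, rfl⟩ := Option.map_eq_some_iff.1 hc
    obtain ⟨h1, h2⟩ := h.calls _ d hd
    refine ⟨by simpa using h1, fun a ha => ?_⟩
    obtain ⟨b, hb, rfl⟩ := List.mem_map.1 ha
    rw [vals_rename hπ]
    exact ⟨b, h2 b hb, rfl⟩

/-- The values of the states after a transition can be moved into `D` if there is room. -/
theorem WellFormed.exists_rename_into (hS : S.WellFormed) {D : Set C} (hD : D.Finite)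
    {t t' : CState C} (ht : S.Invariant t) (hvals : S.vals t.map.graph ⊆ D)
    (hroom : S.Roomy D t.toG) (h : S.Exec t t') :
    ∃ ρ : Equiv.Perm C, (∀ c ∈ S.vals t.map.graph, ρ c = c) ∧
      S.Exec t (t'.rename ρ) ∧ S.vals (CallMap.graph (t'.rename ρ).map) ⊆ D := by
  obtain ⟨E, hE, hcalls, -, -⟩ := hS.exec_iff.1 h
  have hfin := hD.subset hvals
  have hN : (newCalls E t.map.graph).Finite :=
    (finite_calls _ hfin).subset (hS.newCalls_subset ht hE)
  have hsub : S.vals t'.map.graph ⊆ S.vals t.map.graph ∪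
      (fun u => (t'.map u).getD (defaultFun ℕ C 0)) '' newCalls E t.map.graph := by
    intro c hc
    rcases mem_vals_iff.1 hc with hc | ⟨u, hu⟩
    · exact .inl (.inl hc)
    · by_cases hn : t.map u = none
      · refine .inr ⟨u, mem_newCalls_graph.2 ⟨?_, hn⟩, by simp [hu]⟩
        exact ((hcalls.2 u).1 (by simp [hu])).resolve_left (by simp [hn])
      · obtain ⟨d, hd⟩ := Option.ne_none_iff_exists'.1 hn
        have := hcalls.1 u d hd
        rw [hu] at this
        exact .inl (mem_vals_of_eq_some (by rw [hd, ← this]))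
  have hfin' := hfin.union (hN.image fun u => (t'.map u).getD (defaultFun ℕ C 0))
  -- Each new call adds at most one value, and `Roomy` provides that many places in `D` beyond the
  -- old values.
  have hcard : (S.vals t'.map.graph).ncard ≤ D.ncard :=
    calc _ ≤ _ := Set.ncard_le_ncard hsub hfin'
      _ ≤ _ := Set.ncard_union_le _ _
      _ ≤ _ := Nat.add_le_add_left (Set.ncard_image_le hN) _
      _ ≤ _ := hroom E hE
  obtain ⟨ρ, h1, h2⟩ := exists_perm_maps_into (hfin'.subset hsub) hD
    (vals_mono hcalls.1) hvals hcard
  have hρ : ∀ c ∈ adom S.initInst, ρ c = c := fun c hc => h1 c (.inl hc)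
  refine ⟨ρ, h1, ?_, ?_⟩
  -- The permutation `ρ` fixes all values that `t` refers to, so it maps `t` to itself and only
  -- changes the target of the step.
  · have := hS.exec_rename hρ h
    rwa [CState.rename_congr (ρ := Equiv.refl C) (S.vals t.map.graph) ht.adom_subset
      (fun u c hu => ⟨mem_vals_of_eq_some hu, (ht.calls u c hu).2⟩) h1, CState.rename_refl] at this
  · simp only [CState.rename]
    rw [vals_rename hρ]
    exact Set.image_subset_iff.2 h2

end DCDS
end DataCentric

namespace DataCentric
set_option linter.unusedSectionVars false
open Encodable Denumerable

/-! ### The finite abstraction is bisimilar to the concrete transition system -/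

namespace DCDS
variable {C : Type*} [Denumerable C] {S : DCDS C}

theorem mem_edgeList {D : Set C} {Xs : List (GState C)} {i j : ℕ} :
    (i, j) ∈ S.edgeList D Xs ↔ ∃ X Y, Xs[i]? = some X ∧ Xs[j]? = some Y ∧ Y ∈ S.succs D X := by
  simp only [edgeList, List.mem_flatMap]
  constructor
  · rintro ⟨⟨X, i'⟩, hX, ⟨Y, j'⟩, hY, h⟩
    split_ifs at h with hXY
    · obtain ⟨rfl, rfl⟩ := Prod.mk.inj (List.mem_singleton.1 h)
      exact ⟨X, Y, List.mem_zipIdx_iff_getElem?.1 hX, List.mem_zipIdx_iff_getElem?.1 hY, hXY⟩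
    · simp at h
  · rintro ⟨X, Y, hX, hY, hXY⟩
    exact ⟨(X, i), List.mem_zipIdx_iff_getElem?.2 hX, (Y, j), List.mem_zipIdx_iff_getElem?.2 hY,
      by simp [hXY]⟩

theorem layer_mono (a : ℕ) : Monotone (S.layer a) :=
  monotone_nat_of_le_succ fun _ => Set.subset_union_left

theorem initG_mem_layer (a k : ℕ) : S.initG ∈ S.layer a k :=
  layer_mono a (Nat.zero_le k) rfl

theorem toG_initState : S.initState.toG = S.initG := by
  simp [CState.toG, initState, initG, CallMap.graph]

/-- Abstract runs are particular concrete runs, so the invariants of reachable concrete states hold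
for abstract states. -/
theorem WellFormed.exists_reachable_of_mem_layer (hS : S.WellFormed) {a k : ℕ} {X : GState C}
    (hX : X ∈ S.layer a k) : ∃ s, S.Reachable s ∧ s.toG = X ∧
      ∀ t c, s.map t = some c → c ∈ S.dom a := by
  induction k generalizing X with
  | zero =>
    obtain rfl : X = S.initG := hX
    exact ⟨_, .init, toG_initState, fun t c h => by simp [initState] at h⟩
  | succ k ih =>
    rcases hX with hX | ⟨Y, hY, hX⟩
    · exact ih hX
    · obtain ⟨s, hs, rfl, hd⟩ := ih hY
      obtain ⟨s', hs', rfl, h⟩ := hS.mem_succs.1 hX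
      exact ⟨s', hs.step hs', rfl, fun t c htc => (h t c htc).elim (hd t c) id⟩

variable {F : FinTS C} {a k : ℕ} {Xs : List (GState C)}

theorem IsAbstraction.labels_cons (h : S.IsAbstraction F a k Xs) :
    List.Forall₂ (fun X l => X.1 = {f | f ∈ l}) (S.initG :: Xs) (F.initLabel :: F.labels) :=
  .cons (by rw [h.initLabel]; rfl) h.labels

theorem IsAbstraction.db_eq (h : S.IsAbstraction F a k Xs) {j : F.toTS.State} {X : GState C}
    (hX : (S.initG :: Xs)[j.1]? = some X) : F.toTS.db j = X.1 := by
  obtain ⟨hj, rfl⟩ := List.getElem?_eq_some_iff.1 hX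
  exact (h.labels_cons.get hj j.2).symm

theorem IsAbstraction.mem_layer (h : S.IsAbstraction F a k Xs) {X : GState C}
    (hX : X ∈ S.initG :: Xs) : X ∈ S.layer a k := by
  rcases List.mem_cons.1 hX with rfl | hX
  · exact initG_mem_layer a k
  · rw [h.states]
    exact hX

theorem IsAbstraction.conforms (h : S.IsAbstraction F a k Xs) (hS : S.WellFormed) :
    F.Conforms S.schema := by
  intro l hl f hf
  obtain ⟨j, hj, rfl⟩ := List.mem_iff_getElem.1 hl
  have hj' : j < (S.initG :: Xs).length := by rw [h.labels_cons.length_eq]; exact hj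
  have hX := h.labels_cons.get hj' hj
  obtain ⟨s, hs, he, -⟩ := hS.exists_reachable_of_mem_layer (h.mem_layer (List.get_mem _ ⟨j, hj'⟩))
  rw [← he] at hX
  refine (hS.invariant hs).conforms f ?_
  have hfX : f ∈ s.toG.1 := by rw [hX]; exact hf
  exact hfX

theorem vals_subset_dom {s : CState C} (h : ∀ t c, s.map t = some c → c ∈ S.dom a) :
    S.vals s.map.graph ⊆ S.dom a := fun _ hc =>
  (mem_vals_iff.1 hc).elim .inl fun ⟨t, ht⟩ => h t _ ht

/-- A concrete state, after renaming, is a state of the abstraction. -/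
structure Matches (S : DCDS C) (F : FinTS C) (a : ℕ) (Xs : List (GState C)) (π : Equiv.Perm C)
    (s : S.cts.State) (j : F.toTS.State) : Prop where
  fixed : ∀ c ∈ adom S.initInst, π c = c
  entry : (S.initG :: Xs)[j.1]? = some (s.1.rename π).toG
  results : ∀ t c, (s.1.rename π).map t = some c → c ∈ S.dom a

theorem matches_init : S.Matches F a Xs (Equiv.refl C) S.cts.init F.toTS.init where
  fixed _ _ := rfl
  entry := by
    show some S.initG = some (S.initState.rename _).toG
    rw [CState.rename_refl, toG_initState]
  results t c h := by
    simp [CState.rename, CallMap.rename, cts, initState] at h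

/-- The step is first renamed by `π`, so that it starts in the abstract state, and its new results
are then moved into `S.dom a` by `ρ`. Room for this, and the presence of the target in the list, are
the two halves of `Complete`. -/
theorem IsAbstraction.forth (h : S.IsAbstraction F a k Xs) (hS : S.WellFormed)
    {π : Equiv.Perm C} {s s' : S.cts.State} {j : F.toTS.State} (hm : S.Matches F a Xs π s j)
    (hs : S.cts.Step s s') : ∃ π' j', F.toTS.Step j j' ∧ S.Matches F a Xs π' s' j' ∧
      ∀ c ∈ S.vals s.1.map.graph, π' c = π c := by
  have hlayer := h.mem_layer (List.mem_of_getElem? hm.entry)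
  obtain ⟨hsub, hroom⟩ := h.complete _ hlayer
  obtain ⟨ρ, hρ, hexec, hvals⟩ := hS.exists_rename_into (finite_dom a)
    (invariant_rename hm.fixed (hS.invariant s.2)) (vals_subset_dom hm.results) hroom
    (hS.exec_rename hm.fixed hs)
  have hsucc : ((s'.1.rename π).rename ρ).toG ∈ S.succs (S.dom a) (s.1.rename π).toG :=
    hS.mem_succs.2 ⟨_, hexec, rfl, fun t c htc => .inr (hvals (mem_vals_of_eq_some htc))⟩
  have hmem := hsub hsucc
  rw [h.states] at hmem
  -- The target has number `i + 1`, since the initial state stands in front of `Xs`. That it occurs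
  -- in `Xs` once more is harmless: equal entries have the same successors.
  obtain ⟨i, hi, hX⟩ := List.mem_iff_getElem.1 hmem
  have hentry : (S.initG :: Xs)[i + 1]? = some ((s'.1.rename π).rename ρ).toG := by
    rw [List.getElem?_cons_succ, List.getElem?_eq_getElem hi, hX]
  refine ⟨π.trans ρ, ⟨i + 1, ?_⟩, ?_, ⟨fun c hc => ?_, ?_, ?_⟩, fun c hc => hρ _ ?_⟩
  · simpa [← h.labels.length_eq] using hi
  · show (j.1, i + 1) ∈ F.edges
    rw [h.edges]
    exact mem_edgeList.2 ⟨_, _, hm.entry, hentry, hsucc⟩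
  · rw [Equiv.trans_apply, hm.fixed c hc]
    exact hρ c (.inl hc)
  · rw [CState.rename_trans]
    exact hentry
  · rw [CState.rename_trans]
    exact fun t c htc => hvals (mem_vals_of_eq_some htc)
  · simp only [CState.rename]
    rw [vals_rename hm.fixed]
    exact ⟨c, hc, rfl⟩

/-- An abstract step is a concrete step from the renamed state, and the inverse renaming carries it
back. The renaming itself need not change. -/
theorem IsAbstraction.back (h : S.IsAbstraction F a k Xs) (hS : S.WellFormed)
    {π : Equiv.Perm C} {s : S.cts.State} {j j' : F.toTS.State} (hm : S.Matches F a Xs π s j)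
    (hj : F.toTS.Step j j') : ∃ s', S.cts.Step s s' ∧ S.Matches F a Xs π s' j' := by
  have hedge : (j.1, j'.1) ∈ S.edgeList (S.dom a) (S.initG :: Xs) := h.edges ▸ hj
  obtain ⟨X, Y, hX, hY, hXY⟩ := mem_edgeList.1 hedge
  obtain rfl : (s.1.rename π).toG = X := Option.some.inj (hm.entry.symm.trans hX)
  obtain ⟨t', ht', rfl, hd⟩ := hS.mem_succs.1 hXY
  have hexec := hS.exec_rename (π := π.symm)
    (fun c hc => (Equiv.symm_apply_eq π).2 (hm.fixed c hc).symm) ht'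
  rw [CState.rename_symm_rename] at hexec
  refine ⟨⟨t'.rename π.symm, s.2.step hexec⟩, hexec, ⟨hm.fixed, ?_, ?_⟩⟩
  · rw [CState.rename_rename_symm]
    exact hY
  · rw [CState.rename_rename_symm]
    exact fun t c htc => (hd t c htc).elim (hm.results t c) id

/-- The history of a concrete state consists of the initial constants and all stored results. It
contains the active domain by the invariant, and it grows because deterministic services never lose
results. -/
theorem IsAbstraction.isHistoryBisim (h : S.IsAbstraction F a k Xs) (hS : S.WellFormed) :
    IsHistoryBisim S.cts F.toTS (adom S.initInst) (fun s => S.vals s.1.map.graph)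
      (S.Matches F a Xs) where
  fixed hm := hm.fixed
  db hm := h.db_eq hm.entry
  live {_ s _} _ := (hS.invariant s.2).adom_subset
  forth {_ s _ _} hm hs := by
    obtain ⟨π', j', h1, h2, h3⟩ := h.forth hS hm hs
    exact ⟨π', j', h1, h2, h3, vals_mono (hS.invariant_step (hS.invariant s.2) hs).2⟩
  back {π s _ _} hm hj := by
    obtain ⟨s', hs, h2⟩ := h.back hS hm hj
    exact ⟨π, s', hs, h2, fun _ _ => rfl, vals_mono (hS.invariant_step (hS.invariant s.2) hs).2⟩

theorem IsAbstraction.satisfies_iff (h : S.IsAbstraction F a k Xs) (hS : S.WellFormed)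
    {Φ : MuLA C} (hΦ : Φ.IsSentence) (hK : Φ.consts ⊆ adom S.initInst) :
    S.cts.Satisfies Φ ↔ F.toTS.Satisfies Φ :=
  have : Nonempty C := ⟨ofNat C 0⟩
  (h.isHistoryBisim hS).satisfies_iff matches_init hΦ hK

end DCDS
end DataCentric

namespace DataCentric
set_option linter.unusedSectionVars false
open Encodable Denumerable

/-! ### Run-bounded systems have finite abstractions -/

theorem map_eq_map_of_injOn {α β : Type*} {e : α → β} {A : Set α} (he : Set.InjOn e A)
    {l k : List α} (hl : ∀ a ∈ l, a ∈ A) (hk : ∀ a ∈ k, a ∈ A) (h : l.map e = k.map e) : l = k := by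
  induction l generalizing k with
  | nil => exact (List.map_eq_nil_iff.1 h.symm).symm
  | cons a l ih =>
    cases k with
    | nil => simp at h
    | cons b k =>
      simp only [List.map_cons, List.cons.injEq] at h
      simp only [List.forall_mem_cons] at hl hk
      rw [he hl.1 hk.1 h.1, ih hl.2 hk.2 h.2]

namespace DCDS
variable {C : Type*} [Denumerable C] {S : DCDS C}

/-- All results of service calls occur in the instance after the step in which they are made. -/
theorem WellFormed.mem_adom_of_new (hS : S.WellFormed) {s s' : CState C} (h : S.Exec s s')
    {t : ℕ × List C} {c : C} (hs : s.map t = none) (hs' : s'.map t = some c) :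
    c ∈ adom s'.inst := by
  obtain ⟨E, hE, hcalls, hinst, -⟩ := hS.exec_iff.1 h
  obtain ⟨g, hg, ht⟩ := ((hcalls.2 t).1 (by simp [hs'])).resolve_left (by simp [hs])
  -- A result is visible only if the whole fact containing the call gets a value. All calls in it
  -- are answered, so the default is never used on its arguments.
  let val : GroundTerm C → C := fun u => (u.value s'.map).getD (ofNat C 0)
  have hval : ∀ u ∈ g.args, u.value s'.map = some (val u) := fun u hu => by
    cases u with
    | val d => rfl
    | call f l =>
      obtain ⟨d, hd⟩ := Option.isSome_iff_exists.1 ((hcalls.2 (f, l)).2 (.inr ⟨g, hg, hu⟩))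
      have : (GroundTerm.call f l).value s'.map = some d := hd
      simp [val, this]
  refine ⟨⟨g.rel, g.args.map val⟩, ?_, List.mem_map.2 ⟨_, ht, ?_⟩⟩
  · rw [hinst]
    exact ⟨g, hg, rfl, List.forall₂_map_right_iff.2 (List.forall₂_same.2 hval)⟩
  · have : (GroundTerm.call t.1 t.2).value s'.map = some c := hs'
    simp [val, this]

/-- Every reachable state ends a run in which all values that the state refers to occur. -/
theorem WellFormed.exists_run (hS : S.WellFormed) {s : CState C} (h : S.Reachable s) :
    ∃ (n : ℕ) (τ : ℕ → S.cts.State), S.cts.IsRun n τ ∧ (τ n).1 = s ∧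
      S.vals s.map.graph ⊆ {c | ∃ i : ℕ, (i : ℕ∞) ≤ n ∧ c ∈ adom (S.cts.db (τ i))} := by
  induction h with
  | init =>
    refine ⟨0, fun _ => S.cts.init, ⟨rfl, fun i hi => by simp at hi⟩, rfl, fun c hc => ?_⟩
    rcases mem_vals_iff.1 hc with hc | ⟨t, ht⟩
    · exact ⟨0, le_rfl, hc⟩
    · simp [initState] at ht
  | @step s s' hs hexec ih =>
    obtain ⟨n, τ, ⟨h0, hstep⟩, hn, hvals⟩ := ih
    -- The run is prolonged by one step; its values after index `n + 1` are irrelevant.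
    let τ' : ℕ → S.cts.State := fun i => if i ≤ n then τ i else ⟨s', hs.step hexec⟩
    have hle : ∀ i ≤ n, τ' i = τ i := fun i hi => if_pos hi
    have hlast : τ' (n + 1) = ⟨s', hs.step hexec⟩ := if_neg (by omega)
    refine ⟨n + 1, τ', ⟨(hle 0 (Nat.zero_le n)).trans h0, fun i hi => ?_⟩, by rw [hlast], ?_⟩
    · have hi' : i ≤ n := Nat.lt_succ_iff.1 (by exact_mod_cast hi)
      rw [hle i hi']
      rcases hi'.lt_or_eq with hlt | rfl
      · rw [hle (i + 1) hlt]
        exact hstep i (by exact_mod_cast hlt)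
      · rw [hlast]
        show S.Exec (τ i).1 s'
        rw [hn]
        exact hexec
    · have hold : ∀ c ∈ S.vals s.map.graph,
          ∃ i : ℕ, (i : ℕ∞) ≤ (n + 1 : ℕ) ∧ c ∈ adom (S.cts.db (τ' i)) := fun c hc => by
        obtain ⟨i, hi, hc⟩ := hvals hc
        have hi' : i ≤ n := by exact_mod_cast hi
        exact ⟨i, by exact_mod_cast hi'.trans (Nat.le_succ n), by rwa [hle i hi']⟩
      intro c hc
      rcases mem_vals_iff.1 hc with hc | ⟨t, ht⟩
      · exact hold c (.inl hc)
      -- A result of a new call occurs in the last instance; an old result occurs earlier in the run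
      -- by the induction hypothesis.
      · cases hst : s.map t with
        | none =>
          refine ⟨n + 1, le_rfl, ?_⟩
          rw [hlast]
          exact hS.mem_adom_of_new hexec hst ht
        | some d =>
          have := (hS.invariant_step (hS.invariant hs) hexec).2 t d hst
          obtain rfl : c = d := Option.some.inj (ht.symm.trans this)
          exact hold c (mem_vals_of_eq_some hst)

/-- In a run-bounded system, the number of values that a state refers to is bounded. -/
theorem WellFormed.exists_encard_vals_lt (hS : S.WellFormed) (hb : S.cts.RunBounded) :
    ∃ b : ℕ, ∀ s, S.Reachable s → (S.vals s.map.graph).encard < b := by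
  obtain ⟨b, hb⟩ := hb
  refine ⟨b, fun s hs => ?_⟩
  obtain ⟨n, τ, hτ, -, hsub⟩ := hS.exists_run hs
  exact (Set.encard_le_encard hsub).trans_lt (hb n τ hτ)

/-- In a run-bounded system, the number of new service calls in a step is bounded. -/
theorem WellFormed.exists_ncard_newCalls_le (hS : S.WellFormed) {b : ℕ}
    (hb : ∀ s, S.Reachable s → (S.vals s.map.graph).encard < b) :
    ∃ K : ℕ, ∀ s, S.Reachable s → ∀ E ∈ S.moves s.inst, (newCalls E s.map.graph).ncard ≤ K := by
  -- The bound counts calls on the numbers below `b` instead of constants, so that it does not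
  -- depend on the state. The values of a state inject into these numbers.
  have hfin := finite_calls S.services (Set.finite_lt_nat b)
  refine ⟨Set.ncard {t : ℕ × List ℕ | S.services[t.1]? = some t.2.length ∧
    ∀ a ∈ t.2, a ∈ {i | i < b}}, fun s hs E hE => ?_⟩
  have hV := hb s hs
  have hVf : (S.vals s.map.graph).Finite := Set.encard_lt_top_iff.1 (hV.trans_le le_top)
  have hcard : ({i | i < b} : Set ℕ).encard = b := by
    have : ({i | i < b} : Set ℕ) = (Finset.range b : Set ℕ) := by ext; simp
    rw [this, Set.encard_coe_eq_coe_finsetCard, Finset.card_range]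
  obtain ⟨e, he, hinj⟩ := hVf.exists_injOn_of_encard_le (t := {i : ℕ | i < b})
    (by rw [hcard]; exact hV.le)
  have hsub := hS.newCalls_subset (hS.invariant hs) hE
  refine Set.ncard_le_ncard_of_injOn (fun t => (t.1, t.2.map e)) (fun t ht => ?_) ?_ hfin
  · obtain ⟨h1, h2⟩ := hsub ht
    refine ⟨by simpa using h1, fun a ha => ?_⟩
    obtain ⟨c, hc, rfl⟩ := List.mem_map.1 ha
    exact he (h2 c hc)
  · rintro ⟨f, l⟩ ht ⟨g, k⟩ hu h
    simp only [Prod.mk.injEq] at h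
    exact Prod.ext h.1 (map_eq_map_of_injOn hinj (hsub ht).2 (hsub hu).2 h.2)

/-- Over the finite set `S.dom a` there are finitely many facts that conform to the schema and
finitely many calls with results, hence finitely many pairs of an instance and a graph. -/
theorem WellFormed.finite_iUnion_layer (hS : S.WellFormed) (a : ℕ) :
    (⋃ k, S.layer a k).Finite := by
  have hD := finite_dom (S := S) a
  have hA := (finite_calls S.schema hD).image fun t => RelAtom.mk t.1 t.2
  have hB := (finite_calls S.services hD).prod hD
  refine (hA.finite_subsets.prod hB.finite_subsets).subset fun X hX => ?_
  obtain ⟨k, hk⟩ := Set.mem_iUnion.1 hX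
  obtain ⟨s, hs, rfl, hd⟩ := hS.exists_reachable_of_mem_layer hk
  have hinv := hS.invariant hs
  have hvals := vals_subset_dom hd
  refine ⟨fun f hf => ⟨(f.rel, f.args), ⟨hinv.conforms f hf, fun c hc =>
    hvals (hinv.adom_subset ⟨f, hf, hc⟩)⟩, rfl⟩, fun p hp => ?_⟩
  obtain ⟨h1, h2⟩ := hinv.calls p.1 p.2 hp
  exact ⟨⟨h1, fun c hc => hvals (h2 c hc)⟩, hd p.1 p.2 hp⟩

/-- Pigeonhole: the layers are subsets of a finite set, so two of them coincide, and by monotonicity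
the chain is constant between them. -/
theorem WellFormed.exists_layer_succ_subset (hS : S.WellFormed) (a : ℕ) :
    ∃ k, S.layer a (k + 1) ⊆ S.layer a k := by
  have := ((hS.finite_iUnion_layer a).finite_subsets).to_subtype
  obtain ⟨i, j, hij, h⟩ := Finite.exists_ne_map_eq_of_infinite
    fun k => (⟨S.layer a k, Set.subset_iUnion (S.layer a) k⟩ : {A | A ⊆ ⋃ k, S.layer a k})
  have h : S.layer a i = S.layer a j := congrArg Subtype.val h
  rcases hij.lt_or_gt with hlt | hlt
  · exact ⟨i, (layer_mono a hlt).trans h.ge⟩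
  · exact ⟨j, (layer_mono a hlt).trans h.le⟩

theorem le_ncard_dom (a : ℕ) : a ≤ (S.dom a).ncard := by
  have hsub : ofNat C '' (Finset.range a : Set ℕ) ⊆ S.dom a := by
    rintro _ ⟨i, hi, rfl⟩
    exact .inr (by simpa using hi)
  have := Set.ncard_le_ncard hsub (finite_dom a)
  rwa [Set.ncard_image_of_injective _ (f := ofNat C) (Denumerable.eqv C).symm.injective, Set.ncard_coe_finset,
    Finset.card_range] at this

/-- With at most `b` values in a state and at most `K` new calls in a step, `b + K` constants leave
room at every reachable state. For this domain a layer is chosen after which nothing new appears. -/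
theorem WellFormed.exists_complete (hS : S.WellFormed) (hb : S.cts.RunBounded) :
    ∃ a k, S.Complete a k := by
  obtain ⟨b, hb⟩ := hS.exists_encard_vals_lt hb
  obtain ⟨K, hK⟩ := hS.exists_ncard_newCalls_le hb
  obtain ⟨k, hk⟩ := hS.exists_layer_succ_subset (b + K)
  refine ⟨b + K, k, fun X hX => ⟨fun Y hY => hk (.inr ⟨X, hX, hY⟩), fun E hE => ?_⟩⟩
  obtain ⟨s, hs, rfl, -⟩ := hS.exists_reachable_of_mem_layer hX
  have h1 : (S.vals s.map.graph).ncard ≤ b := by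
    have h := (hb s hs).le
    rw [← (Set.encard_lt_top_iff.1 ((hb s hs).trans_le le_top)).cast_ncard_eq] at h
    exact_mod_cast h
  exact (Nat.add_le_add h1 (hK s hs E hE)).trans (le_ncard_dom _)

end DCDS
end DataCentric

/-! ### The two algorithms -/

namespace DataCentric
set_option linter.unusedSectionVars false
open Encodable Denumerable
open Represented (Names)

section
variable {C : Type*} [Denumerable C] [Represented C] [GodelNamed C]

/-- The reduction to model checking of the propositional mu-calculus, as an algorithm. -/
theorem exists_reduction_algorithm : ∃ red : ℕ →. ℕ, Partrec red ∧
    ∀ S : DCDS C, S.WellFormed → S.cts.RunBounded → ∃ F : FinTS C, F.Conforms S.schema ∧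
      ∀ Φ : MuLA C, Φ.IsSentence → Φ.consts ⊆ adom S.initInst →
        Nat.pair F.code (Φ.ground F.adomList).code ∈ red (Nat.pair S.code Φ.code) ∧
        (Φ.ground F.adomList).IsSentence ∧
        (S.cts.Satisfies Φ ↔ F.toTS.Satisfies Φ) ∧
        (F.toTS.Satisfies Φ ↔ F.toTS.toKripke.Satisfies (Φ.ground F.adomList)) := by
  obtain ⟨φ, hφ, h1⟩ := exists_abstraction_algorithm (C := C)
  obtain ⟨ψ, hψ, h2⟩ : Tracked fun p : FinTS C × MuLA C => p.2.ground p.1.adomList :=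
    .ground (by fun_prop) (by fun_prop)
  refine ⟨fun n => (φ n.unpair.1).bind fun m => (ψ (Nat.pair m n.unpair.2)).map (Nat.pair m),
    (hφ.comp (.fst_unpair .id)).bind (Partrec.map
      (hψ.comp (.natPair .snd (.snd_unpair .fst)))
      (Computable.natPair (Computable.snd.comp .fst) .snd).to₂),
    fun S hS hb => ?_⟩
  obtain ⟨F, a, k, Xs, hF, m, hm, hmF⟩ := h1 S (hS.exists_complete hb)
  refine ⟨F, hF.conforms hS, fun Φ hΦ hK => ⟨?_, hΦ.ground _, hF.satisfies_iff hS hΦ hK,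
    have : Nonempty C := ⟨ofNat C 0⟩; MuLA.satisfies_ground_iff hΦ⟩⟩
  obtain ⟨g, hg, hgn⟩ := h2 (Nat.pair m Φ.code) (F, Φ) (names_pair hmF (names_muLA_iff.2 rfl))
  -- The name `m` is the code of `F`, and `F` was obtained before the formula: one finite system
  -- serves all properties of `S`.
  obtain rfl := eq_finTS_code hmF
  have hgn : g = _ := hgn
  subst hgn
  refine Part.mem_bind (a := F.code) (by simpa using hm) ((Part.mem_map_iff _).2 ⟨_, ?_, rfl⟩)
  simpa using hg

/-- Verification is decidable. -/
theorem exists_decision_algorithm : ∃ dec : ℕ →. Bool, Partrec dec ∧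
    ∀ S : DCDS C, S.WellFormed → S.cts.RunBounded →
      ∀ Φ : MuLA C, Φ.IsSentence → Φ.consts ⊆ adom S.initInst →
        ∃ b ∈ dec (Nat.pair S.code Φ.code), (b = true ↔ S.cts.Satisfies Φ) := by
  obtain ⟨φ, hφ, h1⟩ := exists_abstraction_algorithm (C := C)
  obtain ⟨p, ⟨ψ, hψ, h2⟩, hp⟩ := tracked_satisfies (C := C)
  refine ⟨fun n => (φ n.unpair.1).bind fun m =>
      (ψ (Nat.pair m n.unpair.2)).map fun r => decide (r = 1),
    (hφ.comp (.fst_unpair .id)).bind (Partrec.map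
      (hψ.comp (.natPair .snd (.snd_unpair .fst)))
      ((PrimrecRel.decide (Primrec.eq (α := ℕ))).to_comp.comp .snd (.const 1))),
    fun S hS hb Φ hΦ hK => ?_⟩
  obtain ⟨F, a, k, Xs, hF, m, hm, hmF⟩ := h1 S (hS.exists_complete hb)
  obtain ⟨r, hr, hrn⟩ := h2 (Nat.pair m Φ.code) (F, Φ) (names_pair hmF (names_muLA_iff.2 rfl))
  refine ⟨decide (r = 1), Part.mem_bind (a := m) (by simpa using hm)
    ((Part.mem_map_iff _).2 ⟨r, by simpa using hr, rfl⟩), ?_⟩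
  rw [hF.satisfies_iff hS hΦ hK, ← hp F Φ hΦ]
  rcases hrn with ⟨rfl, h⟩ | ⟨rfl, h⟩ <;> simpa using h

end
end DataCentric

theorem mainTheorem2 {C : Type*} [Denumerable C] :
    -- verification is decidable: one algorithm answers for all run-bounded systems
    (∃ dec : ℕ →. Bool, Partrec dec ∧
      ∀ S : DataCentric.DCDS C, S.WellFormed → S.cts.RunBounded →
      ∀ Φ : DataCentric.MuLA C, Φ.IsSentence → Φ.consts ⊆ DataCentric.adom S.initInst →
        ∃ b ∈ dec (Nat.pair S.code Φ.code), (b = true ↔ S.cts.Satisfies Φ)) ∧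
    -- effective reduction to propositional model checking over a finite transition system
    (∃ red : ℕ →. ℕ, Partrec red ∧
      ∀ S : DataCentric.DCDS C, S.WellFormed → S.cts.RunBounded →
      ∃ F : DataCentric.FinTS C, F.Conforms S.schema ∧
      ∀ Φ : DataCentric.MuLA C, Φ.IsSentence → Φ.consts ⊆ DataCentric.adom S.initInst →
        Nat.pair F.code (Φ.ground F.adomList).code ∈ red (Nat.pair S.code Φ.code) ∧
        (Φ.ground F.adomList).IsSentence ∧
        (S.cts.Satisfies Φ ↔ F.toTS.Satisfies Φ) ∧
        (F.toTS.Satisfies Φ ↔ F.toTS.toKripke.Satisfies (Φ.ground F.adomList))) := by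
  -- Constants are named by their Gödel numbers, so that names agree with the codes in the
  -- statement.
  let _ : DataCentric.Represented C := ⟨fun n c => n = Encodable.encode c⟩
  have : DataCentric.GodelNamed C := ⟨Iff.rfl⟩
  exact ⟨DataCentric.exists_decision_algorithm, DataCentric.exists_reduction_algorithm⟩
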